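/- Let $l,m,k\ge 0$ be integers with $k\le n:=l+m$. Let $V=\mathbb C^{l+1}$ with the indefinite Hermitian form $(v,x)=v_0\bar x_0-\sum_{i=1}^l v_i\bar x_i$ and let $W=\mathbb C^{m+1}$ with its standard Hermitian inner product. Let $\mathbf H^l\subset\mathbf P(V)$ be the set of lines on which $(\cdot,\cdot)$ is positive, and give $M=\mathbf H^l\times\mathbf P(W)$ the product Kähler metric with Kähler form $\sqrt{-1}\,\partial\bar\partial\bigl(-\log(x,x)+\log(y,y)\bigr)$, where $x\in V$, $y\in W$ are local holomorphic lifts of the point of $M$. The twistor space $Z_k(M)$ is the Grassmann bundle of $k$-dimensional complex subspaces $L$ of the holomorphic tangent spaces of $M$, with the following almost complex structure $J$. The Chern (Levi-Civita) connection of $M$ splits the tangent space of $Z_k(M)$ at $(p,L)$ into a vertical part, on which $J$ is the natural complex structure of the Grassmannian, and a horizontal part, identified with $T_pM=L\oplus L^\perp$, on which $J$ is $-\sqrt{-1}$ on $L$ and $\sqrt{-1}$ on $L^\perp$. For $\kappa=(p,L)\in Z_k(M)$ let $x\in V$, $y\in W$ be affine lifts of the two components of $p$, regard tangent vectors at $p$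 as elements of $V\oplus W$ through the derivative of the affine lifts, and let $z\in\Lambda^k(V\oplus W)$ be a Plücker vector of $L$. For $a+b=k+1$ let $$\phi_{a,b}(\kappa)=\left. x\wedge\Bigl(1-\tfrac{y\wedge i(\bar y)}{(y,y)}\Bigr)z+y\wedge\Bigl(1-\tfrac{x\wedge i(\bar x)}{(x,x)}\Bigr)z\ \right|_{\Lambda^aV\otimes\Lambda^bW},$$ the component in the summand $\Lambda^aV\otimes\Lambda^bW$ of $\Lambda^{k+1}(V\oplus W)$, where $\bar x=(\cdot,x)\in V^*$, $\bar y=(\cdot,y)\in W^*$ and $i$ is interior multiplication; it is determined by $\kappa$ up to a nonzero factor. For $a,b\ge0$ with $a+b=k$ let $$U_{a,b}=\{\kappa\in Z_k(M)\mid\phi_{a+1,b}(\kappa)\ne0,\ \phi_{a,b+1}(\kappa)\ne0\},$$ $$\psi_{a,b}:U_{a,b}\to\mathbf P(\Lambda^{a+1}V\otimes\Lambda^bW)\times\mathbf P(\Lambda^aV\otimes\Lambda^{b+1}W),\qquad \psi_{a,b}(\kappa)=([\phi_{a+1,b}(\kappa)],[\phi_{a,b+1}(\kappa)]).$$ Then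 the sets $U_{a,b}$ with $a+b=k$ cover $Z_k(M)$, and for all $a,b\ge0$ with $a+b=k$: 1. $U_{a,b}$ is open, and $\psi_{a,b}$ is a smooth embedding: it is smooth, a homeomorphism onto its image (in particular injective), and its derivative is injective at every point. 2. $\psi_{a,b}$ is holomorphic: $d\psi_{a,b}\circ J=\sqrt{-1}\,d\psi_{a,b}$. 3. $\psi_{a,b}$ gives local holomorphic coordinates: every point of $U_{a,b}$ has an open neighbourhood $N\subset U_{a,b}$ with a smooth chart $e$ of $Z_k(M)$ on $N$, with values in the complex vector space $\mathbb C^n\times\operatorname{Hom}(\mathbb C^k,\mathbb C^{n-k})$, such that $de\circ J=\sqrt{-1}\,de$ on $N$ and $e=g\circ\psi_{a,b}$ on $N$ for a map $g$ that is holomorphic on an open set containing $\psi_{a,b}(N)$. -/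

import Mathlib

open scoped Manifold ContDiff LinearAlgebra.Projectivization TensorProduct
open Set

noncomputable section

namespace BKTwistor

section Projective

variable (E : Type*) [AddCommGroup E] [Module ℂ E]

/-- The model space of the projective space of `E`. -/
abbrev ProjModel : Type := Fin (Module.finrank ℂ E - 1) → ℂ

/-- A linear coordinate system `E ≃ ℂ × ℂ^d`, where `dim E = d + 1`. -/
abbrev ProjFrame : Type _ := E ≃ₗ[ℂ] ℂ × ProjModel E

variable {E}

/-- The affine lift `x' ↦ (1, x')` of affine coordinates to `E`. -/
def ProjFrame.lift (T : ProjFrame E) (x : ProjModel E) : E := T.symm (1, x)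

/-- The derivative of the affine lift. -/
def ProjFrame.tangentLift (T : ProjFrame E) : ProjModel E →ₗ[ℂ] E :=
  T.symm.toLinearMap ∘ₗ LinearMap.inr ℂ ℂ (ProjModel E)

@[simp]
theorem ProjFrame.apply_lift (T : ProjFrame E) (x : ProjModel E) : T (T.lift x) = (1, x) := by
  simp [ProjFrame.lift]

theorem ProjFrame.lift_ne_zero (T : ProjFrame E) (x : ProjModel E) : T.lift x ≠ 0 := by
  intro h
  have : T (T.lift x) = 0 := by rw [h, map_zero]
  simp [ProjFrame.lift] at this

theorem exists_rep_mk_eq (v : E) (hv : v ≠ 0) :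
    ∃ a : ℂ, a ≠ 0 ∧ (Projectivization.mk ℂ v hv).rep = a • v := by
  obtain ⟨a, ha⟩ := Projectivization.exists_smul_eq_mk_rep ℂ v hv
  exact ⟨a, a.ne_zero, ha.symm⟩

/-- The affine chart `[v] ↦ x'` with `T v = c • (1, x')`. -/
def ProjFrame.chart (T : ProjFrame E) : PartialEquiv (ℙ ℂ E) (ProjModel E) where
  toFun p := (T p.rep).1⁻¹ • (T p.rep).2
  invFun x := Projectivization.mk ℂ (T.lift x) (T.lift_ne_zero x)
  source := {p | (T p.rep).1 ≠ 0}
  target := univ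
  map_source' _ _ := mem_univ _
  map_target' x _ := by
    obtain ⟨a, ha, h⟩ := exists_rep_mk_eq _ (T.lift_ne_zero x)
    change (T (Projectivization.mk ℂ (T.lift x) _).rep).1 ≠ 0
    rw [h]
    simp [ha]
  left_inv' p hp := by
    conv_rhs => rw [← Projectivization.mk_rep p]
    rw [Projectivization.mk_eq_mk_iff']
    refine ⟨(T p.rep).1⁻¹, ?_⟩
    apply T.injective
    have hp' : (T p.rep).1 ≠ 0 := hp
    ext <;> simp [ProjFrame.lift, hp']
  right_inv' x _ := by
    obtain ⟨a, ha, h⟩ := exists_rep_mk_eq _ (T.lift_ne_zero x)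
    rw [h]
    simp [ha]

theorem ProjFrame.transition_eq (T T' : ProjFrame E) (x : ProjModel E) :
    T'.chart (T.chart.symm x) = (T' (T.lift x)).1⁻¹ • (T' (T.lift x)).2 := by
  obtain ⟨a, ha, h⟩ := exists_rep_mk_eq _ (T.lift_ne_zero x)
  have h' : (T.chart.symm x).rep = a • T.lift x := h
  change (T' (T.chart.symm x).rep).1⁻¹ • (T' (T.chart.symm x).rep).2 = _
  rw [h']
  simp [smul_smul, mul_comm, ha]

theorem ProjFrame.transition_source (T T' : ProjFrame E) :
    (T.chart.symm.trans T'.chart).source = {x | (T' (T.lift x)).1 ≠ 0} := by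
  ext x
  obtain ⟨a, ha, h⟩ := exists_rep_mk_eq _ (T.lift_ne_zero x)
  have h' : (T.chart.symm x).rep = a • T.lift x := h
  have : x ∈ (T.chart.symm.trans T'.chart).source ↔ (T' (T.chart.symm x).rep).1 ≠ 0 := by
    simp [PartialEquiv.trans_source, ProjFrame.chart]
  rw [this, h']
  simp [ha]

theorem ProjFrame.contDiff_lift (T T' : ProjFrame E) (n : ℕ∞ω) :
    ContDiff ℂ n fun x => T' (T.lift x) := by
  have : (fun x => T' (T.lift x)) =
      fun x => (LinearMap.toContinuousLinearMap (T.symm.trans T').toLinearMap) (1, x) := by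
    ext x <;> simp [ProjFrame.lift]
  rw [this]
  exact (ContinuousLinearMap.contDiff _).comp (contDiff_const.prodMk contDiff_id)

theorem ProjFrame.isOpen_transition (T T' : ProjFrame E) :
    IsOpen (T.chart.symm.trans T'.chart).source := by
  rw [T.transition_source]
  exact isOpen_ne_fun (continuous_fst.comp (T.contDiff_lift T' 0).continuous) continuous_const

theorem ProjFrame.contDiffOn_transition (T T' : ProjFrame E) (n : ℕ∞ω) :
    ContDiffOn ℂ n (T.chart.symm.trans T'.chart) (T.chart.symm.trans T'.chart).source := by
  rw [T.transition_source]
  have : ContDiffOn ℂ n (fun x => (T' (T.lift x)).1⁻¹ • (T' (T.lift x)).2)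
      {x | (T' (T.lift x)).1 ≠ 0} :=
    ((contDiff_fst.comp (T.contDiff_lift T' n)).contDiffOn.inv fun x hx => hx).smul
      (contDiff_snd.comp (T.contDiff_lift T' n)).contDiffOn
  exact this.congr fun x _ => T.transition_eq T' x

variable [FiniteDimensional ℂ E]

theorem exists_projFrame (p : ℙ ℂ E) : ∃ T : ProjFrame E, (T p.rep).1 ≠ 0 := by
  obtain ⟨S, hS⟩ := Submodule.exists_isCompl (Submodule.span ℂ {p.rep})
  have h1 : Module.finrank ℂ (Submodule.span ℂ {p.rep}) = 1 :=
    finrank_span_singleton p.rep_nonzero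
  have h2 := Submodule.finrank_add_eq_of_isCompl hS
  have h3 : Module.finrank ℂ S = Module.finrank ℂ (ProjModel E) := by
    simp; omega
  let e := LinearEquiv.ofFinrankEq S (ProjModel E) h3
  let e1 := (LinearEquiv.toSpanNonzeroSingleton ℂ E p.rep p.rep_nonzero).symm
  refine ⟨(Submodule.prodEquivOfIsCompl _ _ hS).symm.trans (e1.prodCongr e), ?_⟩
  have : (Submodule.prodEquivOfIsCompl _ _ hS).symm p.rep =
      (⟨p.rep, Submodule.mem_span_singleton_self _⟩, 0) :=
    Submodule.prodEquivOfIsCompl_symm_apply_left _ _ hS ⟨p.rep, _⟩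
  simp only [LinearEquiv.trans_apply, this]
  simp [e1, p.rep_nonzero]

/-- A linear coordinate system of `E` whose affine chart contains `p`. -/
def projFrameAt (p : ℙ ℂ E) : ProjFrame E := (exists_projFrame p).choose

theorem projFrameAt_spec (p : ℙ ℂ E) : (projFrameAt p p.rep).1 ≠ 0 :=
  (exists_projFrame p).choose_spec

variable (E)

/-- The affine charts of the projective space. -/
def projCore : ChartedSpaceCore (ProjModel E) (ℙ ℂ E) where
  atlas := range ProjFrame.chart
  chartAt p := (projFrameAt p).chart
  mem_chart_source p := projFrameAt_spec p
  chart_mem_atlas p := mem_range_self _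
  open_source := by
    rintro _ _ ⟨T, rfl⟩ ⟨T', rfl⟩
    exact T.isOpen_transition T'
  continuousOn_toFun := by
    rintro _ _ ⟨T, rfl⟩ ⟨T', rfl⟩
    exact (T.contDiffOn_transition T' 0).continuousOn

instance instTopologicalSpaceProj : TopologicalSpace (ℙ ℂ E) := (projCore E).toTopologicalSpace

instance instChartedSpaceProj : ChartedSpace (ProjModel E) (ℙ ℂ E) := (projCore E).toChartedSpace

instance instIsManifoldProj : IsManifold 𝓘(ℂ, ProjModel E) ω (ℙ ℂ E) := by
  apply isManifold_of_contDiffOn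
  intro e e' he he'
  simp only [atlas, mem_iUnion, mem_singleton_iff, ChartedSpace.atlas] at he he'
  obtain ⟨_, ⟨T, rfl⟩, rfl⟩ := he
  obtain ⟨_, ⟨T', rfl⟩, rfl⟩ := he'
  simp only [modelWithCornersSelf_coe, modelWithCornersSelf_coe_symm, range_id, inter_univ,
    preimage_id, Function.id_comp, Function.comp_id]
  exact T.contDiffOn_transition T' ω

end Projective

section Grassmann

variable {E H : Type*} [NormedAddCommGroup E] [NormedSpace ℂ E] [TopologicalSpace H]
  (I : ModelWithCorners ℂ E H) (M : Type*) [TopologicalSpace M] [ChartedSpace H M] (k : ℕ)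

/-- The Grassmann bundle `G_k(TM)` of a complex manifold `M`: pairs of a point of `M` and a
`k`-dimensional complex subspace of its holomorphic tangent space. -/
structure GrassmannBundle where
  base : M
  fiber : Submodule ℂ (TangentSpace I base)
  finrank_fiber : Module.finrank ℂ fiber = k

/-- `ℂ^k`. -/
abbrev GrSub : Type := Fin k → ℂ

variable (E) in
/-- `ℂ^(n-k)`, where `n = dim E`. -/
abbrev GrQuot : Type := Fin (Module.finrank ℂ E - k) → ℂ

variable (E) in
/-- A linear coordinate system `E ≃ ℂ^k × ℂ^(n-k)`. -/
abbrev GrFrame : Type _ := E ≃L[ℂ] GrSub k × GrQuot E k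

variable (E) in
/-- The model space `E × Hom(ℂ^k, ℂ^(n-k))` of the Grassmann bundle. -/
abbrev GrModel : Type _ := E × (GrSub k →L[ℂ] GrQuot E k)

variable {I M k}

/-- The embedding `c ↦ (c, Z c)` of `ℂ^k` into `E` with respect to the coordinates `T`. -/
def GrFrame.incl (T : GrFrame E k) (Z : GrSub k →L[ℂ] GrQuot E k) : GrSub k →L[ℂ] E :=
  T.symm.toContinuousLinearMap ∘L (ContinuousLinearMap.id ℂ (GrSub k)).prod Z

/-- The graph of `Z` as a subspace of `E` with respect to the coordinates `T`. -/
def GrFrame.graph (T : GrFrame E k) (Z : GrSub k →L[ℂ] GrQuot E k) : Submodule ℂ E :=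
  LinearMap.range (T.incl Z).toLinearMap

/-- The projection `(c, d) ↦ d - Z c` of `E` along the graph of `Z`. -/
def GrFrame.quot (T : GrFrame E k) (Z : GrSub k →L[ℂ] GrQuot E k) : E →L[ℂ] GrQuot E k :=
  (ContinuousLinearMap.snd ℂ _ _ - Z ∘L ContinuousLinearMap.fst ℂ _ _) ∘L T.toContinuousLinearMap

theorem GrFrame.apply_incl (T : GrFrame E k) (Z : GrSub k →L[ℂ] GrQuot E k) (c : GrSub k) :
    T (T.incl Z c) = (c, Z c) := by
  simp [GrFrame.incl]

theorem GrFrame.incl_injective (T : GrFrame E k) (Z : GrSub k →L[ℂ] GrQuot E k) :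
    Function.Injective (T.incl Z) := by
  intro c c' h
  have := congrArg T h
  rw [T.apply_incl, T.apply_incl] at this
  exact congrArg Prod.fst this

theorem GrFrame.graph_injective (T : GrFrame E k) : Function.Injective T.graph := by
  intro Z Z' h
  ext1 c
  have h1 : T.incl Z c ∈ T.graph Z' := h ▸ ⟨c, rfl⟩
  obtain ⟨c', hc'⟩ := h1
  have h2 : T (T.incl Z' c') = T (T.incl Z c) := congrArg T hc'
  rw [T.apply_incl, T.apply_incl] at h2
  obtain rfl : c' = c := congrArg Prod.fst h2
  exact (congrArg Prod.snd h2).symm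

theorem GrFrame.finrank_graph (T : GrFrame E k) (Z : GrSub k →L[ℂ] GrQuot E k) :
    Module.finrank ℂ (T.graph Z) = k := by
  rw [GrFrame.graph, LinearMap.finrank_range_of_inj (T.incl_injective Z)]
  simp

theorem GrFrame.range_eq_graph_iff (T : GrFrame E k) (C : GrSub k →L[ℂ] E)
    (Z : GrSub k →L[ℂ] GrQuot E k) :
    LinearMap.range C.toLinearMap = T.graph Z ↔
      IsUnit (ContinuousLinearMap.fst ℂ _ _ ∘L T.toContinuousLinearMap ∘L C) ∧
      Z = (ContinuousLinearMap.snd ℂ _ _ ∘L T.toContinuousLinearMap ∘L C) ∘L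
        Ring.inverse (ContinuousLinearMap.fst ℂ _ _ ∘L T.toContinuousLinearMap ∘L C) := by
  set α : GrSub k →L[ℂ] GrSub k := ContinuousLinearMap.fst ℂ _ _ ∘L T.toContinuousLinearMap ∘L C
    with hα
  have hmem : ∀ v, v ∈ T.graph Z ↔ (T v).2 = Z (T v).1 := by
    intro v
    constructor
    · rintro ⟨c, rfl⟩
      have := T.apply_incl Z c
      simp only [ContinuousLinearMap.coe_coe]
      rw [this]
    · intro h
      refine ⟨(T v).1, T.injective ?_⟩
      have := T.apply_incl Z (T v).1
      simp only [ContinuousLinearMap.coe_coe]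
      rw [this, ← h]
  constructor
  · intro h
    have hsurj : Function.Surjective α := by
      intro c
      have h1 : T.incl Z c ∈ LinearMap.range C.toLinearMap := h ▸ ⟨c, rfl⟩
      obtain ⟨c', hc'⟩ := h1
      refine ⟨c', ?_⟩
      have h2 : T (C c') = T (T.incl Z c) := congrArg T hc'
      rw [T.apply_incl] at h2
      simp [hα, h2]
    have hinj : Function.Injective α :=
      (LinearMap.injective_iff_surjective (f := α.toLinearMap)).2 hsurj
    have hu : IsUnit α := by
      rw [ContinuousLinearMap.isUnit_iff_bijective]
      exact ⟨hinj, hsurj⟩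
    refine ⟨hu, ?_⟩
    ext1 c
    have hc : α (Ring.inverse α c) = c := by
      have := Ring.mul_inverse_cancel α hu
      exact congrArg (fun f : GrSub k →L[ℂ] GrSub k => f c) this
    have h3 : C (Ring.inverse α c) ∈ T.graph Z := h ▸ ⟨_, rfl⟩
    rw [hmem] at h3
    have h4 : (T (C (Ring.inverse α c))).1 = c := hc
    rw [h4] at h3
    exact h3.symm
  · rintro ⟨hu, hZ⟩
    have hZ' : ∀ c, Z (α c) = (T (C c)).2 := by
      intro c
      have hc : Ring.inverse α (α c) = c := by
        have := Ring.inverse_mul_cancel α hu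
        exact congrArg (fun f : GrSub k →L[ℂ] GrSub k => f c) this
      rw [hZ]
      simp [hc]
    apply le_antisymm
    · rintro _ ⟨c, rfl⟩
      rw [hmem]
      exact (hZ' c).symm
    · rintro v hv
      rw [hmem] at hv
      obtain ⟨c, hc⟩ := ((ContinuousLinearMap.isUnit_iff_bijective).1 hu).2 (T v).1
      refine ⟨c, T.injective (Prod.ext hc ?_)⟩
      rw [hv, ← hc, hZ' c]
      rfl

theorem GrassmannBundle.ext_of {κ κ' : GrassmannBundle I M k} (h : κ.base = κ'.base)
    (h' : @Eq (Submodule ℂ E) κ.fiber κ'.fiber) : κ = κ' := by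
  obtain ⟨b, L, hL⟩ := κ
  obtain ⟨b', L', hL'⟩ := κ'
  obtain rfl : b = b' := h
  obtain rfl : L = L' := h'
  rfl

theorem GrassmannBundle.isOpen_baseTransition [I.Boundaryless] (p q : M) :
    IsOpen ((extChartAt I p).symm.trans (extChartAt I q)).source := by
  rw [PartialEquiv.trans_source]
  exact (continuousOn_extChartAt_symm p).isOpen_inter_preimage (isOpen_extChartAt_target p)
    (isOpen_extChartAt_source q)

theorem GrassmannBundle.exists_frame [FiniteDimensional ℂ E] (κ : GrassmannBundle I M k) :
    ∃ T : GrFrame E k, (κ.fiber : Submodule ℂ E) = T.graph 0 := by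
  let L : Submodule ℂ E := κ.fiber
  have hL : Module.finrank ℂ L = k := κ.finrank_fiber
  obtain ⟨S, hS⟩ := Submodule.exists_isCompl L
  have h2 := Submodule.finrank_add_eq_of_isCompl hS
  let e1 : L ≃ₗ[ℂ] GrSub k := LinearEquiv.ofFinrankEq _ _ (by simp [hL])
  let e2 : S ≃ₗ[ℂ] GrQuot E k := LinearEquiv.ofFinrankEq _ _ (by simp; omega)
  let T : E ≃ₗ[ℂ] GrSub k × GrQuot E k :=
    (Submodule.prodEquivOfIsCompl _ _ hS).symm.trans (e1.prodCongr e2)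
  refine ⟨T.toContinuousLinearEquiv, ?_⟩
  change L = _
  have hle : GrFrame.graph T.toContinuousLinearEquiv 0 ≤ L := by
    rintro _ ⟨c, rfl⟩
    have : (GrFrame.incl T.toContinuousLinearEquiv 0) c = (e1.symm c : E) := by
      simp [GrFrame.incl, T]
    exact this ▸ (e1.symm c).2
  exact (Submodule.eq_of_le_of_finrank_eq hle (by rw [hL, GrFrame.finrank_graph])).symm

/-- A linear coordinate system of `E` in which the fiber of `κ` is `ℂ^k × 0`. -/
def GrassmannBundle.frameAt [FiniteDimensional ℂ E] (κ : GrassmannBundle I M k) : GrFrame E k := κ.exists_frame.choose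

theorem GrassmannBundle.frameAt_spec [FiniteDimensional ℂ E] (κ : GrassmannBundle I M k) :
    (κ.fiber : Submodule ℂ E) = κ.frameAt.graph 0 := κ.exists_frame.choose_spec

/-- The fiber of `κ`, read in the preferred chart of `M` at the base point of `κ`. -/
def GrassmannBundle.subspace (κ : GrassmannBundle I M k) : Submodule ℂ E := κ.fiber

variable [IsManifold I ∞ M]

/-- The fiber of `κ`, read in the preferred chart of `M` at `p`. -/
def GrassmannBundle.coordFiber (κ : GrassmannBundle I M k) (p : M) : Submodule ℂ E :=
  Submodule.map (tangentCoordChange I κ.base p κ.base).toLinearMap (κ.fiber : Submodule ℂ E)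

theorem finrank_map_tangentCoordChange (p q : M) (hq : q ∈ (extChartAt I p).source)
    (L : Submodule ℂ E) :
    Module.finrank ℂ (L.map (tangentCoordChange I p q q).toLinearMap) = Module.finrank ℂ L := by
  apply LinearEquiv.finrank_eq
  refine (Submodule.equivMapOfInjective _ ?_ L).symm
  intro v w h
  have key : ∀ u, tangentCoordChange I q p q (tangentCoordChange I p q q u) = u := by
    intro u
    rw [tangentCoordChange_comp ⟨⟨hq, mem_extChartAt_source q⟩, hq⟩, tangentCoordChange_self hq]
  rw [← key v, ← key w]
  exact congrArg _ h

theorem map_map_tangentCoordChange (p q r z : M) (L : Submodule ℂ E)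
    (h : z ∈ (extChartAt I p).source ∩ (extChartAt I q).source ∩ (extChartAt I r).source) :
    (L.map (tangentCoordChange I p q z).toLinearMap).map
      (tangentCoordChange I q r z).toLinearMap = L.map (tangentCoordChange I p r z).toLinearMap := by
  rw [← Submodule.map_comp]
  congr 1
  ext1 v
  exact tangentCoordChange_comp h

theorem map_tangentCoordChange_self (p z : M) (L : Submodule ℂ E)
    (h : z ∈ (extChartAt I p).source) :
    L.map (tangentCoordChange I p p z).toLinearMap = L := by
  have : (tangentCoordChange I p p z).toLinearMap = LinearMap.id := by
    ext1 v
    exact tangentCoordChange_self h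
  rw [this, Submodule.map_id]

/-- The point of the Grassmann bundle over `q` whose fiber, read in the preferred chart of `M` at `p`,
is the graph of `Z` with respect to the linear coordinates `T`. -/
def GrassmannBundle.ofGraph (p : M) (T : GrFrame E k) (Z : GrSub k →L[ℂ] GrQuot E k) (q : M)
    (hq : q ∈ (extChartAt I p).source) : GrassmannBundle I M k where
  base := q
  fiber := Submodule.map (tangentCoordChange I p q q).toLinearMap (T.graph Z)
  finrank_fiber := (finrank_map_tangentCoordChange _ _ hq _).trans (T.finrank_graph _)

theorem GrassmannBundle.coordFiber_ofGraph (p p' : M) (T : GrFrame E k)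
    (Z : GrSub k →L[ℂ] GrQuot E k) (q : M) (hq : q ∈ (extChartAt I p).source)
    (hq' : q ∈ (extChartAt I p').source) :
    (ofGraph p T Z q hq).coordFiber p' =
      Submodule.map (tangentCoordChange I p p' q).toLinearMap (T.graph Z) :=
  map_map_tangentCoordChange _ _ _ _ _ ⟨⟨hq, mem_extChartAt_source _⟩, hq'⟩

theorem GrassmannBundle.coordFiber_ofGraph_self (p : M) (T : GrFrame E k)
    (Z : GrSub k →L[ℂ] GrQuot E k) (q : M) (hq : q ∈ (extChartAt I p).source) :
    (ofGraph p T Z q hq).coordFiber p = T.graph Z :=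
  (coordFiber_ofGraph p p T Z q hq hq).trans (map_tangentCoordChange_self _ _ _ hq)

theorem GrassmannBundle.coordFiber_base (κ : GrassmannBundle I M k) :
    κ.coordFiber κ.base = κ.fiber :=
  map_tangentCoordChange_self _ _ _ (mem_extChartAt_source _)

open Classical in
/-- The matrix `Z` whose graph is the fiber of `κ`, read in the preferred chart of `M` at `p` and the
linear coordinates `T`; zero if there is none. -/
def GrassmannBundle.slope (κ : GrassmannBundle I M k) (p : M) (T : GrFrame E k) :
    GrSub k →L[ℂ] GrQuot E k :=
  if h : ∃ Z, κ.coordFiber p = T.graph Z then h.choose else 0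

theorem GrassmannBundle.slope_eq {κ : GrassmannBundle I M k} {p : M} {T : GrFrame E k}
    {Z : GrSub k →L[ℂ] GrQuot E k} (h : κ.coordFiber p = T.graph Z) : κ.slope p T = Z := by
  have h' : ∃ Z, κ.coordFiber p = T.graph Z := ⟨Z, h⟩
  rw [GrassmannBundle.slope, dif_pos h']
  exact T.graph_injective (h'.choose_spec.symm.trans h)

open Classical in
/-- The standard charts `κ ↦ (q, Z)` of the Grassmann bundle: `q` are the coordinates of the base
point in the preferred chart of `M` at the base point of `κ₀`, and the fiber is the graph of `Z` with
respect to the linear coordinates `T`. -/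
def GrassmannBundle.chart (κ₀ : GrassmannBundle I M k) (T : GrFrame E k) :
    PartialEquiv (GrassmannBundle I M k) (GrModel E k) where
  toFun κ := (extChartAt I κ₀.base κ.base, κ.slope κ₀.base T)
  invFun x := if h : x.1 ∈ (extChartAt I κ₀.base).target then
      ofGraph κ₀.base T x.2 ((extChartAt I κ₀.base).symm x.1)
        ((extChartAt I κ₀.base).map_target h)
    else κ₀
  source := {κ | κ.base ∈ (extChartAt I κ₀.base).source ∧
    ∃ Z, κ.coordFiber κ₀.base = T.graph Z}
  target := (extChartAt I κ₀.base).target ×ˢ univ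
  map_source' κ h := ⟨(extChartAt I κ₀.base).map_source h.1, mem_univ _⟩
  map_target' x h := by
    have h1 : x.1 ∈ (extChartAt I κ₀.base).target := h.1
    rw [dif_pos h1]
    exact ⟨(extChartAt I κ₀.base).map_target h1, x.2, coordFiber_ofGraph_self _ _ _ _ _⟩
  left_inv' κ h := by
    obtain ⟨h1, Z, h2⟩ := h
    have h3 := (extChartAt I κ₀.base).map_source h1
    have h4 := (extChartAt I κ₀.base).left_inv h1
    rw [dif_pos h3, slope_eq h2]
    refine GrassmannBundle.ext_of h4 ?_
    simp only [ofGraph]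
    rw [h4, ← h2]
    refine (map_map_tangentCoordChange _ _ _ _ _
      ⟨⟨mem_extChartAt_source _, h1⟩, mem_extChartAt_source _⟩).trans ?_
    exact map_tangentCoordChange_self _ _ _ (mem_extChartAt_source _)
  right_inv' x h := by
    have h1 : x.1 ∈ (extChartAt I κ₀.base).target := h.1
    rw [dif_pos h1, slope_eq (coordFiber_ofGraph_self _ _ _ _ _)]
    exact Prod.ext ((extChartAt I κ₀.base).right_inv h1) rfl

/-- The change of charts of `TM`, read in linear coordinates and restricted to graphs. -/
def GrassmannBundle.transAux (κ₀ κ₁ : GrassmannBundle I M k) (T : GrFrame E k)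
    (x : GrModel E k) : GrSub k →L[ℂ] E :=
  tangentCoordChange I κ₀.base κ₁.base ((extChartAt I κ₀.base).symm x.1) ∘L T.incl x.2

theorem GrassmannBundle.mem_transition_source (κ₀ κ₁ : GrassmannBundle I M k) (T T' : GrFrame E k)
    (x : GrModel E k) :
    x ∈ ((chart κ₀ T).symm.trans (chart κ₁ T')).source ↔
      x.1 ∈ ((extChartAt I κ₀.base).symm.trans (extChartAt I κ₁.base)).source ∧
      IsUnit (ContinuousLinearMap.fst ℂ _ _ ∘L T'.toContinuousLinearMap ∘L
        transAux κ₀ κ₁ T x) := by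
  have key : ∀ (h1 : x.1 ∈ (extChartAt I κ₀.base).target)
      (_ : (extChartAt I κ₀.base).symm x.1 ∈ (extChartAt I κ₁.base).source),
      (∃ Z, ((chart κ₀ T).symm x).coordFiber κ₁.base = T'.graph Z) ↔
      IsUnit (ContinuousLinearMap.fst ℂ _ _ ∘L T'.toContinuousLinearMap ∘L
        transAux κ₀ κ₁ T x) := by
    intro h1 h2
    have e1 : ((chart κ₀ T).symm x).coordFiber κ₁.base =
        LinearMap.range (transAux κ₀ κ₁ T x).toLinearMap := by
      have : (chart κ₀ T).symm x = ofGraph κ₀.base T x.2 ((extChartAt I κ₀.base).symm x.1)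
        ((extChartAt I κ₀.base).map_target h1) := dif_pos h1
      rw [this, coordFiber_ofGraph _ _ _ _ _ _ h2]
      exact (LinearMap.range_comp _ _).symm
    rw [e1]
    constructor
    · rintro ⟨Z, hZ⟩
      exact ((T'.range_eq_graph_iff _ Z).1 hZ).1
    · intro h
      exact ⟨_, (T'.range_eq_graph_iff _ _).2 ⟨h, rfl⟩⟩
  have e2 : x ∈ ((chart κ₀ T).symm.trans (chart κ₁ T')).source ↔
      x.1 ∈ (extChartAt I κ₀.base).target ∧
      ((chart κ₀ T).symm x).base ∈ (extChartAt I κ₁.base).source ∧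
      ∃ Z, ((chart κ₀ T).symm x).coordFiber κ₁.base = T'.graph Z := by
    rw [PartialEquiv.trans_source]
    simp [chart]
  rw [e2, PartialEquiv.trans_source]
  constructor
  · rintro ⟨h1, h2, h3⟩
    have : (chart κ₀ T).symm x = ofGraph κ₀.base T x.2 ((extChartAt I κ₀.base).symm x.1)
        ((extChartAt I κ₀.base).map_target h1) := dif_pos h1
    have h4 : (extChartAt I κ₀.base).symm x.1 ∈ (extChartAt I κ₁.base).source := by
      rw [this] at h2; exact h2
    exact ⟨⟨h1, h4⟩, (key h1 h4).1 h3⟩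
  · rintro ⟨⟨h1, h2⟩, h3⟩
    have : (chart κ₀ T).symm x = ofGraph κ₀.base T x.2 ((extChartAt I κ₀.base).symm x.1)
        ((extChartAt I κ₀.base).map_target h1) := dif_pos h1
    exact ⟨h1, by rw [this]; exact h2, (key h1 h2).2 h3⟩

theorem GrassmannBundle.transition_eq (κ₀ κ₁ : GrassmannBundle I M k) (T T' : GrFrame E k)
    (x : GrModel E k) (hx : x ∈ ((chart κ₀ T).symm.trans (chart κ₁ T')).source) :
    (chart κ₀ T).symm.trans (chart κ₁ T') x =
      (extChartAt I κ₁.base ((extChartAt I κ₀.base).symm x.1),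
        (ContinuousLinearMap.snd ℂ _ _ ∘L T'.toContinuousLinearMap ∘L transAux κ₀ κ₁ T x) ∘L
          Ring.inverse (ContinuousLinearMap.fst ℂ _ _ ∘L T'.toContinuousLinearMap ∘L
            transAux κ₀ κ₁ T x)) := by
  obtain ⟨h12, h3⟩ := (mem_transition_source κ₀ κ₁ T T' x).1 hx
  have h1 : x.1 ∈ (extChartAt I κ₀.base).target := h12.1
  have h2 : (extChartAt I κ₀.base).symm x.1 ∈ (extChartAt I κ₁.base).source := h12.2
  have e0 : (chart κ₀ T).symm x = ofGraph κ₀.base T x.2 ((extChartAt I κ₀.base).symm x.1)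
    ((extChartAt I κ₀.base).map_target h1) := dif_pos h1
  have e1 : ((chart κ₀ T).symm x).coordFiber κ₁.base =
      LinearMap.range (transAux κ₀ κ₁ T x).toLinearMap := by
    rw [e0, coordFiber_ofGraph _ _ _ _ _ _ h2]
    exact (LinearMap.range_comp _ _).symm
  have e2 : ((chart κ₀ T).symm x).slope κ₁.base T' = _ :=
    slope_eq (e1.trans ((T'.range_eq_graph_iff _ _).2 ⟨h3, rfl⟩))
  refine Prod.ext ?_ e2
  change extChartAt I κ₁.base ((chart κ₀ T).symm x).base = _
  rw [e0]
  rfl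

theorem GrassmannBundle.contDiffOn_transAux (κ₀ κ₁ : GrassmannBundle I M k) (T : GrFrame E k) :
    ContDiffOn ℂ ∞ (transAux κ₀ κ₁ T)
      (((extChartAt I κ₀.base).symm.trans (extChartAt I κ₁.base)).source ×ˢ univ) := by
  have : IsManifold I (∞ + 1) M := by simpa
  have h1 := contDiffOn_fderiv_coord_change (I := I) (n := ∞) (achart H κ₀.base) (achart H κ₁.base)
  have h2 : ContDiffOn ℂ ∞ (fun y : E =>
      tangentCoordChange I κ₀.base κ₁.base ((extChartAt I κ₀.base).symm y))
      ((extChartAt I κ₀.base).symm.trans (extChartAt I κ₁.base)).source := by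
    refine h1.congr ?_
    intro y hy
    rw [tangentCoordChange_def, (extChartAt I κ₀.base).right_inv hy.1]
    rfl
  have h3 : ContDiff ℂ ∞ (fun Z : GrSub k →L[ℂ] GrQuot E k => T.incl Z) := by
    have : (fun Z : GrSub k →L[ℂ] GrQuot E k => T.incl Z) =
        fun Z => T.symm.toContinuousLinearMap ∘L (ContinuousLinearMap.inl ℂ _ _) +
          T.symm.toContinuousLinearMap ∘L ((ContinuousLinearMap.inr ℂ _ _) ∘L Z) := by
      funext Z
      ext1 c
      simp [GrFrame.incl, ← map_add]
    rw [this]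
    exact contDiff_const.add (contDiff_const.clm_comp (contDiff_const.clm_comp contDiff_id))
  exact (h2.comp contDiff_fst.contDiffOn fun x hx => hx.1).clm_comp
    (h3.comp contDiff_snd).contDiffOn

theorem GrassmannBundle.isOpen_transition [I.Boundaryless] (κ₀ κ₁ : GrassmannBundle I M k) (T T' : GrFrame E k) :
    IsOpen ((chart κ₀ T).symm.trans (chart κ₁ T')).source := by
  have h : ((chart κ₀ T).symm.trans (chart κ₁ T')).source =
      (((extChartAt I κ₀.base).symm.trans (extChartAt I κ₁.base)).source ×ˢ univ) ∩
      (fun x => ContinuousLinearMap.fst ℂ _ _ ∘L T'.toContinuousLinearMap ∘L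
        transAux κ₀ κ₁ T x) ⁻¹' {α | IsUnit α} := by
    ext x
    rw [mem_transition_source]
    simp
  rw [h]
  have hc : ContinuousOn (fun x => ContinuousLinearMap.fst ℂ _ _ ∘L T'.toContinuousLinearMap ∘L
        transAux κ₀ κ₁ T x)
      (((extChartAt I κ₀.base).symm.trans (extChartAt I κ₁.base)).source ×ˢ univ) :=
    (contDiffOn_const.clm_comp (contDiffOn_const.clm_comp
      (contDiffOn_transAux κ₀ κ₁ T))).continuousOn
  exact hc.isOpen_inter_preimage ((isOpen_baseTransition _ _).prod isOpen_univ) Units.isOpen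

theorem GrassmannBundle.contDiffOn_transition [I.Boundaryless] (κ₀ κ₁ : GrassmannBundle I M k)
    (T T' : GrFrame E k) :
    ContDiffOn ℂ ∞ ((chart κ₀ T).symm.trans (chart κ₁ T'))
      ((chart κ₀ T).symm.trans (chart κ₁ T')).source := by
  have h0 : ContDiffOn ℂ ∞ (transAux κ₀ κ₁ T) ((chart κ₀ T).symm.trans (chart κ₁ T')).source :=
    (contDiffOn_transAux κ₀ κ₁ T).mono fun x hx =>
      ⟨((mem_transition_source κ₀ κ₁ T T' x).1 hx).1, mem_univ _⟩
  have h1 : ContDiffOn ℂ ∞ (fun x : GrModel E k =>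
      extChartAt I κ₁.base ((extChartAt I κ₀.base).symm x.1))
      ((chart κ₀ T).symm.trans (chart κ₁ T')).source := by
    intro x hx
    have hx' := ((mem_transition_source κ₀ κ₁ T T' x).1 hx).1
    have := contDiffWithinAt_ext_coord_change (I := I) (n := ∞) κ₁.base κ₀.base
      (y := x.1) (by simpa using hx')
    rw [I.range_eq_univ] at this
    exact this.comp (f := Prod.fst) x contDiff_fst.contDiffWithinAt (mapsTo_univ _ _)
  have h2 : ContDiffOn ℂ ∞ (fun x => ContinuousLinearMap.fst ℂ _ _ ∘L T'.toContinuousLinearMap ∘L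
      transAux κ₀ κ₁ T x) ((chart κ₀ T).symm.trans (chart κ₁ T')).source :=
    contDiffOn_const.clm_comp (contDiffOn_const.clm_comp h0)
  have h3 : ContDiffOn ℂ ∞ (fun x => Ring.inverse (ContinuousLinearMap.fst ℂ _ _ ∘L
      T'.toContinuousLinearMap ∘L transAux κ₀ κ₁ T x))
      ((chart κ₀ T).symm.trans (chart κ₁ T')).source := by
    intro x hx
    obtain ⟨u, hu⟩ := ((mem_transition_source κ₀ κ₁ T T' x).1 hx).2
    have h4 := contDiffAt_ringInverse ℂ u (n := ∞)
    rw [hu] at h4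
    exact h4.comp_contDiffWithinAt x (h2 x hx)
  have h4 : ContDiffOn ℂ ∞ (fun x => ContinuousLinearMap.snd ℂ _ _ ∘L T'.toContinuousLinearMap ∘L
      transAux κ₀ κ₁ T x) ((chart κ₀ T).symm.trans (chart κ₁ T')).source :=
    contDiffOn_const.clm_comp (contDiffOn_const.clm_comp h0)
  exact (h1.prodMk (h4.clm_comp h3)).congr fun x hx => transition_eq κ₀ κ₁ T T' x hx

variable [FiniteDimensional ℂ E] [I.Boundaryless]

variable (I M k) in
/-- The standard charts of the Grassmann bundle. -/
def grassmannCore : ChartedSpaceCore (GrModel E k) (GrassmannBundle I M k) where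
  atlas := {e | ∃ κ T, e = GrassmannBundle.chart κ T}
  chartAt κ := GrassmannBundle.chart κ κ.frameAt
  mem_chart_source κ := ⟨mem_extChartAt_source _, 0, κ.coordFiber_base.trans κ.frameAt_spec⟩
  chart_mem_atlas κ := ⟨κ, κ.frameAt, rfl⟩
  open_source := by
    rintro _ _ ⟨κ, T, rfl⟩ ⟨κ', T', rfl⟩
    exact GrassmannBundle.isOpen_transition κ κ' T T'
  continuousOn_toFun := by
    rintro _ _ ⟨κ, T, rfl⟩ ⟨κ', T', rfl⟩
    exact (GrassmannBundle.contDiffOn_transition κ κ' T T').continuousOn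

instance instTopologicalSpaceGrassmann : TopologicalSpace (GrassmannBundle I M k) :=
  (grassmannCore I M k).toTopologicalSpace

instance instChartedSpaceGrassmann : ChartedSpace (GrModel E k) (GrassmannBundle I M k) :=
  (grassmannCore I M k).toChartedSpace

instance instIsManifoldGrassmann : IsManifold 𝓘(ℝ, GrModel E k) ∞ (GrassmannBundle I M k) := by
  apply isManifold_of_contDiffOn
  intro e e' he he'
  simp only [atlas, mem_iUnion, mem_singleton_iff, ChartedSpace.atlas] at he he'
  obtain ⟨_, ⟨κ, T, rfl⟩, rfl⟩ := he
  obtain ⟨_, ⟨κ', T', rfl⟩, rfl⟩ := he'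
  simp only [modelWithCornersSelf_coe, modelWithCornersSelf_coe_symm, range_id, inter_univ,
    preimage_id, Function.id_comp, Function.comp_id]
  exact (GrassmannBundle.contDiffOn_transition κ κ' T T').restrict_scalars ℝ

end Grassmann

section Connection

variable {E : Type*} [NormedAddCommGroup E] [NormedSpace ℂ E]

/-- The Wirtinger derivative `∂_u f = (D_u f - i D_{iu} f) / 2`. -/
def wirtinger (f : E → ℂ) (q u : E) : ℂ :=
  (1 / 2) * (fderiv ℝ f q u - Complex.I * fderiv ℝ f q (Complex.I • u))

/-- The conjugate Wirtinger derivative `∂̄_u f = (D_u f + i D_{iu} f) / 2`. -/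
def wirtingerBar (f : E → ℂ) (q u : E) : ℂ :=
  (1 / 2) * (fderiv ℝ f q u + Complex.I * fderiv ℝ f q (Complex.I • u))

/-- The Hermitian form `h(u, v) = ∂_u ∂̄_v K` (linear in `u`, conjugate linear in `v`) at `q` of the
Kähler metric with Kähler form `√-1 ∂∂̄K`. -/
def kahlerMetric (K : E → ℝ) (q u v : E) : ℂ :=
  wirtinger (fun q' => wirtingerBar (fun q'' => (K q'' : ℂ)) q' v) q u

/-- The connection form `Γ = (∂h) h⁻¹` at `q` of the Chern (= Levi-Civita) connection of the Kähler
metric `√-1 ∂∂̄K`, in the coordinate frame: `∇_ξ u = D_ξ u + Γ(ξ) u`. -/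
def chernForm (K : E → ℝ) (q : E) : E →L[ℂ] E →L[ℂ] E :=
  Classical.epsilon fun Γ : E →L[ℂ] E →L[ℂ] E =>
    ∀ ξ u v, kahlerMetric K q (Γ ξ u) v = wirtinger (fun q' => kahlerMetric K q' u v) q ξ

/-- The orthogonal projection at `q` onto the subspace `L` with respect to the Kähler metric
`√-1 ∂∂̄K`. -/
def kahlerProj (K : E → ℝ) (q : E) (L : Submodule ℂ E) : E →L[ℂ] E :=
  Classical.epsilon fun P : E →L[ℂ] E =>
    ∀ ξ, P ξ ∈ L ∧ ∀ v ∈ L, kahlerMetric K q (ξ - P ξ) v = 0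

variable {H : Type*} [TopologicalSpace H] {I : ModelWithCorners ℂ E H}
  {M : Type*} [TopologicalSpace M] [ChartedSpace H M] {k : ℕ}
  [IsManifold I ∞ M] [FiniteDimensional ℂ E]

/-! In the following, `K p` is a Kähler potential of the metric of `M` near `p`, read in the preferred
chart of `M` at `p`. Tangent vectors `(ξ, ζ)` of `G_k(TM)` at `κ` are read in the preferred chart
at `κ`. -/

/-- The connection form of the Grassmann bundle at `κ`, with values in
`Hom(L, T_p M / L) = Hom(ℂ^k, ℂ^(n-k))`. The vertical component of the tangent vector `(ξ, ζ)` with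
respect to the connection is `ζ + connForm ξ`: along a curve in `G_k(TM)` whose fiber is spanned by
moving vectors `f c`, it is `c ↦ ∇(f c) mod L`. -/
def GrassmannBundle.connForm (K : M → E → ℝ) (κ : GrassmannBundle I M k) (ξ : E) :
    GrSub k →L[ℂ] GrQuot E k :=
  κ.frameAt.quot (κ.slope κ.base κ.frameAt) ∘L
    chernForm (K κ.base) (extChartAt I κ.base κ.base) ξ ∘L
    κ.frameAt.incl (κ.slope κ.base κ.frameAt)

/-- The complex structure on the horizontal space `T_p M = L ⊕ L^⊥` of the twistor space: it is
multiplication by `-√-1` on `L` and by `√-1` on `L^⊥`. -/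
def GrassmannBundle.horizontalJ (K : M → E → ℝ) (κ : GrassmannBundle I M k) (ξ : E) : E :=
  Complex.I • (ξ - (2 : ℂ) •
    kahlerProj (K κ.base) (extChartAt I κ.base κ.base) κ.subspace ξ)

/-- The almost complex structure of the twistor space at `κ`: it is `horizontalJ` on the horizontal
component `ξ`, and multiplication by `√-1` on the vertical component `ζ + connForm ξ`. -/
def GrassmannBundle.twistorJ (K : M → E → ℝ) (κ : GrassmannBundle I M k)
    (t : GrModel E k) : GrModel E k :=
  (κ.horizontalJ K t.1,
    Complex.I • (t.2 + κ.connForm K t.1) - κ.connForm K (κ.horizontalJ K t.1))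

end Connection

section Model

open Module (Dual)

/-- The vector space `V` of dimension `l + 1`. -/
abbrev VSpace (l : ℕ) : Type := Fin (l + 1) → ℂ

/-- The vector space `W` of dimension `m + 1`. -/
abbrev WSpace (m : ℕ) : Type := Fin (m + 1) → ℂ

variable {l m k : ℕ}

/-- The element `x̄ = (·, x)` of `V*`, where `(v, x) = v₀ x̄₀ - v₁ x̄₁ - ⋯ - v_l x̄_l` is the
indefinite metric of `V`. -/
def conjV (x : VSpace l) : Dual ℂ (VSpace l) :=
  (starRingEnd ℂ (x 0)) • LinearMap.proj 0 -
    ∑ i : Fin l, (starRingEnd ℂ (x i.succ)) • LinearMap.proj i.succ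

/-- The element `ȳ = (·, y)` of `W*`, where `(w, y) = ∑ w_j ȳ_j` is the Hermitian metric of `W`. -/
def conjW (y : WSpace m) : Dual ℂ (WSpace m) :=
  ∑ j : Fin (m + 1), (starRingEnd ℂ (y j)) • LinearMap.proj j

theorem conjV_smul_smul (a : ℂ) (x : VSpace l) :
    conjV (a • x) (a • x) = (Complex.normSq a : ℂ) * conjV x x := by
  have h : (Complex.normSq a : ℂ) = a * starRingEnd ℂ a := (Complex.mul_conj a).symm
  simp only [conjV, h, Pi.smul_apply, smul_eq_mul, map_mul, LinearMap.sub_apply,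
    LinearMap.smul_apply, LinearMap.proj_apply, LinearMap.sum_apply, mul_sub, Finset.mul_sum]
  congr 1
  · ring
  · exact Finset.sum_congr rfl fun i _ => by ring

theorem conjV_rep_pos_iff (T : ProjFrame (VSpace l)) (p : ℙ ℂ (VSpace l)) (hp : p ∈ T.chart.source) :
    0 < (conjV p.rep p.rep).re ↔ 0 < (conjV (T.lift (T.chart p)) (T.lift (T.chart p))).re := by
  obtain ⟨a, ha, h⟩ := exists_rep_mk_eq (T.lift (T.chart p)) (T.lift_ne_zero _)
  have h1 : Projectivization.mk ℂ (T.lift (T.chart p)) (T.lift_ne_zero _) = p :=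
    T.chart.left_inv hp
  rw [h1] at h
  rw [h, conjV_smul_smul, Complex.re_ofReal_mul]
  exact mul_pos_iff_of_pos_left (Complex.normSq_pos.2 ha)

theorem continuous_conjV : Continuous fun x : VSpace l => (conjV x x).re := by
  simp only [conjV, LinearMap.sub_apply, LinearMap.smul_apply, LinearMap.proj_apply,
    LinearMap.sum_apply, smul_eq_mul]
  fun_prop

theorem isOpen_hyperbolic : IsOpen {p : ℙ ℂ (VSpace l) | 0 < (conjV p.rep p.rep).re} := by
  rw [isOpen_iff_mem_nhds]
  intro p hp
  have hs : p ∈ (projFrameAt p).chart.source := projFrameAt_spec p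
  have hcont : Continuous fun x : ProjModel (VSpace l) =>
      (conjV ((projFrameAt p).lift x) ((projFrameAt p).lift x)).re := by
    have : Continuous fun x : ProjModel (VSpace l) => (projFrameAt p).lift x :=
      ((projFrameAt p).symm.toLinearMap.continuous_of_finiteDimensional).comp
        (Continuous.prodMk_right (1 : ℂ))
    exact continuous_conjV.comp this
  have hopen := (chartAt (ProjModel (VSpace l)) p).isOpen_inter_preimage
    (hcont.isOpen_preimage (Set.Ioi 0) isOpen_Ioi)
  refine Filter.mem_of_superset (hopen.mem_nhds ⟨mem_chart_source _ p, ?_⟩) ?_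
  · exact (conjV_rep_pos_iff _ p hs).1 hp
  · rintro p' ⟨h1, h2⟩
    exact (conjV_rep_pos_iff _ p' h1).2 h2

/-- The complex hyperbolic space `H^l`, the open subset of `P(V)` of the lines on which the metric of
`V` is positive, that is, `{(1 : x₁ : ⋯ : x_l) | |x₁|² + ⋯ + |x_l|² < 1}`. -/
def Hyp (l : ℕ) : TopologicalSpace.Opens (ℙ ℂ (VSpace l)) :=
  ⟨{p | 0 < (conjV p.rep p.rep).re}, isOpen_hyperbolic⟩

/-- The model space `M = H^l × P^m`. -/
abbrev BKSpace (l m : ℕ) : Type := Hyp l × ℙ ℂ (WSpace m)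

/-- `ℂ^l × ℂ^m`, on which `M` is modelled. -/
abbrev BKModel (l m : ℕ) : Type := ProjModel (VSpace l) × ProjModel (WSpace m)

/-- The complex manifold structure of `M`. -/
abbrev bkI (l m : ℕ) : ModelWithCorners ℂ (BKModel l m)
    (ModelProd (ProjModel (VSpace l)) (ProjModel (WSpace m))) :=
  (𝓘(ℂ, ProjModel (VSpace l))).prod 𝓘(ℂ, ProjModel (WSpace m))

/-- A Kähler potential of `M` near `p` in the affine coordinates of the preferred chart at `p`:
`- log (x, x) + log (y, y)`, where `x` and `y` are the affine lifts. In the affine coordinates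
`x = (1 : x₁ : ⋯ : x_l)` and `y = (1 : y₁ : ⋯ : y_m)` it is `- log (1 - ∑ |xᵢ|²) + log (1 + ∑ |yⱼ|²)`;
for other affine coordinates it differs from this by the real part of a holomorphic function. -/
def bkPotential (p : BKSpace l m) (q : BKModel l m) : ℝ :=
  - Real.log (conjV ((projFrameAt p.1.1).lift q.1) ((projFrameAt p.1.1).lift q.1)).re +
    Real.log (conjW ((projFrameAt p.2).lift q.2) ((projFrameAt p.2).lift q.2)).re

/-- The `k`-th twistor space `Z_k(M)` of `M = H^l × P^m`. -/
abbrev BKTwistorSpace (l m k : ℕ) : Type := GrassmannBundle (bkI l m) (BKSpace l m) k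

/-- The space `Λ^a V ⊗ Λ^b W`. -/
abbrev LambdaVW (l m a b : ℕ) : Type := (⋀[ℂ]^a (VSpace l)) ⊗[ℂ] (⋀[ℂ]^b (WSpace m))

/-- The projection of `Λ(V ⊕ W) = ⨁ Λ^a V ⊗ Λ^b W` to `Λ^a V ⊗ Λ^b W`. -/
def lambdaProj (a b : ℕ) :
    ExteriorAlgebra ℂ (VSpace l × WSpace m) →ₗ[ℂ] LambdaVW l m a b :=
  ExteriorAlgebra.liftAlternating (R := ℂ) (N := LambdaVW l m a b) <| Pi.single (a + b) <|
    (AlternatingMap.domCoprod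
      ((exteriorPower.ιMulti ℂ a).compLinearMap (LinearMap.fst ℂ (VSpace l) (WSpace m)))
      ((exteriorPower.ιMulti ℂ b).compLinearMap (LinearMap.snd ℂ (VSpace l) (WSpace m)))
    ).domDomCongr finSumFinEquiv

/-- `x ∧ (1 - y ∧ i(ȳ) / (y, y)) z + y ∧ (1 - x ∧ i(x̄) / (x, x)) z`. -/
def phiTotal (x : VSpace l) (y : WSpace m) (z : ExteriorAlgebra ℂ (VSpace l × WSpace m)) :
    ExteriorAlgebra ℂ (VSpace l × WSpace m) :=
  ExteriorAlgebra.ι ℂ (x, 0) * (z - (conjW y y)⁻¹ • (ExteriorAlgebra.ι ℂ (0, y) *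
      CliffordAlgebra.contractLeft (conjW y ∘ₗ LinearMap.snd ℂ (VSpace l) (WSpace m)) z)) +
  ExteriorAlgebra.ι ℂ (0, y) * (z - (conjV x x)⁻¹ • (ExteriorAlgebra.ι ℂ (x, 0) *
      CliffordAlgebra.contractLeft (conjV x ∘ₗ LinearMap.fst ℂ (VSpace l) (WSpace m)) z))

/-- The affine lift `x ∈ V` of the hyperbolic component of the base point of `κ`. -/
def BKTwistorSpace.x (κ : BKTwistorSpace l m k) : VSpace l :=
  (projFrameAt κ.base.1.1).lift (extChartAt (bkI l m) κ.base κ.base).1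

/-- The affine lift `y ∈ W` of the projective component of the base point of `κ`. -/
def BKTwistorSpace.y (κ : BKTwistorSpace l m k) : WSpace m :=
  (projFrameAt κ.base.2).lift (extChartAt (bkI l m) κ.base κ.base).2

/-- The identification of tangent vectors of `M` with elements of `V ⊕ W`, by the derivative of the
affine lifts `x` and `y`. -/
def BKTwistorSpace.tangentLift (κ : BKTwistorSpace l m k) :
    BKModel l m →ₗ[ℂ] VSpace l × WSpace m :=
  (projFrameAt κ.base.1.1).tangentLift.prodMap (projFrameAt κ.base.2).tangentLift

/-- A basis of the subspace `L` of the tangent space given by `κ`. -/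
def BKTwistorSpace.fiberBasis (κ : BKTwistorSpace l m k) :
    Module.Basis (Fin k) ℂ κ.subspace :=
  Module.finBasisOfFinrankEq ℂ κ.subspace κ.finrank_fiber

/-- The Plücker vector `z = u₁ ∧ ⋯ ∧ u_k` of the subspace `L` given by `κ`, as an element of
`Λ^k(V ⊕ W)`; another basis of `L` multiplies it by a nonzero constant. -/
def BKTwistorSpace.z (κ : BKTwistorSpace l m k) : ExteriorAlgebra ℂ (VSpace l × WSpace m) :=
  ExteriorAlgebra.ιMulti ℂ k fun i => κ.tangentLift (κ.fiberBasis i : BKModel l m)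

/-- `φ_{a,b}(κ)`, which is determined by `κ` up to a nonzero constant. -/
def BKTwistorSpace.phi (a b : ℕ) (κ : BKTwistorSpace l m k) : LambdaVW l m a b :=
  lambdaProj a b (phiTotal (BKTwistorSpace.x κ) (BKTwistorSpace.y κ) (BKTwistorSpace.z κ))

/-- The set `U_{a,b}` on which `φ_{a+1,b}` and `φ_{a,b+1}` are both nonzero. -/
def twistorU (l m k a b : ℕ) : Set (BKTwistorSpace l m k) :=
  {κ | BKTwistorSpace.phi (a + 1) b κ ≠ 0 ∧ BKTwistorSpace.phi a (b + 1) κ ≠ 0}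

/-- The map `ψ_{a,b} = ([φ_{a+1,b}], [φ_{a,b+1}])`. -/
def twistorPsi (l m k a b : ℕ) (κ : twistorU l m k a b) :
    ℙ ℂ (LambdaVW l m (a + 1) b) × ℙ ℂ (LambdaVW l m a (b + 1)) :=
  (Projectivization.mk ℂ (BKTwistorSpace.phi (a + 1) b κ.1) κ.2.1,
    Projectivization.mk ℂ (BKTwistorSpace.phi a (b + 1) κ.1) κ.2.2)

/-- The model space of `P(Λ^{a+1} V ⊗ Λ^b W) × P(Λ^a V ⊗ Λ^{b+1} W)`. -/
abbrev TargetModel (l m a b : ℕ) : Type :=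
  ProjModel (LambdaVW l m (a + 1) b) × ProjModel (LambdaVW l m a (b + 1))

/-- The real tangent model of the twistor space. -/
abbrev TwistorModel (l m k : ℕ) : Type := GrModel (BKModel l m) k

end Model

end BKTwistor

end

open BKTwistor

open scoped Manifold ContDiff LinearAlgebra.Projectivization TensorProduct
open Set

noncomputable section

namespace BKTwistor

/-! ### The bigraded components of the exterior algebra of V ⊕ W. -/

section LambdaAlgebra

variable {l m : ℕ}

/-! The expression defining φ collapses: on z = u₁ ∧ ⋯ ∧ u_k it is the Plücker vector of the
(k+1)-plane P in V ⊕ W spanned by (x, y) and by the projections of the uᵢ to x^⊥ ⊕ y^⊥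
(`phiTotal_ιMulti`). Other affine lifts replace P by its image under some diag(c, d), and this
multiplies each bigraded component by a nonzero scalar. Everything reduces to the passage from κ to
P modulo GL(1) × GL(1), and from P to two adjacent components of its Plücker vector.

Linear algebra of P. The (a, b) component of a decomposable vector, with a + b = dim P, is nonzero
exactly when a and b are at most the dimensions of the projections of P to V and W
(`lambdaProj_ne_zero`, `le_finrank_of_lambdaProj_ne_zero`). Since (x, y) lies in P but (x, 0) does
not, these dimensions add up to at least k + 2, so some two adjacent components are nonzero: the
sets U_{a,b} cover. The (a+1, b+1) component of v ∧ ω involves only the (a+1, b) and (a, b+1)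
components of ω, and it vanishes for the Plücker vector ω of P exactly when v ∈ P
(`lambdaWedge_eq_zero_iff`). Rescaling these two components separately moves P by a diagonal map, so
ψ determines precisely P modulo GL(1) × GL(1).

From P to κ. The form of V is negative definite on x^⊥ and that of W is positive definite, so on P
one has (v, v)/(x, x) ≤ (w, w)/(y, y), with equality only on the line of (x, y). Comparing two
planes related by a diagonal map in both directions recovers the base point, and then L
(`BKTwistorSpace.eq_of_plane_eq_map`). This gives injectivity.

The differential. Modulo P and the infinitesimal diagonal action, a tangent vector with horizontal
part ξ moves (x, y) by the projection of ξ, and moves the projection of uᵢ by the projection of ∇uᵢ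
plus h(uᵢ, ξ)(x, 0) (`fderiv_localFrame_zero`, `fderiv_localFrame_succ`). The first term sees ξ
modulo L, the second is the vertical component modulo L, and the third is conjugate linear in ξ and
sees only its L-component. The twistor structure is √-1 on the first two and -√-1 on L, so all three
become complex linear; if they vanish modulo P and a diagonal motion, the tangent vector is zero
(`BKTwistorSpace.frameDeriv_twistorJ`, `BKTwistorSpace.eq_zero_of_frameDeriv_mem`).

The topology. The equations "frame ⊂ kernel" in the frame coordinates and one scaling parameter form
a square system with invertible linearization, so a nearby kernel is spanned by a nearby frame up to
a diagonal map. Combined with the recovery of κ from P, points whose images are close are close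
(`eventually_mem_of_localPsi`). For holomorphic coordinates, the image of dψ is a complex subspace;
a complex linear map that is bijective on it, composed with affine coordinates of ψ, is a chart by
the inverse function theorem (`exists_holomorphic_chart`). -/

/-- The map induced on `Λ^a V ⊗ Λ^b W` by endomorphisms of `V` and `W`. -/
def lambdaMap (a b : ℕ) (f : VSpace l →ₗ[ℂ] VSpace l) (g : WSpace m →ₗ[ℂ] WSpace m) :
    LambdaVW l m a b →ₗ[ℂ] LambdaVW l m a b :=
  TensorProduct.map (exteriorPower.map a f) (exteriorPower.map b g)

theorem lambdaProj_ιMulti (a b : ℕ) (p : Fin (a + b) → VSpace l × WSpace m) :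
    lambdaProj a b (ExteriorAlgebra.ιMulti ℂ (a + b) p) =
      ∑ σ : Equiv.Perm.ModSumCongr (Fin a) (Fin b), AlternatingMap.domCoprod.summand
        ((exteriorPower.ιMulti ℂ a).compLinearMap (LinearMap.fst ℂ (VSpace l) (WSpace m)))
        ((exteriorPower.ιMulti ℂ b).compLinearMap (LinearMap.snd ℂ (VSpace l) (WSpace m)))
        σ (fun i => p (finSumFinEquiv i)) := by
  rw [lambdaProj, ExteriorAlgebra.liftAlternating_apply_ιMulti, Pi.single_eq_same]
  rw [AlternatingMap.domDomCongr_apply, AlternatingMap.domCoprod_apply, sum_apply]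
  rfl

theorem lambdaProj_ιMulti_of_ne {a b n : ℕ} (h : n ≠ a + b) (p : Fin n → VSpace l × WSpace m) :
    lambdaProj a b (ExteriorAlgebra.ιMulti ℂ n p) = 0 := by
  rw [lambdaProj, ExteriorAlgebra.liftAlternating_apply_ιMulti, Pi.single_eq_of_ne h]
  rfl

theorem domCoprod_summand_fst_snd {a b : ℕ} (σ : Equiv.Perm (Fin a ⊕ Fin b))
    (q : Fin a ⊕ Fin b → VSpace l × WSpace m) :
    AlternatingMap.domCoprod.summand
        ((exteriorPower.ιMulti ℂ a).compLinearMap (LinearMap.fst ℂ (VSpace l) (WSpace m)))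
        ((exteriorPower.ιMulti ℂ b).compLinearMap (LinearMap.snd ℂ (VSpace l) (WSpace m)))
        (Quotient.mk'' σ) q = Equiv.Perm.sign σ •
      ((exteriorPower.ιMulti ℂ a fun i => (q (σ (Sum.inl i))).1) ⊗ₜ[ℂ]
        (exteriorPower.ιMulti ℂ b fun j => (q (σ (Sum.inr j))).2)) := by
  rw [AlternatingMap.domCoprod.summand_mk'']
  rfl

/-- A block diagonal map acts on each shuffle term separately. Scalar blocks separate the bidegrees;
later, suitable projections isolate a single term. -/
theorem lambdaProj_map (a b : ℕ) (f : VSpace l →ₗ[ℂ] VSpace l) (g : WSpace m →ₗ[ℂ] WSpace m)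
    (θ : ExteriorAlgebra ℂ (VSpace l × WSpace m)) :
    lambdaProj a b (ExteriorAlgebra.map (f.prodMap g) θ) = lambdaMap a b f g (lambdaProj a b θ) := by
  suffices h : (lambdaProj a b).comp (ExteriorAlgebra.map (f.prodMap g)).toLinearMap =
      (lambdaMap a b f g).comp (lambdaProj a b) from LinearMap.congr_fun h θ
  refine ExteriorAlgebra.lhom_ext (R := ℂ) (N := LambdaVW l m a b) ?_
  intro n
  ext p
  simp only [LinearMap.compAlternatingMap_apply, LinearMap.comp_apply, AlgHom.toLinearMap_apply,
    ExteriorAlgebra.map_apply_ιMulti]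
  by_cases h : n = a + b
  · subst h
    rw [lambdaProj_ιMulti, lambdaProj_ιMulti, map_sum]
    refine Finset.sum_congr rfl fun σ _ => ?_
    induction σ using Quotient.inductionOn' with | _ σ
    rw [domCoprod_summand_fst_snd, domCoprod_summand_fst_snd, Units.smul_def, Units.smul_def,
      map_zsmul, lambdaMap, TensorProduct.map_tmul, exteriorPower.map_apply_ιMulti,
      exteriorPower.map_apply_ιMulti]
    rfl
  · rw [lambdaProj_ιMulti_of_ne h, lambdaProj_ιMulti_of_ne h, map_zero]

/-- Only the trivial shuffle survives: any other one puts some `w j` into a V-slot, where its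
component is zero. -/
theorem lambdaProj_append {a b : ℕ} (v : Fin a → VSpace l) (w : Fin b → WSpace m) :
    lambdaProj a b (ExteriorAlgebra.ιMulti ℂ (a + b)
      (Fin.append (fun i => (v i, 0)) (fun j => (0, w j)))) =
      exteriorPower.ιMulti ℂ a v ⊗ₜ[ℂ] exteriorPower.ιMulti ℂ b w := by
  refine (lambdaProj_ιMulti a b _).trans ?_
  refine (Finset.sum_eq_single (Quotient.mk'' 1 : Equiv.Perm.ModSumCongr (Fin a) (Fin b))
    ?_ ?_).trans ?_
  rotate_left 2
  · rw [domCoprod_summand_fst_snd]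
    simp
  · intro σ _ hσ
    induction σ using Quotient.inductionOn' with | _ σ
    rw [domCoprod_summand_fst_snd]
    -- A permutation preserving the left block lies in the subgroup S_a × S_b, so its coset is the
    -- trivial one.
    by_cases h : ∀ i, ∃ i', σ (Sum.inl i) = Sum.inl i'
    · exfalso
      apply hσ
      rw [Quotient.eq'', QuotientGroup.leftRel_apply]
      rw [mul_one, inv_mem_iff]
      apply Equiv.Perm.mem_sumCongrHom_range_of_perm_mapsTo_inl
      rintro _ ⟨i, rfl⟩
      obtain ⟨i', hi'⟩ := h i
      exact ⟨i', hi'.symm⟩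
    · push Not at h
      obtain ⟨i, hi⟩ := h
      have : (exteriorPower.ιMulti ℂ a fun i => (Fin.append (fun i => ((v i, 0) : VSpace l × WSpace m))
          (fun j => (0, w j)) (finSumFinEquiv (σ (Sum.inl i)))).1) = 0 := by
        apply AlternatingMap.map_coord_zero (i := i)
        rcases hs : σ (Sum.inl i) with i' | j'
        · exact absurd hs (hi i')
        · simp
      rw [this, TensorProduct.zero_tmul, smul_zero]
  · simp

/-- The inclusion of `Λ^a V ⊗ Λ^b W` into `Λ(V ⊕ W)`. -/
def lambdaIncl (a b : ℕ) : LambdaVW l m a b →ₗ[ℂ] ExteriorAlgebra ℂ (VSpace l × WSpace m) :=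
  TensorProduct.lift ((LinearMap.mul ℂ (ExteriorAlgebra ℂ (VSpace l × WSpace m))).compl₁₂
    ((ExteriorAlgebra.map (LinearMap.inl ℂ (VSpace l) (WSpace m))).toLinearMap ∘ₗ
      Submodule.subtype _)
    ((ExteriorAlgebra.map (LinearMap.inr ℂ (VSpace l) (WSpace m))).toLinearMap ∘ₗ
      Submodule.subtype _))

theorem lambdaIncl_tmul_ιMulti {a b : ℕ} (v : Fin a → VSpace l) (w : Fin b → WSpace m) :
    lambdaIncl a b (exteriorPower.ιMulti ℂ a v ⊗ₜ[ℂ] exteriorPower.ιMulti ℂ b w) =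
      ExteriorAlgebra.ιMulti ℂ (a + b) (Fin.append (fun i => (v i, 0)) (fun j => (0, w j))) := by
  rw [← ExteriorAlgebra.ιMulti_mul_ιMulti]
  simp only [lambdaIncl, TensorProduct.lift.tmul, LinearMap.compl₁₂_apply, LinearMap.comp_apply,
    Submodule.subtype_apply, exteriorPower.ιMulti_apply_coe, AlgHom.toLinearMap_apply,
    ExteriorAlgebra.map_apply_ιMulti, LinearMap.mul_apply']
  rfl

theorem exteriorPower_map_smul_id {F : Type*} [AddCommGroup F] [Module ℂ F] (a : ℕ) (c : ℂ) :
    exteriorPower.map a (c • (LinearMap.id : F →ₗ[ℂ] F)) = c ^ a • LinearMap.id := by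
  ext v
  simp
  rw [← (ExteriorAlgebra.ιMulti ℂ a).coe_multilinearMap, MultilinearMap.map_smul_univ]
  simp

theorem lambdaMap_smul_id (a b : ℕ) (c d : ℂ) (α : LambdaVW l m a b) :
    lambdaMap a b (c • LinearMap.id) (d • LinearMap.id) α = (c ^ a * d ^ b) • α := by
  rw [lambdaMap, exteriorPower_map_smul_id, exteriorPower_map_smul_id, TensorProduct.map_smul_left,
    TensorProduct.map_smul_right, TensorProduct.map_id, smul_smul]
  rfl

/-- In the same total degree, doubling V multiplies the product by 2^a' and its (a, b) component by
2^a; for a ≠ a' the component must vanish. -/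
theorem lambdaProj_append_of_ne {a b a' b' : ℕ} (h : ¬ (a' = a ∧ b' = b))
    (v : Fin a' → VSpace l) (w : Fin b' → WSpace m) :
    lambdaProj a b (ExteriorAlgebra.ιMulti ℂ (a' + b')
      (Fin.append (fun i => (v i, 0)) (fun j => (0, w j)))) = 0 := by
  set θ := ExteriorAlgebra.ιMulti ℂ (a' + b')
      (Fin.append (fun i => ((v i, 0) : VSpace l × WSpace m)) (fun j => (0, w j))) with hθ
  by_cases hab : a' + b' = a + b
  · have ha : a' ≠ a := fun h' => h ⟨h', by omega⟩
    have h1 := lambdaProj_map a b ((2 : ℂ) • LinearMap.id) ((1 : ℂ) • LinearMap.id) θ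
    have h2 : ExteriorAlgebra.map (((2 : ℂ) • (LinearMap.id : VSpace l →ₗ[ℂ] VSpace l)).prodMap
        ((1 : ℂ) • (LinearMap.id : WSpace m →ₗ[ℂ] WSpace m))) θ = (2 : ℂ) ^ a' • θ := by
      have : θ = lambdaIncl a' b' (exteriorPower.ιMulti ℂ a' v ⊗ₜ[ℂ] exteriorPower.ιMulti ℂ b' w) :=
        (lambdaIncl_tmul_ιMulti v w).symm
      rw [hθ, ← ExteriorAlgebra.ιMulti_mul_ιMulti, map_mul, ExteriorAlgebra.map_apply_ιMulti,
        ExteriorAlgebra.map_apply_ιMulti, ← smul_mul_assoc]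
      congr 1
      · rw [← (ExteriorAlgebra.ιMulti ℂ a').coe_multilinearMap]
        have := (ExteriorAlgebra.ιMulti ℂ a').toMultilinearMap.map_smul_univ
          (fun _ => (2 : ℂ)) (fun i => ((v i, 0) : VSpace l × WSpace m))
        simp only [Finset.prod_const, Finset.card_univ, Fintype.card_fin] at this
        rw [← this]
        congr 1
        funext i
        simp
      · congr 1
        funext i
        simp
    rw [h2, map_smul, lambdaMap_smul_id, one_pow, mul_one] at h1
    have h3 : ((2 : ℂ) ^ a' - 2 ^ a) • lambdaProj a b θ = 0 := by
      rw [sub_smul (_ : ℂ) _ (lambdaProj a b θ), h1, sub_self]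
    refine (smul_eq_zero.1 h3).resolve_left (sub_ne_zero.2 fun h' => ha ?_)
    exact_mod_cast Nat.pow_right_injective le_rfl (by exact_mod_cast h' : (2 : ℕ) ^ a' = 2 ^ a)
  · exact lambdaProj_ιMulti_of_ne hab _

theorem ι_inl_mul_append {a b : ℕ} (x : VSpace l) (v : Fin a → VSpace l) (w : Fin b → WSpace m) :
    ExteriorAlgebra.ι ℂ ((x, 0) : VSpace l × WSpace m) * ExteriorAlgebra.ιMulti ℂ (a + b)
      (Fin.append (fun i => (v i, 0)) (fun j => (0, w j))) =
    ExteriorAlgebra.ιMulti ℂ (a + 1 + b)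
      (Fin.append (fun i => ((Fin.cons x v : Fin (a + 1) → VSpace l) i, 0)) (fun j => (0, w j))) := by
  rw [← ExteriorAlgebra.ιMulti_mul_ιMulti, ← ExteriorAlgebra.ιMulti_mul_ιMulti, ← mul_assoc]
  congr 1
  rw [ExteriorAlgebra.ιMulti_succ_apply]
  rfl

theorem ι_mul_ιMulti_swap {F : Type*} [AddCommGroup F] [Module ℂ F] {a : ℕ} (y : F) (v : Fin a → F) :
    ExteriorAlgebra.ι ℂ y * ExteriorAlgebra.ιMulti ℂ a v =
      (-1 : ℂ) ^ a • (ExteriorAlgebra.ιMulti ℂ a v * ExteriorAlgebra.ι ℂ y) := by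
  induction a with
  | zero => simp
  | succ a ih =>
    rw [ExteriorAlgebra.ιMulti_succ_apply, ← mul_assoc,
      eq_neg_of_add_eq_zero_left (ExteriorAlgebra.ι_add_mul_swap y (v 0)), neg_mul, mul_assoc, ih,
      mul_smul_comm, mul_assoc, pow_succ, mul_neg_one, neg_smul]

theorem ι_inr_mul_append {a b : ℕ} (y : WSpace m) (v : Fin a → VSpace l) (w : Fin b → WSpace m) :
    ExteriorAlgebra.ι ℂ ((0, y) : VSpace l × WSpace m) * ExteriorAlgebra.ιMulti ℂ (a + b)
      (Fin.append (fun i => (v i, 0)) (fun j => (0, w j))) =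
    (-1 : ℂ) ^ a • ExteriorAlgebra.ιMulti ℂ (a + (b + 1))
      (Fin.append (fun i => (v i, 0)) (fun j => (0, (Fin.cons y w : Fin (b + 1) → WSpace m) j))) := by
  rw [← ExteriorAlgebra.ιMulti_mul_ιMulti, ← ExteriorAlgebra.ιMulti_mul_ιMulti, ← mul_assoc,
    ι_mul_ιMulti_swap, smul_mul_assoc, mul_assoc]
  congr 2
  rw [ExteriorAlgebra.ιMulti_succ_apply]
  rfl

/-- Linear identities can thus be tested on bihomogeneous products: multiplying such a product by a
vector of V ⊕ W splits into a V-part and a W-part that are bihomogeneous again. -/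
theorem span_append_eq_top :
    Submodule.span ℂ {θ : ExteriorAlgebra ℂ (VSpace l × WSpace m) | ∃ (a b : ℕ)
      (v : Fin a → VSpace l) (w : Fin b → WSpace m), θ = ExteriorAlgebra.ιMulti ℂ (a + b)
        (Fin.append (fun i => (v i, 0)) (fun j => (0, w j)))} = ⊤ := by
  rw [eq_top_iff]
  intro θ _
  induction θ using CliffordAlgebra.left_induction with
  | algebraMap r =>
    rw [Algebra.algebraMap_eq_smul_one]
    refine Submodule.smul_mem _ _ (Submodule.subset_span ⟨0, 0, 0, 0, ?_⟩)
    exact (ExteriorAlgebra.ιMulti_zero_apply _).symm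
  | add x y hx hy => exact Submodule.add_mem _ (hx trivial) (hy trivial)
  | ι_mul x p hx =>
    have hx' := hx trivial
    clear hx
    induction hx' using Submodule.span_induction with
    | mem x h =>
      obtain ⟨a, b, v, w, rfl⟩ := h
      have : p = (p.1, 0) + (0, p.2) := by simp
      change ExteriorAlgebra.ι ℂ p * _ ∈ _
      rw [this, map_add, add_mul, ι_inl_mul_append, ι_inr_mul_append]
      exact Submodule.add_mem _ (Submodule.subset_span ⟨_, _, _, _, rfl⟩)
        (Submodule.smul_mem _ _ (Submodule.subset_span ⟨_, _, _, _, rfl⟩))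
    | zero => simp
    | add x y _ _ hx hy => rw [mul_add]; exact Submodule.add_mem _ (hx trivial) (hy trivial)
    | smul c x _ hx => rw [mul_smul_comm]; exact Submodule.smul_mem _ _ (hx trivial)

/-- The map `(v, w) ↦ v ∧ β + w ∧ α`. -/
def lambdaWedge (a b : ℕ) (α : LambdaVW l m (a + 1) b) (β : LambdaVW l m a (b + 1))
    (p : VSpace l × WSpace m) : LambdaVW l m (a + 1) (b + 1) :=
  lambdaProj (a + 1) (b + 1) (ExteriorAlgebra.ι ℂ (p.1, 0) * lambdaIncl a (b + 1) β +
    ExteriorAlgebra.ι ℂ (0, p.2) * lambdaIncl (a + 1) b α)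

/-- The V-part of `p` raises the first degree and the W-part the second, so only two adjacent
components of `θ` contribute. This is why the two factors of ψ suffice to write the equation of the
plane. -/
theorem lambdaProj_ι_mul (a b : ℕ) (p : VSpace l × WSpace m)
    (θ : ExteriorAlgebra ℂ (VSpace l × WSpace m)) :
    lambdaProj (a + 1) (b + 1) (ExteriorAlgebra.ι ℂ p * θ) =
      lambdaWedge a b (lambdaProj (a + 1) b θ) (lambdaProj a (b + 1) θ) p := by
  have hθ : θ ∈ (⊤ : Submodule ℂ (ExteriorAlgebra ℂ (VSpace l × WSpace m))) := trivial
  rw [← span_append_eq_top] at hθ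
  induction hθ using Submodule.span_induction with
  | zero => simp [lambdaWedge]
  | add x y _ _ hx hy =>
    simp only [lambdaWedge, mul_add, map_add] at hx hy ⊢
    rw [hx, hy]
    abel
  | smul c x _ hx =>
    simp only [lambdaWedge, mul_smul_comm, map_smul, map_add] at hx ⊢
    rw [hx, smul_add]
  | mem x h =>
    obtain ⟨a', b', v, w, rfl⟩ := h
    have : p = (p.1, 0) + (0, p.2) := by simp
    conv_lhs => rw [this]
    rw [lambdaWedge, map_add (ExteriorAlgebra.ι ℂ), add_mul, map_add, map_add]
    congr 1
    · by_cases h : a' = a ∧ b' = b + 1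
      · obtain ⟨rfl, rfl⟩ := h
        rw [lambdaProj_append, lambdaIncl_tmul_ιMulti]
      · rw [lambdaProj_append_of_ne h, ι_inl_mul_append, lambdaProj_append_of_ne (by omega)]
        simp
    · by_cases h : a' = a + 1 ∧ b' = b
      · obtain ⟨rfl, rfl⟩ := h
        rw [lambdaProj_append, lambdaIncl_tmul_ιMulti]
      · rw [lambdaProj_append_of_ne h, ι_inr_mul_append, map_smul, lambdaProj_append_of_ne (by omega)]
        simp

end LambdaAlgebra

/-! ### Subspaces, decomposable vectors and the derivation on them. -/

section ExteriorLinearAlgebra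

variable {F : Type*} [AddCommGroup F] [Module ℂ F]

theorem exists_submodule_finrank_eq [FiniteDimensional ℂ F] {K N : Submodule ℂ F} (h : K ≤ N) {a : ℕ}
    (h1 : Module.finrank ℂ K ≤ a) (h2 : a ≤ Module.finrank ℂ N) :
    ∃ L : Submodule ℂ F, K ≤ L ∧ L ≤ N ∧ Module.finrank ℂ L = a := by
  induction a, h1 using Nat.le_induction with
  | base => exact ⟨K, le_rfl, h, rfl⟩
  | succ a _ ih =>
    obtain ⟨L, hKL, hLN, hL⟩ := ih (by omega)
    obtain ⟨x, hxN, hxL⟩ : ∃ x ∈ N, x ∉ L := by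
      by_contra! hcon
      have := Submodule.finrank_mono hcon
      omega
    refine ⟨L ⊔ Submodule.span ℂ {x}, hKL.trans le_sup_left, sup_le hLN ?_, ?_⟩
    · rwa [Submodule.span_singleton_le_iff_mem]
    · rw [Submodule.finrank_sup_span_singleton hxL, hL]

/-- Enlarge K₁ inside a complement of K₂, then take for N₂ a complement of N₁ containing K₂. -/
theorem exists_isCompl_of_disjoint [FiniteDimensional ℂ F] {K₁ K₂ : Submodule ℂ F}
    (h : Disjoint K₁ K₂) {a b : ℕ} (h1 : Module.finrank ℂ K₁ ≤ a) (h2 : Module.finrank ℂ K₂ ≤ b)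
    (hab : Module.finrank ℂ F = a + b) :
    ∃ N₁ N₂ : Submodule ℂ F, IsCompl N₁ N₂ ∧ K₁ ≤ N₁ ∧ K₂ ≤ N₂ ∧
      Module.finrank ℂ N₁ = a ∧ Module.finrank ℂ N₂ = b := by
  obtain ⟨N, hKN, hN⟩ := h.exists_isCompl
  have h3 := Submodule.finrank_add_eq_of_isCompl hN
  obtain ⟨N₁, h4, h5, h6⟩ := exists_submodule_finrank_eq hKN h1 (by omega)
  obtain ⟨N₂, h7, h8⟩ := (hN.disjoint.symm.mono_right h5).exists_isCompl
  have h9 := Submodule.finrank_add_eq_of_isCompl h8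
  exact ⟨N₁, N₂, h8.symm, h4, h7, h6, by omega⟩

theorem exists_dual_family {ι : Type*} [DecidableEq ι] {v : ι → F} (hv : LinearIndependent ℂ v) :
    ∃ f : ι → Module.Dual ℂ F, ∀ i j, f i (v j) = if j = i then 1 else 0 := by
  choose f hf using fun i => LinearMap.exists_extend ((Finsupp.lapply i : (ι →₀ ℂ) →ₗ[ℂ] ℂ) ∘ₗ
    (hv.repr : Submodule.span ℂ (range v) →ₗ[ℂ] (ι →₀ ℂ)))
  refine ⟨f, fun i j => ?_⟩
  have h1 := LinearMap.congr_fun (hf i) ⟨v j, Submodule.subset_span ⟨j, rfl⟩⟩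
  have h2 : f i (v j) = _ := h1
  rw [h2, LinearMap.comp_apply, hv.repr_eq_single j _ rfl, Finsupp.lapply_apply,
    Finsupp.single_apply]

theorem exists_dual_ιMulti {a : ℕ} {v : Fin a → F} (hv : LinearIndependent ℂ v) :
    ∃ f : (⋀[ℂ]^a F) →ₗ[ℂ] ℂ, f (exteriorPower.ιMulti ℂ a v) = 1 := by
  obtain ⟨f, hf⟩ := exists_dual_family hv
  refine ⟨exteriorPower.pairingDual ℂ F a (exteriorPower.ιMulti ℂ a f), ?_⟩
  rw [exteriorPower.pairingDual_ιMulti_ιMulti]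
  have : (Matrix.of fun i j => f j (v i)) = (1 : Matrix (Fin a) (Fin a) ℂ) := by
    ext i j
    rw [Matrix.of_apply, hf, Matrix.one_apply]
  rw [this, Matrix.det_one]

theorem ιMulti_ne_zero_of_linearIndependent {a : ℕ} {v : Fin a → F} (hv : LinearIndependent ℂ v) :
    ExteriorAlgebra.ιMulti ℂ a v ≠ 0 := by
  intro h
  obtain ⟨f, hf⟩ := exists_dual_ιMulti hv
  have : exteriorPower.ιMulti ℂ a v = 0 := Subtype.ext h
  rw [this, map_zero] at hf
  exact zero_ne_one hf

/-- Alternating maps of n vectors in ℂ^n are multiples of the determinant; the factor is the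
determinant of the coefficients of `p'` in terms of `p`. No independence of `p` is needed. -/
theorem exists_ιMulti_eq_smul {n : ℕ} (p p' : Fin n → F)
    (h : ∀ i, p' i ∈ Submodule.span ℂ (range p)) :
    ∃ C : ℂ, ExteriorAlgebra.ιMulti ℂ n p' = C • ExteriorAlgebra.ιMulti ℂ n p := by
  have h' : ∀ i, ∃ c : Fin n → ℂ, Fintype.linearCombination ℂ p c = p' i := fun i =>
    (Submodule.mem_span_range_iff_exists_fun ℂ).1 (h i)
  choose c hc using h'
  refine ⟨(Pi.basisFun ℂ (Fin n)).det c, ?_⟩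
  have key : (ExteriorAlgebra.ιMulti ℂ n).compLinearMap (Fintype.linearCombination ℂ p) =
      (LinearMap.toSpanSingleton ℂ _ (ExteriorAlgebra.ιMulti ℂ n p)).compAlternatingMap
        (Pi.basisFun ℂ (Fin n)).det := by
    refine Module.Basis.ext_alternating (Pi.basisFun ℂ (Fin n)) fun σ hσ => ?_
    obtain ⟨τ, rfl⟩ : ∃ τ : Equiv.Perm (Fin n), ⇑τ = σ :=
      ⟨Equiv.ofBijective σ (Finite.injective_iff_bijective.1 hσ), rfl⟩
    change _ = (Pi.basisFun ℂ (Fin n)).det _ • ExteriorAlgebra.ιMulti ℂ n p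
    have e1 : (fun i => Pi.basisFun ℂ (Fin n) (τ i)) = (Pi.basisFun ℂ (Fin n)) ∘ τ := rfl
    rw [e1, AlternatingMap.map_perm, AlternatingMap.map_perm, Module.Basis.det_self]
    rw [AlternatingMap.compLinearMap_apply, smul_assoc, one_smul]
    congr 2
    funext i
    simp [Fintype.linearCombination_apply]
  have := congrArg (fun f => f c) key
  simp only [AlternatingMap.compLinearMap_apply, hc] at this
  exact this

theorem exists_ιMulti_eq_smul_of_span_eq {n : ℕ} {p p' : Fin n → F} (hp : LinearIndependent ℂ p)
    (h : Submodule.span ℂ (range p') = Submodule.span ℂ (range p)) :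
    ∃ C : ℂ, C ≠ 0 ∧ ExteriorAlgebra.ιMulti ℂ n p' = C • ExteriorAlgebra.ιMulti ℂ n p := by
  obtain ⟨C, hC⟩ := exists_ιMulti_eq_smul p p' fun i => h ▸ Submodule.subset_span ⟨i, rfl⟩
  obtain ⟨C', hC'⟩ := exists_ιMulti_eq_smul p' p fun i => h ▸ Submodule.subset_span ⟨i, rfl⟩
  refine ⟨C, ?_, hC⟩
  rintro rfl
  rw [hC, zero_smul, smul_zero] at hC'
  exact ιMulti_ne_zero_of_linearIndependent hp hC'

theorem ι_mul_ιMulti {n : ℕ} (y : F) (p : Fin n → F) :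
    ExteriorAlgebra.ι ℂ y * ExteriorAlgebra.ιMulti ℂ n p =
      ExteriorAlgebra.ιMulti ℂ (n + 1) (Fin.cons y p) := by
  rw [ExteriorAlgebra.ιMulti_succ_apply]
  rfl

theorem ι_mul_ιMulti_of_mem_span {n : ℕ} (y : F) (p : Fin n → F)
    (hy : y ∈ Submodule.span ℂ (range p)) :
    ExteriorAlgebra.ι ℂ y * ExteriorAlgebra.ιMulti ℂ n p = 0 := by
  rw [ι_mul_ιMulti]
  apply AlternatingMap.map_linearDependent
  rw [linearIndependent_finCons]
  exact fun h => h.2 hy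

/-- The value of the derivation extending `p i ↦ d i` on `p 0 ∧ p 1 ∧ ⋯`. -/
def ιMultiDeriv {n : ℕ} (p d : Fin n → F) : ExteriorAlgebra ℂ F :=
  ∑ i, ExteriorAlgebra.ιMulti ℂ n (Function.update p i (d i))

/-- This is the Leibniz rule applied to p_j ∧ (p₀ ∧ p₁ ∧ ⋯) = 0. -/
theorem ι_mul_ιMultiDeriv {n : ℕ} (p d : Fin n → F) (j : Fin n) :
    ExteriorAlgebra.ι ℂ (p j) * ιMultiDeriv p d +
      ExteriorAlgebra.ι ℂ (d j) * ExteriorAlgebra.ιMulti ℂ n p = 0 := by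
  rw [ιMultiDeriv, Finset.mul_sum, Finset.sum_eq_single j]
  · rw [ι_mul_ιMulti, ι_mul_ιMulti]
    have : (Fin.cons (p j) (Function.update p j (d j)) : Fin (n + 1) → F) =
        (Fin.cons (d j) p : Fin (n + 1) → F) ∘ Equiv.swap 0 j.succ := by
      funext i
      refine Fin.cases ?_ (fun i => ?_) i
      · simp
      · by_cases hij : i = j
        · subst hij; simp
        · rw [Function.comp_apply, Equiv.swap_apply_of_ne_of_ne (Fin.succ_ne_zero i)
            (fun h => hij (Fin.succ_injective _ h))]
          simp [hij]
    -- Only the term replacing p_j survives, and it differs from the second summand by exchanging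
    -- p_j and d_j.
    rw [this, AlternatingMap.map_swap _ _ (Fin.succ_ne_zero j).symm, neg_add_cancel]
  · intro i _ hij
    apply ι_mul_ιMulti_of_mem_span
    refine Submodule.subset_span ⟨j, ?_⟩
    rw [Function.update_of_ne hij.symm]
  · simp

theorem ιMultiDeriv_add {n : ℕ} (p d d' : Fin n → F) :
    ιMultiDeriv p (fun i => d i + d' i) = ιMultiDeriv p d + ιMultiDeriv p d' := by
  simp only [ιMultiDeriv, AlternatingMap.map_update_add, Finset.sum_add_distrib]

theorem ιMultiDeriv_smul {n : ℕ} (c : ℂ) (p d : Fin n → F) :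
    ιMultiDeriv p (fun i => c • d i) = c • ιMultiDeriv p d := by
  simp only [ιMultiDeriv, AlternatingMap.map_update_smul, Finset.smul_sum]

theorem exists_ιMultiDeriv_eq_smul {n : ℕ} (p d : Fin n → F)
    (h : ∀ i, d i ∈ Submodule.span ℂ (range p)) :
    ∃ C : ℂ, ιMultiDeriv p d = C • ExteriorAlgebra.ιMulti ℂ n p := by
  have : ∀ i, ∃ C : ℂ, ExteriorAlgebra.ιMulti ℂ n (Function.update p i (d i)) =
      C • ExteriorAlgebra.ιMulti ℂ n p := by
    intro i
    apply exists_ιMulti_eq_smul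
    intro j
    by_cases hj : j = i
    · subst hj; simpa using h j
    · rw [Function.update_of_ne hj]; exact Submodule.subset_span ⟨j, rfl⟩
  choose C hC using this
  exact ⟨∑ i, C i, by simp only [ιMultiDeriv, hC, Finset.sum_smul]⟩

end ExteriorLinearAlgebra

/-! ### Which components of a decomposable vector vanish, and how they determine its span. -/

section LambdaProjection

variable {l m : ℕ}

/-- The endomorphism `(v, w) ↦ (c v, d w)` of `V ⊕ W`. -/
def diagMap (l m : ℕ) (c d : ℂ) : VSpace l × WSpace m →ₗ[ℂ] VSpace l × WSpace m :=
  (c • LinearMap.id).prodMap (d • LinearMap.id)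

@[simp]
theorem diagMap_apply (c d : ℂ) (p : VSpace l × WSpace m) :
    diagMap l m c d p = (c • p.1, d • p.2) := rfl

theorem diagMap_injective {c d : ℂ} (hc : c ≠ 0) (hd : d ≠ 0) :
    Function.Injective (diagMap l m c d) := by
  intro p q h
  rw [diagMap_apply, diagMap_apply, Prod.mk.injEq] at h
  exact Prod.ext (smul_right_injective _ hc h.1) (smul_right_injective _ hd h.2)

theorem lambdaProj_diagMap (a b : ℕ) (c d : ℂ) {n : ℕ} (p : Fin n → VSpace l × WSpace m) :
    lambdaProj a b (ExteriorAlgebra.ιMulti ℂ n fun i => diagMap l m c d (p i)) =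
      (c ^ a * d ^ b) • lambdaProj a b (ExteriorAlgebra.ιMulti ℂ n p) := by
  rw [← lambdaMap_smul_id, ← lambdaProj_map, ExteriorAlgebra.map_apply_ιMulti]
  rfl

/-- A change of basis contributes its determinant, the same for all bidegrees, and diag(c, d)
contributes c^a d^b. Hence the projective class of each component depends only on the plane modulo
GL(1) × GL(1). -/
theorem exists_lambdaProj_eq_smul {n : ℕ} {p p' : Fin n → VSpace l × WSpace m}
    (hp : LinearIndependent ℂ p) {c d : ℂ} (hc : c ≠ 0) (hd : d ≠ 0)
    (h : Submodule.span ℂ (range p') = (Submodule.span ℂ (range p)).map (diagMap l m c d))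
    (a b : ℕ) :
    ∃ C : ℂ, C ≠ 0 ∧ lambdaProj a b (ExteriorAlgebra.ιMulti ℂ n p') =
      C • lambdaProj a b (ExteriorAlgebra.ιMulti ℂ n p) := by
  have h1 : LinearIndependent ℂ (fun i => diagMap l m c d (p i)) :=
    hp.map' _ (LinearMap.ker_eq_bot.2 (diagMap_injective hc hd))
  have h2 : Submodule.span ℂ (range p') =
      Submodule.span ℂ (range fun i => diagMap l m c d (p i)) := by
    rw [h, Submodule.map_span, ← range_comp]
    rfl
  obtain ⟨C, hC, h3⟩ := exists_ιMulti_eq_smul_of_span_eq h1 h2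
  refine ⟨C * (c ^ a * d ^ b), by positivity, ?_⟩
  rw [h3, map_smul, lambdaProj_diagMap, smul_smul]

/-- Each shuffle term contains the wedge of a vectors from the V-projection and of b vectors from
the W-projection; if either projection is too small these are dependent. -/
theorem le_finrank_of_lambdaProj_ne_zero {a b n : ℕ} {p : Fin n → VSpace l × WSpace m}
    (h : lambdaProj a b (ExteriorAlgebra.ιMulti ℂ n p) ≠ 0) :
    a ≤ Module.finrank ℂ ((Submodule.span ℂ (range p)).map (LinearMap.fst ℂ _ _)) ∧
      b ≤ Module.finrank ℂ ((Submodule.span ℂ (range p)).map (LinearMap.snd ℂ _ _)) := by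
  have key : ∀ {F : Type} [AddCommGroup F] [Module ℂ F] [FiniteDimensional ℂ F] {c : ℕ}
      (g : VSpace l × WSpace m →ₗ[ℂ] F) (τ : Fin c → Fin n),
      ¬ c ≤ Module.finrank ℂ ((Submodule.span ℂ (range p)).map g) →
      exteriorPower.ιMulti ℂ c (fun i => g (p (τ i))) = 0 := by
    intro F _ _ _ c g τ hc
    apply AlternatingMap.map_linearDependent
    intro hli
    apply hc
    have h1 := finrank_span_eq_card hli
    rw [Fintype.card_fin] at h1
    rw [← h1]
    apply Submodule.finrank_mono
    rw [Submodule.span_le]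
    rintro _ ⟨i, rfl⟩
    exact ⟨p (τ i), Submodule.subset_span ⟨_, rfl⟩, rfl⟩
  have hn : n = a + b := by
    by_contra hn
    exact h (lambdaProj_ιMulti_of_ne hn p)
  subst hn
  by_contra hcon
  rw [not_and_or] at hcon
  refine h ((lambdaProj_ιMulti a b p).trans (Finset.sum_eq_zero fun σ _ => ?_))
  induction σ using Quotient.inductionOn' with | _ σ
  rw [domCoprod_summand_fst_snd]
  rcases hcon with hcon | hcon
  · have := key (LinearMap.fst ℂ _ _) (fun i => finSumFinEquiv (σ (Sum.inl i))) hcon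
    simp only [LinearMap.fst_apply] at this
    rw [this, TensorProduct.zero_tmul, smul_zero]
  · have := key (LinearMap.snd ℂ _ _) (fun i => finSumFinEquiv (σ (Sum.inr i))) hcon
    simp only [LinearMap.snd_apply] at this
    rw [this, TensorProduct.tmul_zero, smul_zero]

/-- The kernel condition makes A ∘ π factor through A on its range, and the factor extends to all of
F. -/
theorem exists_endomorphism_comp_eq {E F : Type*} [AddCommGroup E] [Module ℂ E] [AddCommGroup F]
    [Module ℂ F] (A : E →ₗ[ℂ] F) (π : E →ₗ[ℂ] E) (h : LinearMap.ker A ≤ LinearMap.ker π) :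
    ∃ f : F →ₗ[ℂ] F, ∀ c, f (A c) = A (π c) := by
  obtain ⟨r, hr⟩ := A.rangeRestrict.exists_rightInverse_of_surjective A.range_rangeRestrict
  obtain ⟨f, hf⟩ := LinearMap.exists_extend (A ∘ₗ π ∘ₗ r)
  refine ⟨f, fun c => ?_⟩
  have h1 : f (A c) = A (π (r (A.rangeRestrict c))) := LinearMap.congr_fun hf (A.rangeRestrict c)
  rw [h1]
  congr 1
  rw [← sub_eq_zero, ← map_sub]
  apply h
  rw [LinearMap.mem_ker, map_sub, sub_eq_zero]
  exact congrArg Subtype.val (LinearMap.congr_fun hr (A.rangeRestrict c))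

/-- The kernels of the two projections A, B of the plane are disjoint, of dimensions at most b and
a. Enlarge ker B to N₁ of dimension a and ker A to a complement N₂ of dimension b. The projections
of N₁ ⊕ N₂ descend to maps f on V and g on W, and f ⊕ g turns a basis adapted to the splitting into
vectors of A(N₁) followed by vectors of B(N₂). Since A is injective on N₁ and B on N₂, the component
is then a nonzero pure tensor. -/
theorem lambdaProj_ne_zero {a b n : ℕ} {p : Fin n → VSpace l × WSpace m} (hn : n = a + b)
    (hp : LinearIndependent ℂ p)
    (ha : a ≤ Module.finrank ℂ ((Submodule.span ℂ (range p)).map (LinearMap.fst ℂ _ _)))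
    (hb : b ≤ Module.finrank ℂ ((Submodule.span ℂ (range p)).map (LinearMap.snd ℂ _ _))) :
    lambdaProj a b (ExteriorAlgebra.ιMulti ℂ n p) ≠ 0 := by
  subst hn
  set L : (Fin (a + b) → ℂ) →ₗ[ℂ] VSpace l × WSpace m := Fintype.linearCombination ℂ p with hL
  have hLr : LinearMap.range L = Submodule.span ℂ (range p) := Fintype.range_linearCombination ℂ p
  have hLi : Function.Injective L := linearIndependent_iff_injective_fintypeLinearCombination.1 hp
  set A := LinearMap.fst ℂ (VSpace l) (WSpace m) ∘ₗ L with hA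
  set B := LinearMap.snd ℂ (VSpace l) (WSpace m) ∘ₗ L with hB
  have hL' : ∀ c, L c = (A c, B c) := fun c => rfl
  rw [← hLr, ← LinearMap.range_comp] at ha hb
  rw [← hA] at ha
  rw [← hB] at hb
  have hrA := LinearMap.finrank_range_add_finrank_ker A
  have hrB := LinearMap.finrank_range_add_finrank_ker B
  rw [Module.finrank_fin_fun] at hrA hrB
  have hdis : Disjoint (LinearMap.ker B) (LinearMap.ker A) := by
    rw [Submodule.disjoint_def]
    intro c hcB hcA
    apply hLi
    rw [hL', LinearMap.mem_ker.1 hcB, LinearMap.mem_ker.1 hcA, map_zero]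
    rfl
  obtain ⟨N₁, N₂, hN, h1, h2, h3, h4⟩ := exists_isCompl_of_disjoint hdis
    (a := a) (b := b) (by omega) (by omega) (by simp)
  set π₁ : (Fin (a + b) → ℂ) →ₗ[ℂ] (Fin (a + b) → ℂ) :=
    N₁.subtype ∘ₗ Submodule.projectionOnto N₁ N₂ hN
  set π₂ : (Fin (a + b) → ℂ) →ₗ[ℂ] (Fin (a + b) → ℂ) :=
    N₂.subtype ∘ₗ Submodule.projectionOnto N₂ N₁ hN.symm
  obtain ⟨f, hf⟩ := exists_endomorphism_comp_eq A π₁ (by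
    refine h2.trans fun c hc => ?_
    rw [LinearMap.mem_ker, LinearMap.comp_apply,
      (Submodule.projectionOnto_apply_eq_zero_iff hN).2 hc, map_zero])
  obtain ⟨g, hg⟩ := exists_endomorphism_comp_eq B π₂ (by
    refine h1.trans fun c hc => ?_
    rw [LinearMap.mem_ker, LinearMap.comp_apply,
      (Submodule.projectionOnto_apply_eq_zero_iff hN.symm).2 hc, map_zero])
  let b₁ := Module.finBasisOfFinrankEq ℂ N₁ h3
  let b₂ := Module.finBasisOfFinrankEq ℂ N₂ h4
  have hv : LinearIndependent ℂ (fun i => A (b₁ i)) := by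
    refine b₁.linearIndependent.map' (A ∘ₗ N₁.subtype) ?_
    rw [LinearMap.ker_comp, ← Submodule.disjoint_iff_comap_eq_bot]
    exact hN.disjoint.mono_right h2
  have hw : LinearIndependent ℂ (fun i => B (b₂ i)) := by
    refine b₂.linearIndependent.map' (B ∘ₗ N₂.subtype) ?_
    rw [LinearMap.ker_comp, ← Submodule.disjoint_iff_comap_eq_bot]
    exact hN.symm.disjoint.mono_right h1
  intro h0
  set p' : Fin (a + b) → VSpace l × WSpace m :=
    Fin.append (fun i => L (b₁ i)) (fun j => L (b₂ j)) with hp'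
  obtain ⟨C, hC⟩ := exists_ιMulti_eq_smul p p' (by
    intro i
    rw [← hLr]
    refine Fin.addCases (fun i => ?_) (fun j => ?_) i
    · rw [hp', Fin.append_left]; exact ⟨_, rfl⟩
    · rw [hp', Fin.append_right]; exact ⟨_, rfl⟩)
  have h5 : lambdaProj a b (ExteriorAlgebra.ιMulti ℂ (a + b) p') = 0 := by
    rw [hC, map_smul, h0, smul_zero]
  have h6 := lambdaProj_map a b f g (ExteriorAlgebra.ιMulti ℂ (a + b) p')
  rw [h5, map_zero, ExteriorAlgebra.map_apply_ιMulti] at h6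
  have h7 : (f.prodMap g) ∘ p' =
      Fin.append (fun i => (A (b₁ i), 0)) (fun j => (0, B (b₂ j))) := by
    funext i
    refine Fin.addCases (fun i => ?_) (fun j => ?_) i
    · rw [Function.comp_apply, hp', Fin.append_left, Fin.append_left, hL', LinearMap.prodMap_apply,
        hf, hg]
      simp [π₁, π₂]
    · rw [Function.comp_apply, hp', Fin.append_right, Fin.append_right, hL',
        LinearMap.prodMap_apply, hf, hg]
      simp [π₁, π₂]
  rw [h7, lambdaProj_append] at h6
  obtain ⟨φ, hφ⟩ := exists_dual_ιMulti hv
  obtain ⟨χ, hχ⟩ := exists_dual_ιMulti hw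
  have h8 := congrArg (TensorProduct.lid ℂ ℂ) (congrArg (TensorProduct.map φ χ) h6)
  rw [TensorProduct.map_tmul, hφ, hχ, map_zero, map_zero, TensorProduct.lid_tmul, smul_eq_mul,
    mul_one] at h8
  exact one_ne_zero h8

theorem lambdaWedge_add_right (a b : ℕ) (α : LambdaVW l m (a + 1) b) (β : LambdaVW l m a (b + 1))
    (p q : VSpace l × WSpace m) :
    lambdaWedge a b α β (p + q) = lambdaWedge a b α β p + lambdaWedge a b α β q := by
  have h1 : ((p + q).1, (0 : WSpace m)) = (p.1, 0) + (q.1, 0) := by simp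
  have h2 : ((0 : VSpace l), (p + q).2) = (0, p.2) + (0, q.2) := by simp
  refine (congrArg (lambdaProj (a + 1) (b + 1)) ?_).trans
    (LinearMap.map_add (lambdaProj (a + 1) (b + 1)) _ _)
  rw [h1, h2, map_add (ExteriorAlgebra.ι ℂ), map_add (ExteriorAlgebra.ι ℂ), add_mul, add_mul]
  exact add_add_add_comm _ _ _ _

/-- The factors are exchanged because the V-part of `p` is wedged with `β` and the W-part with `α`.
-/
theorem lambdaWedge_smul_smul (a b : ℕ) (c d : ℂ) (α : LambdaVW l m (a + 1) b)
    (β : LambdaVW l m a (b + 1)) (p : VSpace l × WSpace m) :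
    lambdaWedge a b (c • α) (d • β) p = lambdaWedge a b α β (diagMap l m d c p) := by
  have h1 : (d • p.1, (0 : WSpace m)) = d • (p.1, (0 : WSpace m)) := by simp
  have h2 : ((0 : VSpace l), c • p.2) = c • ((0 : VSpace l), p.2) := by simp
  rw [lambdaWedge, lambdaWedge, diagMap_apply, h1, h2]
  simp only [map_smul, smul_mul_assoc, mul_smul_comm]

/-- For y outside the span, y together with p spans a larger plane. Nonvanishing of the two
components bounds the projections of the span of p below by a + 1 and b + 1, so the (a+1, b+1)
component of the larger Plücker vector is nonzero by `lambdaProj_ne_zero`. -/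
theorem lambdaWedge_eq_zero_iff {a b n : ℕ} {p : Fin n → VSpace l × WSpace m}
    (hn : n = a + b + 1) (hp : LinearIndependent ℂ p)
    (hα : lambdaProj (a + 1) b (ExteriorAlgebra.ιMulti ℂ n p) ≠ 0)
    (hβ : lambdaProj a (b + 1) (ExteriorAlgebra.ιMulti ℂ n p) ≠ 0) (y : VSpace l × WSpace m) :
    lambdaWedge a b (lambdaProj (a + 1) b (ExteriorAlgebra.ιMulti ℂ n p))
      (lambdaProj a (b + 1) (ExteriorAlgebra.ιMulti ℂ n p)) y = 0 ↔
      y ∈ Submodule.span ℂ (range p) := by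
  rw [← lambdaProj_ι_mul]
  constructor
  · intro h
    by_contra hy
    rw [ι_mul_ιMulti] at h
    have hle : Submodule.span ℂ (range p) ≤
        Submodule.span ℂ (range (Fin.cons y p : Fin (n + 1) → VSpace l × WSpace m)) := by
      apply Submodule.span_mono
      rw [Fin.range_cons]
      exact subset_insert _ _
    refine lambdaProj_ne_zero (by omega) (linearIndependent_finCons.2 ⟨hp, hy⟩) ?_ ?_ h
    · exact (le_finrank_of_lambdaProj_ne_zero hα).1.trans
        (Submodule.finrank_mono (Submodule.map_mono hle))
    · exact (le_finrank_of_lambdaProj_ne_zero hβ).2.trans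
        (Submodule.finrank_mono (Submodule.map_mono hle))
  · intro h
    rw [ι_mul_ιMulti_of_mem_span _ _ h, map_zero]

/-- The infinitesimal form of recovering the plane: if both projective components are stationary,
each frame vector moves only within the plane and by one common diagonal map. Leibniz's rule
`ι_mul_ιMultiDeriv` supplies the equation of the plane. -/
theorem add_diagMap_mem_span {a b n : ℕ} {p d : Fin n → VSpace l × WSpace m}
    (hn : n = a + b + 1) (hp : LinearIndependent ℂ p)
    (hα : lambdaProj (a + 1) b (ExteriorAlgebra.ιMulti ℂ n p) ≠ 0)
    (hβ : lambdaProj a (b + 1) (ExteriorAlgebra.ιMulti ℂ n p) ≠ 0) {c c' : ℂ}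
    (h1 : lambdaProj (a + 1) b (ιMultiDeriv p d) =
      c • lambdaProj (a + 1) b (ExteriorAlgebra.ιMulti ℂ n p))
    (h2 : lambdaProj a (b + 1) (ιMultiDeriv p d) =
      c' • lambdaProj a (b + 1) (ExteriorAlgebra.ιMulti ℂ n p)) (j : Fin n) :
    d j + diagMap l m c' c (p j) ∈ Submodule.span ℂ (range p) := by
  rw [← lambdaWedge_eq_zero_iff hn hp hα hβ, lambdaWedge_add_right, ← lambdaWedge_smul_smul, ← h1,
    ← h2, ← lambdaProj_ι_mul, ← lambdaProj_ι_mul, ← map_add, add_comm (_ * _) (_ * _),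
    ι_mul_ιMultiDeriv, map_zero]

theorem exists_lambdaProj_ne_zero {k : ℕ} {p : Fin (k + 1) → VSpace l × WSpace m}
    (hp : LinearIndependent ℂ p)
    (h : k + 2 ≤ Module.finrank ℂ ((Submodule.span ℂ (range p)).map (LinearMap.fst ℂ _ _)) +
      Module.finrank ℂ ((Submodule.span ℂ (range p)).map (LinearMap.snd ℂ _ _))) :
    ∃ a b : ℕ, a + b = k ∧ lambdaProj (a + 1) b (ExteriorAlgebra.ιMulti ℂ (k + 1) p) ≠ 0 ∧
      lambdaProj a (b + 1) (ExteriorAlgebra.ιMulti ℂ (k + 1) p) ≠ 0 := by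
  set r := Module.finrank ℂ ((Submodule.span ℂ (range p)).map (LinearMap.fst ℂ _ _)) with hr
  set s := Module.finrank ℂ ((Submodule.span ℂ (range p)).map (LinearMap.snd ℂ _ _)) with hs
  have hP : Module.finrank ℂ (Submodule.span ℂ (range p)) = k + 1 := by
    rw [finrank_span_eq_card hp, Fintype.card_fin]
  have hr1 : r ≤ k + 1 := hP ▸ Submodule.finrank_map_le _ _
  have hs1 : s ≤ k + 1 := hP ▸ Submodule.finrank_map_le _ _
  -- The bidegrees (r, k+1-r) and (r-1, k+2-r) both satisfy the dimension bounds, since r + s ≥ k +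
  -- 2; that r ≥ 1 follows from s ≤ k + 1.
  refine ⟨r - 1, k - (r - 1), by omega, lambdaProj_ne_zero (by omega) hp ?_ ?_,
    lambdaProj_ne_zero (by omega) hp ?_ ?_⟩ <;> omega

end LambdaProjection

/-! ### The expression defining φ as a Plücker vector. -/

section PhiTotal

variable {F : Type*} [AddCommGroup F] [Module ℂ F]

/-- Expanding the right-hand side, terms with two corrections contain v ∧ v = 0; the terms with one
correction are v ∧ i(f). -/
theorem ιMulti_sub_ι_mul_contractLeft {n : ℕ} (f : Module.Dual ℂ F) (v : F) (u : Fin n → F) :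
    ExteriorAlgebra.ιMulti ℂ n u -
      ExteriorAlgebra.ι ℂ v * CliffordAlgebra.contractLeft f (ExteriorAlgebra.ιMulti ℂ n u) =
    ExteriorAlgebra.ιMulti ℂ n (fun i => u i - f (u i) • v) := by
  induction n with
  | zero =>
    rw [ExteriorAlgebra.ιMulti_zero_apply, ExteriorAlgebra.ιMulti_zero_apply]
    have : CliffordAlgebra.contractLeft f (1 : ExteriorAlgebra ℂ F) = 0 :=
      CliffordAlgebra.contractLeft_one _ f
    rw [this, mul_zero, sub_zero]
  | succ n ih =>
    rw [ExteriorAlgebra.ιMulti_succ_apply, ExteriorAlgebra.ιMulti_succ_apply]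
    have h1 := ih (fun i => u i.succ)
    have h2 : (Matrix.vecTail fun i => u i - f (u i) • v) =
        fun i => u (Fin.succ i) - f (u (Fin.succ i)) • v := rfl
    have h3 : Matrix.vecTail u = fun i => u (Fin.succ i) := rfl
    rw [h2, ← h1, h3]
    set w := ExteriorAlgebra.ιMulti ℂ n fun i => u (Fin.succ i)
    have h4 : CliffordAlgebra.contractLeft f (ExteriorAlgebra.ι ℂ (u 0) * w) =
        f (u 0) • w - ExteriorAlgebra.ι ℂ (u 0) * CliffordAlgebra.contractLeft f w :=
      CliffordAlgebra.contractLeft_ι_mul f (u 0) w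
    rw [h4, map_sub, map_smul]
    have h5 := eq_neg_of_add_eq_zero_left (ExteriorAlgebra.ι_add_mul_swap (R := ℂ) (u 0) v)
    have h6 := ExteriorAlgebra.ι_sq_zero (R := ℂ) v
    simp only [mul_sub, sub_mul, smul_mul_assoc, mul_smul_comm, ← mul_assoc, h5, h6, neg_mul]
    rw [zero_mul, smul_zero, sub_zero]
    abel

theorem ι_mul_ιMulti_sub_smul {n : ℕ} (x : F) (u : Fin n → F) (c : Fin n → ℂ) :
    ExteriorAlgebra.ι ℂ x * ExteriorAlgebra.ιMulti ℂ n (fun i => u i - c i • x) =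
      ExteriorAlgebra.ι ℂ x * ExteriorAlgebra.ιMulti ℂ n u := by
  induction n with
  | zero => simp
  | succ n ih =>
    rw [ExteriorAlgebra.ιMulti_succ_apply, ExteriorAlgebra.ιMulti_succ_apply]
    have h1 := ih (fun i => u i.succ) (fun i => c i.succ)
    have h2 : (Matrix.vecTail fun i => u i - c i • x) =
        fun i => u (Fin.succ i) - c (Fin.succ i) • x := rfl
    have h3 : Matrix.vecTail u = fun i => u (Fin.succ i) := rfl
    rw [h2, h3, map_sub, map_smul, sub_mul, mul_sub, ← mul_assoc, ← mul_assoc,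
      ← mul_assoc, mul_smul_comm, ExteriorAlgebra.ι_sq_zero, smul_zero, zero_mul, sub_zero,
      eq_neg_of_add_eq_zero_left (ExteriorAlgebra.ι_add_mul_swap (R := ℂ) x (u 0)), neg_mul, neg_mul,
      mul_assoc, h1, mul_assoc]

variable {l m : ℕ}

/-- The orthogonal projection of `V ⊕ W` onto `x^⊥ ⊕ y^⊥`. -/
def perpMap (x : VSpace l) (y : WSpace m) : VSpace l × WSpace m →ₗ[ℂ] VSpace l × WSpace m :=
  (LinearMap.id - ((conjV x x)⁻¹ • conjV x).smulRight x).prodMap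
    (LinearMap.id - ((conjW y y)⁻¹ • conjW y).smulRight y)

theorem perpMap_apply (x : VSpace l) (y : WSpace m) (u : VSpace l × WSpace m) :
    perpMap x y u = (u.1 - ((conjV x x)⁻¹ * conjV x u.1) • x,
      u.2 - ((conjW y y)⁻¹ * conjW y u.2) • y) := rfl

/-- In each summand one projection is already applied, and the other may be applied freely because
of the leading factor x or y. Both summands then have the same tail, and the leading factors add up
to (x, y). -/
theorem phiTotal_ιMulti {k : ℕ} (x : VSpace l) (y : WSpace m) (u : Fin k → VSpace l × WSpace m) :
    phiTotal x y (ExteriorAlgebra.ιMulti ℂ k u) =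
      ExteriorAlgebra.ιMulti ℂ (k + 1) (Fin.cons (x, y) fun i => perpMap x y (u i)) := by
  set f : Module.Dual ℂ (VSpace l × WSpace m) :=
    (conjV x x)⁻¹ • (conjV x ∘ₗ LinearMap.fst ℂ (VSpace l) (WSpace m)) with hf
  set g : Module.Dual ℂ (VSpace l × WSpace m) :=
    (conjW y y)⁻¹ • (conjW y ∘ₗ LinearMap.snd ℂ (VSpace l) (WSpace m)) with hg
  have h1 : ∀ z : ExteriorAlgebra ℂ (VSpace l × WSpace m),
      (conjW y y)⁻¹ • (ExteriorAlgebra.ι ℂ ((0, y) : VSpace l × WSpace m) *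
      CliffordAlgebra.contractLeft (conjW y ∘ₗ LinearMap.snd ℂ (VSpace l) (WSpace m)) z) =
      ExteriorAlgebra.ι ℂ ((0, y) : VSpace l × WSpace m) * CliffordAlgebra.contractLeft g z := by
    intro z
    rw [hg, map_smul, LinearMap.smul_apply, mul_smul_comm]
  have h2 : ∀ z : ExteriorAlgebra ℂ (VSpace l × WSpace m),
      (conjV x x)⁻¹ • (ExteriorAlgebra.ι ℂ ((x, 0) : VSpace l × WSpace m) *
      CliffordAlgebra.contractLeft (conjV x ∘ₗ LinearMap.fst ℂ (VSpace l) (WSpace m)) z) =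
      ExteriorAlgebra.ι ℂ ((x, 0) : VSpace l × WSpace m) * CliffordAlgebra.contractLeft f z := by
    intro z
    rw [hf, map_smul, LinearMap.smul_apply, mul_smul_comm]
  rw [phiTotal, h1, h2, ιMulti_sub_ι_mul_contractLeft, ιMulti_sub_ι_mul_contractLeft,
    ← ι_mul_ιMulti_sub_smul (x, 0) _ (fun i => f (u i)),
    ← ι_mul_ιMulti_sub_smul (0, y) _ (fun i => g (u i)), ← ι_mul_ιMulti]
  have e1 : (fun i => u i - g (u i) • ((0, y) : VSpace l × WSpace m) -
      f (u i) • ((x, 0) : VSpace l × WSpace m)) = fun i => perpMap x y (u i) := by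
    funext i
    rw [perpMap_apply]
    ext <;> simp [hf, hg]
  have e2 : (fun i => u i - f (u i) • ((x, 0) : VSpace l × WSpace m) -
      g (u i) • ((0, y) : VSpace l × WSpace m)) = fun i => perpMap x y (u i) := by
    funext i
    rw [perpMap_apply]
    ext <;> simp [hf, hg]
  rw [e1, e2, ← add_mul, ← map_add]
  simp

end PhiTotal

/-! ### Continuity of multilinear maps in finite dimension. -/

section MultilinearContinuity

variable {E F : Type*} [NormedAddCommGroup E] [NormedSpace ℂ E] [FiniteDimensional ℂ E]
  [NormedAddCommGroup F] [NormedSpace ℂ F] {n : ℕ}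

theorem MultilinearMap.continuous_of_finiteDimensional
    (f : MultilinearMap ℂ (fun _ : Fin n => E) F) : Continuous f := by
  classical
  let b := Module.finBasis ℂ E
  have h : ∀ p, f p = ∑ r : Fin n → Fin (Module.finrank ℂ E),
      (∏ i, b.repr (p i) (r i)) • f fun i => b (r i) := by
    intro p
    have h1 : p = fun i => ∑ j, b.repr (p i) j • b j := by
      funext i
      exact (b.sum_repr (p i)).symm
    conv_lhs => rw [h1]
    rw [MultilinearMap.map_sum]
    exact Finset.sum_congr rfl fun r _ => f.map_smul_univ _ _
  have h' : (f : (Fin n → E) → F) = fun p => ∑ r : Fin n → Fin (Module.finrank ℂ E),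
      (∏ i, b.repr (p i) (r i)) • f fun i => b (r i) := funext h
  rw [h']
  refine continuous_finsetSum _ fun r _ => Continuous.smul ?_ continuous_const
  refine continuous_finsetProd _ fun i _ => ?_
  have : Continuous fun x : E => b.repr x (r i) :=
    (b.coord (r i)).continuous_of_finiteDimensional
  exact this.comp (continuous_apply i)

end MultilinearContinuity

/-! ### Differentiating the components of a decomposable vector. -/

section LambdaAnalysis

variable {l m n : ℕ} {F : Type*} [NormedAddCommGroup F] [NormedSpace ℂ F] {a b : ℕ}

/-- The multilinear map `p ↦ S (p 0 ∧ p 1 ∧ ⋯)_{a,b}` for a linear map `S` on `Λ^a V ⊗ Λ^b W`. -/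
def lambdaMultilinear (n : ℕ) (S : LambdaVW l m a b →ₗ[ℂ] F) :
    ContinuousMultilinearMap ℂ (fun _ : Fin n => VSpace l × WSpace m) F where
  toMultilinearMap := (S ∘ₗ lambdaProj a b).compMultilinearMap
    (ExteriorAlgebra.ιMulti ℂ n).toMultilinearMap
  cont := MultilinearMap.continuous_of_finiteDimensional _

theorem lambdaMultilinear_apply (S : LambdaVW l m a b →ₗ[ℂ] F) (p : Fin n → VSpace l × WSpace m) :
    lambdaMultilinear n S p = S (lambdaProj a b (ExteriorAlgebra.ιMulti ℂ n p)) := rfl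

theorem linearDeriv_lambdaMultilinear (S : LambdaVW l m a b →ₗ[ℂ] F)
    (p d : Fin n → VSpace l × WSpace m) :
    (lambdaMultilinear n S).linearDeriv p d = S (lambdaProj a b (ιMultiDeriv p d)) := by
  rw [ContinuousMultilinearMap.linearDeriv_apply, ιMultiDeriv, map_sum, map_sum]
  rfl

/-- Euler's identity: differentiate the scaling rule (1 + s)^a for diag(1 + s, 1) at s = 0. -/
theorem lambdaProj_ιMultiDeriv_fst (p : Fin n → VSpace l × WSpace m) :
    lambdaProj a b (ιMultiDeriv p fun i => ((p i).1, 0)) =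
      (a : ℂ) • lambdaProj a b (ExteriorAlgebra.ιMulti ℂ n p) := by
  -- Linear coordinates move the identity to a normed space, where it can be differentiated.
  let S : LambdaVW l m a b ≃ₗ[ℂ] (Fin (Module.finrank ℂ (LambdaVW l m a b)) → ℂ) :=
    (Module.finBasis ℂ (LambdaVW l m a b)).equivFun
  apply S.injective
  rw [map_smul]
  have h1 := linearDeriv_lambdaMultilinear S.toLinearMap p fun i => ((p i).1, 0)
  rw [LinearEquiv.coe_coe] at h1
  rw [← h1]
  have h2 : HasDerivAt (fun s : ℂ => fun i => p i + s • (((p i).1, 0) : VSpace l × WSpace m))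
      (fun i => ((p i).1, 0)) 0 := by
    rw [hasDerivAt_pi]
    intro i
    simpa using ((hasDerivAt_id (0 : ℂ)).smul_const (((p i).1, 0) : VSpace l × WSpace m)).const_add
      (p i)
  have h3 := ((lambdaMultilinear n S.toLinearMap).hasFDerivAt
    (fun i => p i + (0 : ℂ) • (((p i).1, 0) : VSpace l × WSpace m))).comp_hasDerivAt (0 : ℂ) h2
  have h4 : (fun s : ℂ => lambdaMultilinear n S.toLinearMap
      (fun i => p i + s • (((p i).1, 0) : VSpace l × WSpace m))) =
      fun s : ℂ => (1 + s) ^ a • S (lambdaProj a b (ExteriorAlgebra.ιMulti ℂ n p)) := by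
    funext s
    have h5 : (fun i => p i + s • (((p i).1, 0) : VSpace l × WSpace m)) =
        fun i => diagMap l m (1 + s) 1 (p i) := by
      funext i
      ext <;> simp [add_mul]
    rw [lambdaMultilinear_apply, h5, lambdaProj_diagMap, one_pow, mul_one, map_smul]
    rfl
  have h6 : HasDerivAt (fun s : ℂ => (1 + s) ^ a • S (lambdaProj a b (ExteriorAlgebra.ιMulti ℂ n p)))
      ((a : ℂ) • S (lambdaProj a b (ExteriorAlgebra.ιMulti ℂ n p))) 0 := by
    have := (((hasDerivAt_id (0 : ℂ)).const_add 1).pow a).smul_const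
      (S (lambdaProj a b (ExteriorAlgebra.ιMulti ℂ n p)))
    simpa using this
  have h7 := h3.unique (h4 ▸ h6)
  simpa using h7

/-- Moving the vectors `p i` by a diagonal map and within their span does not change the point
`[(p 0 ∧ p 1 ∧ ⋯)_{a,b}]` to first order. -/
theorem exists_lambdaProj_ιMultiDeriv_eq_smul {p d : Fin n → VSpace l × WSpace m} {c c' : ℂ}
    (h : ∀ i, d i - diagMap l m c c' (p i) ∈ Submodule.span ℂ (range p)) (a b : ℕ) :
    ∃ C : ℂ, lambdaProj a b (ιMultiDeriv p d) =
      C • lambdaProj a b (ExteriorAlgebra.ιMulti ℂ n p) := by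
  -- Subtracting c' times the identity, which preserves the span, leaves only a scaling of V by c -
  -- c'.
  have h1 : ∀ i, d i - (c - c') • (((p i).1, 0) : VSpace l × WSpace m) ∈
      Submodule.span ℂ (range p) := by
    intro i
    have e : d i - (c - c') • (((p i).1, 0) : VSpace l × WSpace m) =
        (d i - diagMap l m c c' (p i)) + c' • p i := by
      ext <;> simp [sub_mul]
      ring
    rw [e]
    exact Submodule.add_mem _ (h i) (Submodule.smul_mem _ _ (Submodule.subset_span ⟨i, rfl⟩))
  obtain ⟨C, hC⟩ := exists_ιMultiDeriv_eq_smul p _ h1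
  refine ⟨C + (c - c') * a, ?_⟩
  have e : d = fun i => (d i - (c - c') • (((p i).1, 0) : VSpace l × WSpace m)) +
      (c - c') • (((p i).1, 0) : VSpace l × WSpace m) := by
    funext i
    rw [sub_add_cancel]
  rw [e, ιMultiDeriv_add, ιMultiDeriv_smul, hC, map_add, map_smul, map_smul,
    lambdaProj_ιMultiDeriv_fst, smul_smul]
  exact (add_smul C _ (lambdaProj a b (ExteriorAlgebra.ιMulti ℂ n p))).symm

end LambdaAnalysis

/-! ### Hermitian forms and projection to the complement of a moving vector. -/

section HermitianForm

/-- A Hermitian form, linear in the first argument and conjugate linear in the second. -/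
structure HermitianForm (F : Type*) [NormedAddCommGroup F] [NormedSpace ℂ F] where
  form : F →L[ℝ] F →L[ℝ] ℂ
  smul_left : ∀ (c : ℂ) (u v : F), form (c • u) v = c * form u v
  conj_symm : ∀ u v : F, form v u = starRingEnd ℂ (form u v)

variable {F : Type*} [NormedAddCommGroup F] [NormedSpace ℂ F]

namespace HermitianForm

theorem smul_right (B : HermitianForm F) (c : ℂ) (u v : F) :
    B.form u (c • v) = starRingEnd ℂ c * B.form u v := by
  rw [B.conj_symm (c • v) u, B.smul_left, map_mul, ← B.conj_symm]

theorem add_left (B : HermitianForm F) (u u' v : F) : B.form (u + u') v = B.form u v + B.form u' v := by simp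

theorem add_right (B : HermitianForm F) (u v v' : F) : B.form u (v + v') = B.form u v + B.form u v' := by simp

theorem sub_left (B : HermitianForm F) (u u' v : F) : B.form (u - u') v = B.form u v - B.form u' v := by simp

theorem sub_right (B : HermitianForm F) (u v v' : F) : B.form u (v - v') = B.form u v - B.form u v' := by simp

theorem self_eq_re (B : HermitianForm F) (u : F) : B.form u u = ((B.form u u).re : ℂ) :=
  (Complex.conj_eq_iff_re.1 (B.conj_symm u u).symm).symm

theorem self_ne_zero_of_re_pos (B : HermitianForm F) {u : F} (h : 0 < (B.form u u).re) : B.form u u ≠ 0 := by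
  intro h0
  rw [h0] at h
  exact lt_irrefl _ h

/-- The orthogonal projection onto the orthogonal complement of `x`. -/
def perp (B : HermitianForm F) (x u : F) : F := u - (B.form u x / B.form x x) • x

theorem perp_form_self (B : HermitianForm F) {x : F} (hx : B.form x x ≠ 0) (u : F) :
    B.form (B.perp x u) x = 0 := by
  rw [perp, B.sub_left, B.smul_left, div_mul_cancel₀ _ hx, sub_self]

/-- The Hermitian form `∂ ∂̄ log (x, x)` on tangent vectors. -/
def logMetric (B : HermitianForm F) (x u v : F) : ℂ :=
  B.form u v / B.form x x - B.form u x * B.form x v / (B.form x x) ^ 2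

/-- In this form the sign of the metric can be read off from the sign of the form on x^⊥. -/
theorem logMetric_eq (B : HermitianForm F) {x : F} (hx : B.form x x ≠ 0) (u v : F) :
    B.logMetric x u v = B.form (B.perp x u) (B.perp x v) / B.form x x := by
  have h : B.form (B.perp x u) (B.perp x v) = B.form u v - B.form u x / B.form x x * B.form x v := by
    conv_lhs => rw [perp.eq_def B x v]
    rw [B.sub_right, B.smul_right, B.perp_form_self hx, mul_zero, sub_zero, perp, B.sub_left,
      B.smul_left]
  rw [h, logMetric]
  field_simp

theorem logMetric_add_left (B : HermitianForm F) (x u u' v : F) :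
    B.logMetric x (u + u') v = B.logMetric x u v + B.logMetric x u' v := by
  simp only [logMetric, B.add_left]
  ring

theorem logMetric_smul_left (B : HermitianForm F) (c : ℂ) (x u v : F) :
    B.logMetric x (c • u) v = c * B.logMetric x u v := by
  simp only [logMetric, B.smul_left]
  ring

theorem logMetric_conj_symm (B : HermitianForm F) (x u v : F) :
    B.logMetric x v u = starRingEnd ℂ (B.logMetric x u v) := by
  simp only [logMetric, map_sub, map_div₀, map_mul, map_pow, ← B.conj_symm]
  ring

theorem _root_.HasFDerivAt.complex_inv {E : Type*} [NormedAddCommGroup E] [NormedSpace ℝ E]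
    {f : E → ℂ} {f' : E →L[ℝ] ℂ} {t : E} (hf : HasFDerivAt f f' t) (h0 : f t ≠ 0) :
    HasFDerivAt (fun s => (f s)⁻¹) (-((f t ^ 2)⁻¹ • f')) t := by
  have h := (hasFDerivAt_inv' (𝕜 := ℝ) h0).comp t hf
  refine h.congr_fderiv ?_
  ext1 τ
  have h1 : -((f t)⁻¹ * f' τ * (f t)⁻¹) = -((f t ^ 2)⁻¹ * f' τ) := by
    field_simp
  exact h1

/-- The derivative of the projection of a vector to the orthogonal complement of a moving vector. -/
theorem hasFDerivAt_perp (B : HermitianForm F) {E : Type*} [NormedAddCommGroup E] [NormedSpace ℝ E]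
    {u x : E → F} {u' x' : E →L[ℝ] F} {t : E} (hu : HasFDerivAt u u' t) (hx : HasFDerivAt x x' t)
    (h0 : B.form (x t) (x t) ≠ 0) :
    ∃ L : E →L[ℝ] F, HasFDerivAt (fun s => B.perp (x s) (u s)) L t ∧ ∀ τ, L τ =
      B.perp (x t) (u' τ) - (B.form (u t) (x t) / B.form (x t) (x t)) • B.perp (x t) (x' τ) -
        (B.form (B.perp (x t) (u t)) (B.perp (x t) (x' τ)) / B.form (x t) (x t)) • x t := by
  have h1 := B.form.hasFDerivAt_of_bilinear hu hx
  have h2 := B.form.hasFDerivAt_of_bilinear hx hx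
  refine ⟨_, hu.fun_sub ((h1.fun_mul (h2.complex_inv h0)).fun_smul hx), fun τ => ?_⟩
  have h : B.form (B.perp (x t) (u t)) (B.perp (x t) (x' τ)) =
      B.form (u t) (x' τ) - B.form (u t) (x t) / B.form (x t) (x t) * B.form (x t) (x' τ) := by
    conv_lhs => rw [perp.eq_def B (x t) (x' τ)]
    rw [B.sub_right, B.smul_right, B.perp_form_self h0, mul_zero, sub_zero, perp, B.sub_left,
      B.smul_left]
  rw [h]
  simp only [perp, smul_sub, smul_smul]
  simp
  match_scalars <;> field_simp; ring

end HermitianForm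

end HermitianForm

/-! ### Wirtinger calculus for Hermitian forms of holomorphic maps. -/

section Wirtinger

variable {E : Type*} [NormedAddCommGroup E] [NormedSpace ℂ E]

/-- The function `f` has holomorphic derivative `P` and antiholomorphic derivative `Q` at `q`. -/
def HasWirtingerAt (f P Q : E → ℂ) (q : E) : Prop :=
  ∃ L : E →L[ℝ] ℂ, HasFDerivAt f L q ∧ ∀ u, L u = P u + Q u ∧
    P (Complex.I • u) = Complex.I * P u ∧ Q (Complex.I • u) = -Complex.I * Q u

variable {f g P Q P' Q' : E → ℂ} {q : E}

theorem HasWirtingerAt.wirtinger_eq (h : HasWirtingerAt f P Q q) (u : E) :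
    wirtinger f q u = P u := by
  obtain ⟨L, h1, h2⟩ := h
  rw [wirtinger, h1.fderiv, (h2 u).1, (h2 (Complex.I • u)).1, (h2 u).2.1, (h2 u).2.2]
  linear_combination (-(1 / 2 : ℂ) * P u + (1 / 2 : ℂ) * Q u) * Complex.I_mul_I

theorem HasWirtingerAt.wirtingerBar_eq (h : HasWirtingerAt f P Q q) (u : E) :
    wirtingerBar f q u = Q u := by
  obtain ⟨L, h1, h2⟩ := h
  rw [wirtingerBar, h1.fderiv, (h2 u).1, (h2 (Complex.I • u)).1, (h2 u).2.1, (h2 u).2.2]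
  linear_combination ((1 / 2 : ℂ) * P u - (1 / 2 : ℂ) * Q u) * Complex.I_mul_I

theorem wirtinger_congr (h : f =ᶠ[nhds q] g) (u : E) : wirtinger f q u = wirtinger g q u := by
  rw [wirtinger, wirtinger, h.fderiv_eq]

theorem HasWirtingerAt.congr (h : HasWirtingerAt f P Q q) (hf : ∀ q, g q = f q)
    (hP : ∀ u, P' u = P u) : HasWirtingerAt g P' Q q := by
  obtain rfl : g = f := funext hf
  obtain rfl : P' = P := funext hP
  exact h

theorem HasWirtingerAt.const (c : ℂ) : HasWirtingerAt (fun _ => c) 0 0 q :=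
  ⟨0, hasFDerivAt_const c q, fun u => by simp⟩

theorem HasWirtingerAt.add (hf : HasWirtingerAt f P Q q) (hg : HasWirtingerAt g P' Q' q) :
    HasWirtingerAt (fun q => f q + g q) (fun u => P u + P' u) (fun u => Q u + Q' u) q := by
  obtain ⟨L, h1, h2⟩ := hf
  obtain ⟨L', h3, h4⟩ := hg
  refine ⟨L + L', h1.add h3, fun u => ⟨?_, ?_, ?_⟩⟩
  · rw [add_apply, (h2 u).1, (h4 u).1]; ring
  · beta_reduce; rw [(h2 u).2.1, (h4 u).2.1]; ring
  · beta_reduce; rw [(h2 u).2.2, (h4 u).2.2]; ring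

theorem HasWirtingerAt.mul (hf : HasWirtingerAt f P Q q) (hg : HasWirtingerAt g P' Q' q) :
    HasWirtingerAt (fun q => f q * g q) (fun u => P u * g q + f q * P' u)
      (fun u => Q u * g q + f q * Q' u) q := by
  obtain ⟨L, h1, h2⟩ := hf
  obtain ⟨L', h3, h4⟩ := hg
  refine ⟨_, h1.mul h3, fun u => ⟨?_, ?_, ?_⟩⟩
  · simp only [add_apply, smul_apply, smul_eq_mul,
      (h2 u).1, (h4 u).1]; ring
  · beta_reduce; rw [(h2 u).2.1, (h4 u).2.1]; ring
  · beta_reduce; rw [(h2 u).2.2, (h4 u).2.2]; ring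

theorem HasWirtingerAt.neg (hf : HasWirtingerAt f P Q q) :
    HasWirtingerAt (fun q => -f q) (fun u => -P u) (fun u => -Q u) q := by
  obtain ⟨L, h1, h2⟩ := hf
  refine ⟨-L, h1.neg, fun u => ⟨?_, ?_, ?_⟩⟩
  · rw [neg_apply, (h2 u).1]; ring
  · beta_reduce; rw [(h2 u).2.1]; ring
  · beta_reduce; rw [(h2 u).2.2]; ring

theorem HasWirtingerAt.inv (hf : HasWirtingerAt f P Q q) (h0 : f q ≠ 0) :
    HasWirtingerAt (fun q => (f q)⁻¹) (fun u => -(P u / f q ^ 2)) (fun u => -(Q u / f q ^ 2)) q := by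
  obtain ⟨L, h1, h2⟩ := hf
  refine ⟨_, h1.complex_inv h0, fun u => ⟨?_, ?_, ?_⟩⟩
  · simp [(h2 u).1]; field_simp; ring
  · beta_reduce; rw [(h2 u).2.1]; ring
  · beta_reduce; rw [(h2 u).2.2]; ring

variable {F : Type*} [NormedAddCommGroup F] [NormedSpace ℂ F] (B : HermitianForm F)
  {x : E → F} {A : E →L[ℂ] F}

theorem hasWirtingerAt_form_left (hx : HasFDerivAt x (A.restrictScalars ℝ) q) (v : F) :
    HasWirtingerAt (fun q => B.form (x q) v) (fun u => B.form (A u) v) 0 q := by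
  have h1 := (B.form.hasFDerivAt_of_bilinear hx (hasFDerivAt_const v q))
  refine ⟨_, h1, fun u => ⟨?_, ?_, ?_⟩⟩
  · simp
  · beta_reduce; rw [map_smul, B.smul_left]
  · simp

theorem hasWirtingerAt_form_right (hx : HasFDerivAt x (A.restrictScalars ℝ) q) (v : F) :
    HasWirtingerAt (fun q => B.form v (x q)) 0 (fun u => B.form v (A u)) q := by
  have h1 := (B.form.hasFDerivAt_of_bilinear (hasFDerivAt_const v q) hx)
  refine ⟨_, h1, fun u => ⟨?_, ?_, ?_⟩⟩
  · simp
  · simp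
  · beta_reduce; rw [map_smul, B.smul_right, Complex.conj_I]

theorem hasWirtingerAt_form_self (hx : HasFDerivAt x (A.restrictScalars ℝ) q) :
    HasWirtingerAt (fun q => B.form (x q) (x q)) (fun u => B.form (A u) (x q)) (fun u => B.form (x q) (A u)) q := by
  have h1 := (B.form.hasFDerivAt_of_bilinear hx hx)
  refine ⟨_, h1, fun u => ⟨?_, ?_, ?_⟩⟩
  · simp [add_comm]
  · beta_reduce; rw [map_smul, B.smul_left]
  · beta_reduce; rw [map_smul, B.smul_right, Complex.conj_I]

theorem hasWirtingerAt_log (hx : HasFDerivAt x (A.restrictScalars ℝ) q)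
    (h0 : 0 < (B.form (x q) (x q)).re) :
    HasWirtingerAt (fun q => ((Real.log (B.form (x q) (x q)).re : ℝ) : ℂ))
      (fun u => B.form (A u) (x q) * (B.form (x q) (x q))⁻¹)
      (fun u => B.form (x q) (A u) * (B.form (x q) (x q))⁻¹) q := by
  obtain ⟨L, h1, h2⟩ := hasWirtingerAt_form_self B hx
  beta_reduce at h2
  have h3 := (Complex.reCLM.hasFDerivAt.comp q h1).log h0.ne'
  have h4 := Complex.ofRealCLM.hasFDerivAt.comp q h3
  refine ⟨_, h4, fun u => ⟨?_, ?_, ?_⟩⟩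
  -- The derivative of (x, x) is a number plus its conjugate, so passing to real parts before the
  -- logarithm loses nothing.
  · have e1 : ((L u).re : ℂ) = L u := by
      rw [(h2 u).1, B.conj_symm (A u) (x q), Complex.add_conj]
      simp
    have e2 := B.self_eq_re (x q)
    have e3 : (Complex.ofRealCLM.comp (((Complex.reCLM ∘ fun q => B.form (x q) (x q)) q)⁻¹ •
        Complex.reCLM.comp L)) u = (((B.form (x q) (x q)).re : ℝ) : ℂ)⁻¹ * ((L u).re : ℂ) := by
      simp
    rw [← add_mul, ← (h2 u).1]
    refine e3.trans ?_
    rw [e1, ← e2, mul_comm]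
  · beta_reduce; rw [(h2 u).2.1]; ring
  · beta_reduce; rw [(h2 u).2.2]; ring

/-- Only the holomorphic derivative enters the Chern connection, so the other part is left
unspecified. The derivative is again a combination of values of the metric, from which the
connection form can be read off. -/
theorem hasWirtingerAt_logMetric (hx : HasFDerivAt x (A.restrictScalars ℝ) q)
    (h0 : B.form (x q) (x q) ≠ 0) (u v : F) :
    ∃ Q, HasWirtingerAt (fun q => B.logMetric (x q) u v)
      (fun ξ => -(B.form (A ξ) (x q) / B.form (x q) (x q) * B.logMetric (x q) u v +
        B.form u (x q) / B.form (x q) (x q) * B.logMetric (x q) (A ξ) v)) Q q := by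
  have hN := (hasWirtingerAt_form_self B hx).inv h0
  have h1 := ((HasWirtingerAt.const (B.form u v)).mul hN).add
    ((((hasWirtingerAt_form_right B hx u).mul (hasWirtingerAt_form_left B hx v)).mul
      (hN.mul hN))).neg
  refine ⟨_, h1.congr (fun q => ?_) fun ξ => ?_⟩
  · simp only [HermitianForm.logMetric]
    ring
  · simp only [HermitianForm.logMetric, Pi.zero_apply]
    field_simp
    ring

theorem hasWirtingerAt_form_div (hx : HasFDerivAt x (A.restrictScalars ℝ) q)
    (h0 : B.form (x q) (x q) ≠ 0) (v : F) :
    ∃ Q, HasWirtingerAt (fun q => B.form (x q) v * (B.form (x q) (x q))⁻¹)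
      (fun ξ => B.logMetric (x q) (A ξ) v) Q q := by
  have hN := (hasWirtingerAt_form_self B hx).inv h0
  have h1 := (hasWirtingerAt_form_left B hx v).mul hN
  refine ⟨_, h1.congr (fun q => rfl) fun ξ => ?_⟩
  simp only [HermitianForm.logMetric]
  field_simp
  ring

end Wirtinger

/-! ### Metric, connection and orthogonal projection from a potential. -/

section KahlerPotential

variable {E F₁ F₂ : Type*} [NormedAddCommGroup E] [NormedSpace ℂ E]
  [NormedAddCommGroup F₁] [NormedSpace ℂ F₁] [NormedAddCommGroup F₂] [NormedSpace ℂ F₂]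
  (B₁ : HermitianForm F₁) (B₂ : HermitianForm F₂) {x : E → F₁} {y : E → F₂}
  {A₁ : E →L[ℂ] F₁} {A₂ : E →L[ℂ] F₂}

/-- The Kähler metric of the potential `- log (x, x) + log (y, y)`. -/
theorem kahlerMetric_log (hx : ∀ q, HasFDerivAt x (A₁.restrictScalars ℝ) q)
    (hy : ∀ q, HasFDerivAt y (A₂.restrictScalars ℝ) q) {q : E}
    (hxq : 0 < (B₁.form (x q) (x q)).re) (hyq : 0 < (B₂.form (y q) (y q)).re) (u v : E) :
    kahlerMetric (fun q => - Real.log (B₁.form (x q) (x q)).re + Real.log (B₂.form (y q) (y q)).re) q u v =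
      - B₁.logMetric (x q) (A₁ u) (A₁ v) + B₂.logMetric (y q) (A₂ u) (A₂ v) := by
  have hc1 : Continuous fun q => (B₁.form (x q) (x q)).re := by
    have : Continuous x := continuous_iff_continuousAt.2 fun q => (hx q).continuousAt
    fun_prop
  have hc2 : Continuous fun q => (B₂.form (y q) (y q)).re := by
    have : Continuous y := continuous_iff_continuousAt.2 fun q => (hy q).continuousAt
    fun_prop
  -- The logarithms are differentiable only where both forms are positive, so ∂̄K is replaced by its
  -- formula on a neighbourhood.
  rw [kahlerMetric, wirtinger_congr (g := fun q => -(B₁.form (x q) (A₁ v) * (B₁.form (x q) (x q))⁻¹) +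
    B₂.form (y q) (A₂ v) * (B₂.form (y q) (y q))⁻¹)]
  · obtain ⟨Q₁, h1⟩ := hasWirtingerAt_form_div B₁ (hx q) (B₁.self_ne_zero_of_re_pos hxq) (A₁ v)
    obtain ⟨Q₂, h2⟩ := hasWirtingerAt_form_div B₂ (hy q) (B₂.self_ne_zero_of_re_pos hyq) (A₂ v)
    exact (h1.neg.add h2).wirtinger_eq u
  · filter_upwards [hc1.continuousAt.eventually_const_lt hxq,
      hc2.continuousAt.eventually_const_lt hyq] with q' h1 h2
    have h3 := ((hasWirtingerAt_log B₁ (hx q') h1).neg.add (hasWirtingerAt_log B₂ (hy q') h2))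
    rw [← h3.wirtingerBar_eq v]
    congr 1
    funext q
    push_cast
    rfl

theorem wirtinger_kahlerMetric_log (hx : ∀ q, HasFDerivAt x (A₁.restrictScalars ℝ) q)
    (hy : ∀ q, HasFDerivAt y (A₂.restrictScalars ℝ) q) {q : E}
    (hxq : 0 < (B₁.form (x q) (x q)).re) (hyq : 0 < (B₂.form (y q) (y q)).re) (ξ u v : E) :
    wirtinger (fun q' => kahlerMetric (fun q => - Real.log (B₁.form (x q) (x q)).re +
      Real.log (B₂.form (y q) (y q)).re) q' u v) q ξ =
      B₁.form (A₁ ξ) (x q) / B₁.form (x q) (x q) * B₁.logMetric (x q) (A₁ u) (A₁ v) +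
        B₁.form (A₁ u) (x q) / B₁.form (x q) (x q) * B₁.logMetric (x q) (A₁ ξ) (A₁ v) -
      (B₂.form (A₂ ξ) (y q) / B₂.form (y q) (y q) * B₂.logMetric (y q) (A₂ u) (A₂ v) +
        B₂.form (A₂ u) (y q) / B₂.form (y q) (y q) * B₂.logMetric (y q) (A₂ ξ) (A₂ v)) := by
  have hc1 : Continuous fun q => (B₁.form (x q) (x q)).re := by
    have : Continuous x := continuous_iff_continuousAt.2 fun q => (hx q).continuousAt
    fun_prop
  have hc2 : Continuous fun q => (B₂.form (y q) (y q)).re := by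
    have : Continuous y := continuous_iff_continuousAt.2 fun q => (hy q).continuousAt
    fun_prop
  rw [wirtinger_congr (g := fun q => - B₁.logMetric (x q) (A₁ u) (A₁ v) +
    B₂.logMetric (y q) (A₂ u) (A₂ v))]
  · obtain ⟨Q₁, h1⟩ := hasWirtingerAt_logMetric B₁ (hx q) (B₁.self_ne_zero_of_re_pos hxq)
      (A₁ u) (A₁ v)
    obtain ⟨Q₂, h2⟩ := hasWirtingerAt_logMetric B₂ (hy q) (B₂.self_ne_zero_of_re_pos hyq)
      (A₂ u) (A₂ v)
    rw [(h1.neg.add h2).wirtinger_eq ξ]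
    ring
  · filter_upwards [hc1.continuousAt.eventually_const_lt hxq,
      hc2.continuousAt.eventually_const_lt hyq] with q' h1 h2
    exact kahlerMetric_log B₁ B₂ hx hy h1 h2 u v

/-- The defining property of the orthogonal projection holds when the metric is anisotropic. -/
theorem kahlerProj_spec [FiniteDimensional ℂ E] (K : E → ℝ) (q : E) (L : Submodule ℂ E)
    (hadd : ∀ u u' v, kahlerMetric K q (u + u') v = kahlerMetric K q u v + kahlerMetric K q u' v)
    (hsmul : ∀ (c : ℂ) (u v), kahlerMetric K q (c • u) v = c * kahlerMetric K q u v)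
    (hconj : ∀ u v, kahlerMetric K q v u = starRingEnd ℂ (kahlerMetric K q u v))
    (haniso : ∀ u, kahlerMetric K q u u = 0 → u = 0) (ξ : E) :
    kahlerProj K q L ξ ∈ L ∧ ∀ v ∈ L, kahlerMetric K q (ξ - kahlerProj K q L ξ) v = 0 := by
  suffices h : ∃ P : E →L[ℂ] E, ∀ ξ, P ξ ∈ L ∧ ∀ v ∈ L, kahlerMetric K q (ξ - P ξ) v = 0 from
    Classical.epsilon_spec h ξ
  let b := Module.finBasis ℂ L
  let r : E →ₗ[ℂ] (Fin (Module.finrank ℂ L) → ℂ) := LinearMap.pi fun i =>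
    { toFun := fun u => kahlerMetric K q u (b i)
      map_add' := fun u u' => hadd u u' _
      map_smul' := fun c u => hsmul c u _ }
  -- Orthogonality to a basis extends to L after exchanging the arguments, because the metric is
  -- linear in the first one.
  have key : ∀ u, r u = 0 → ∀ v ∈ L, kahlerMetric K q u v = 0 := by
    intro u hu v hv
    let s : E →ₗ[ℂ] ℂ :=
      { toFun := fun v => kahlerMetric K q v u
        map_add' := fun v v' => hadd v v' _
        map_smul' := fun c v => hsmul c v _ }
    have hs : s ∘ₗ L.subtype = 0 := by
      apply b.ext
      intro i
      have h1 : kahlerMetric K q u (b i) = 0 := congrFun hu i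
      change kahlerMetric K q (b i) u = 0
      rw [hconj, h1, map_zero]
    have h2 : kahlerMetric K q v u = 0 := LinearMap.congr_fun hs ⟨v, hv⟩
    rw [hconj, h2, map_zero]
  have hinj : Function.Injective (r ∘ₗ L.subtype) := by
    rw [← LinearMap.ker_eq_bot, LinearMap.ker_eq_bot']
    intro p hp
    exact Subtype.ext (haniso p (key p hp p p.2))
  -- Anisotropy makes the Gram map injective on L, hence invertible by dimension; the projection is
  -- its inverse after r.
  let e : L ≃ₗ[ℂ] (Fin (Module.finrank ℂ L) → ℂ) :=
    LinearEquiv.ofInjectiveOfFinrankEq (r ∘ₗ L.subtype) hinj (by simp)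
  refine ⟨LinearMap.toContinuousLinearMap (L.subtype ∘ₗ e.symm.toLinearMap ∘ₗ r), fun ξ =>
    ⟨(e.symm (r ξ)).2, key _ ?_⟩⟩
  have h3 : r (e.symm (r ξ)) = r ξ := e.apply_symm_apply (r ξ)
  rw [map_sub, sub_eq_zero]
  exact h3.symm

/-- The given Γ shows that the chosen form has its defining property; anisotropy of the metric makes
that property determine it. -/
theorem chernForm_eq (K : E → ℝ) (q : E) (Γ : E →L[ℂ] E →L[ℂ] E)
    (hΓ : ∀ ξ u v, kahlerMetric K q (Γ ξ u) v = wirtinger (fun q' => kahlerMetric K q' u v) q ξ)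
    (hadd : ∀ u u' v, kahlerMetric K q (u + u') v = kahlerMetric K q u v + kahlerMetric K q u' v)
    (haniso : ∀ u, kahlerMetric K q u u = 0 → u = 0) : chernForm K q = Γ := by
  have h : ∀ ξ u v, kahlerMetric K q (chernForm K q ξ u) v =
      wirtinger (fun q' => kahlerMetric K q' u v) q ξ :=
    Classical.epsilon_spec (p := fun Γ : E →L[ℂ] E →L[ℂ] E =>
      ∀ ξ u v, kahlerMetric K q (Γ ξ u) v = wirtinger (fun q' => kahlerMetric K q' u v) q ξ) ⟨Γ, hΓ⟩
  ext ξ u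
  rw [← sub_eq_zero]
  apply haniso
  have h1 := hadd (chernForm K q ξ u - Γ ξ u) (Γ ξ u) (chernForm K q ξ u - Γ ξ u)
  rw [sub_add_cancel, h, hΓ] at h1
  simpa using h1

end KahlerPotential

/-! ### The two Hermitian forms and their signs. -/

section Forms

variable {l m : ℕ}

theorem conjV_apply (x v : VSpace l) : conjV x v =
    starRingEnd ℂ (x 0) * v 0 - ∑ i : Fin l, starRingEnd ℂ (x i.succ) * v i.succ := by
  simp [conjV]

theorem conjW_apply (y w : WSpace m) : conjW y w = ∑ j, starRingEnd ℂ (y j) * w j := by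
  simp [conjW]

/-- The indefinite Hermitian form of `V`. -/
def formV (l : ℕ) : HermitianForm (VSpace l) where
  form := LinearMap.toContinuousBilinearMap <| LinearMap.mk₂ ℝ (fun v x => conjV x v)
    (fun _ _ _ => map_add _ _ _) (fun c v x => by simp)
    (fun v x x' => by
      simp only [conjV_apply, Pi.add_apply, map_add, add_mul, Finset.sum_add_distrib]; ring)
    (fun c v x => by
      simp [conjV_apply, mul_sub, Finset.mul_sum, mul_assoc])
  smul_left c u v := by
    change conjV v (c • u) = c * conjV v u
    rw [map_smul, smul_eq_mul]
  conj_symm u v := by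
    change conjV u v = starRingEnd ℂ (conjV v u)
    simp [conjV_apply, mul_comm]

/-- The Hermitian inner product of `W`. -/
def formW (m : ℕ) : HermitianForm (WSpace m) where
  form := LinearMap.toContinuousBilinearMap <| LinearMap.mk₂ ℝ (fun v x => conjW x v)
    (fun _ _ _ => map_add _ _ _) (fun c v x => by simp)
    (fun v x x' => by
      simp only [conjW_apply, Pi.add_apply, map_add, add_mul, Finset.sum_add_distrib])
    (fun c v x => by
      simp [conjW_apply, Finset.mul_sum, mul_assoc])
  smul_left c u v := by
    change conjW v (c • u) = c * conjW v u
    rw [map_smul, smul_eq_mul]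
  conj_symm u v := by
    change conjW u v = starRingEnd ℂ (conjW v u)
    simp [conjW_apply, mul_comm]

@[simp]
theorem formV_apply (v x : VSpace l) : (formV l).form v x = conjV x v := rfl

@[simp]
theorem formW_apply (w y : WSpace m) : (formW m).form w y = conjW y w := rfl

theorem formV_self (v : VSpace l) :
    conjV v v = ((‖v 0‖ ^ 2 - ∑ i : Fin l, ‖v i.succ‖ ^ 2 : ℝ) : ℂ) := by
  simp [conjV_apply, Complex.conj_mul']

theorem formW_self (w : WSpace m) : conjW w w = ((∑ j, ‖w j‖ ^ 2 : ℝ) : ℂ) := by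
  simp [conjW_apply, Complex.conj_mul']

theorem conjW_self_re_nonneg (w : WSpace m) : 0 ≤ (conjW w w).re := by
  rw [formW_self, Complex.ofReal_re]
  positivity

theorem conjW_self_re_pos {w : WSpace m} (hw : w ≠ 0) : 0 < (conjW w w).re := by
  rw [formW_self, Complex.ofReal_re]
  obtain ⟨j, hj⟩ := Function.ne_iff.1 hw
  exact Finset.sum_pos' (fun i _ => by positivity) ⟨j, Finset.mem_univ _, by
    have : 0 < ‖w j‖ := norm_pos_iff.2 hj
    positivity⟩

/-- The form of `V` is negative definite on the orthogonal complement of a positive vector. -/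
theorem conjV_self_re_neg {x v : VSpace l} (hx : 0 < (conjV x x).re) (hv : conjV x v = 0)
    (h0 : v ≠ 0) : (conjV v v).re < 0 := by
  rw [formV_self, Complex.ofReal_re] at hx ⊢
  rw [conjV_apply, sub_eq_zero] at hv
  have h1 : ‖x 0‖ * ‖v 0‖ ≤ ∑ i : Fin l, ‖x i.succ‖ * ‖v i.succ‖ := by
    have := congrArg norm hv
    rw [norm_mul, RCLike.norm_conj] at this
    rw [this]
    refine (norm_sum_le _ _).trans_eq (Finset.sum_congr rfl fun i _ => ?_)
    rw [norm_mul, RCLike.norm_conj]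
  -- Cauchy–Schwarz for the negative coordinates bounds |x₀|²|v₀|², by orthogonality.
  have h2 := Finset.sum_mul_sq_le_sq_mul_sq Finset.univ (fun i : Fin l => ‖x i.succ‖)
    (fun i : Fin l => ‖v i.succ‖)
  set X := ∑ i : Fin l, ‖x i.succ‖ ^ 2
  set Y := ∑ i : Fin l, ‖v i.succ‖ ^ 2
  have hX : 0 ≤ X := Finset.sum_nonneg fun i _ => by positivity
  have hY : 0 ≤ Y := Finset.sum_nonneg fun i _ => by positivity
  have h3 : ‖x 0‖ ^ 2 * ‖v 0‖ ^ 2 ≤ X * Y := by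
    refine le_trans ?_ h2
    rw [← mul_pow]
    exact pow_le_pow_left₀ (by positivity) h1 2
  -- If (v, v) ≥ 0, then (x, x)|v₀|² ≤ 0, so v₀ = 0; then the remaining coordinates vanish as well.
  by_contra hcon
  have hYv : Y ≤ ‖v 0‖ ^ 2 := by linarith
  have h4 : 0 ≤ ‖v 0‖ ^ 2 := by positivity
  have h5 : (‖x 0‖ ^ 2 - X) * ‖v 0‖ ^ 2 ≤ 0 := by nlinarith
  have h6 : ‖v 0‖ ^ 2 = 0 := by
    by_contra h
    have : 0 < ‖v 0‖ ^ 2 := lt_of_le_of_ne h4 (Ne.symm h)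
    nlinarith [mul_pos hx this]
  have h7 : Y = 0 := by linarith
  apply h0
  funext i
  refine Fin.cases ?_ (fun j => ?_) i
  · simpa using h6
  · have := (Finset.sum_eq_zero_iff_of_nonneg (fun i _ => by positivity)).1 h7 j
      (Finset.mem_univ _)
    simpa using this

theorem perpMap_eq (x : VSpace l) (y : WSpace m) (u : VSpace l × WSpace m) :
    perpMap x y u = ((formV l).perp x u.1, (formW m).perp y u.2) := by
  rw [perpMap_apply]
  simp only [HermitianForm.perp, formV_apply, formW_apply, div_eq_inv_mul]

end Forms

/-! ### Affine lifts of points of M, projected tangent vectors, and changes of chart. -/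

section Base

variable {l m k : ℕ}

/-- The affine lift to `V` of a point of `M` in the affine coordinates of the frame at `p`. -/
def liftV (p : BKSpace l m) (q : BKModel l m) : VSpace l := (projFrameAt p.1.1).lift q.1

/-- The affine lift to `W` of a point of `M` in the affine coordinates of the frame at `p`. -/
def liftW (p : BKSpace l m) (q : BKModel l m) : WSpace m := (projFrameAt p.2).lift q.2

/-- The derivative of the affine lift to `V`. -/
def tangentV (p : BKSpace l m) : BKModel l m →L[ℂ] VSpace l :=
  LinearMap.toContinuousLinearMap
    ((projFrameAt p.1.1).tangentLift ∘ₗ LinearMap.fst ℂ _ _)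

/-- The derivative of the affine lift to `W`. -/
def tangentW (p : BKSpace l m) : BKModel l m →L[ℂ] WSpace m :=
  LinearMap.toContinuousLinearMap
    ((projFrameAt p.2).tangentLift ∘ₗ LinearMap.snd ℂ _ _)

theorem ProjFrame.hasFDerivAt_lift {E : Type*} [NormedAddCommGroup E] [NormedSpace ℂ E]
    (T : ProjFrame E) (q : ProjModel E) :
    HasFDerivAt T.lift (LinearMap.toContinuousLinearMap T.tangentLift) q := by
  have h : T.lift = fun q => T.symm (1, 0) + LinearMap.toContinuousLinearMap T.tangentLift q := by
    funext q
    change T.symm (1, q) = T.symm (1, 0) + T.symm (0, q)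
    rw [← map_add]
    simp
  have h1 := (LinearMap.toContinuousLinearMap T.tangentLift).hasFDerivAt.const_add (T.symm (1, 0))
    (x := q)
  rwa [h]

theorem hasFDerivAt_liftV (p : BKSpace l m) (q : BKModel l m) :
    HasFDerivAt (liftV p) (tangentV p) q :=
  ((projFrameAt p.1.1).hasFDerivAt_lift q.1).comp q hasFDerivAt_fst

theorem hasFDerivAt_liftW (p : BKSpace l m) (q : BKModel l m) :
    HasFDerivAt (liftW p) (tangentW p) q :=
  ((projFrameAt p.2).hasFDerivAt_lift q.2).comp q hasFDerivAt_snd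

theorem ProjFrame.lift_chart {E : Type*} [AddCommGroup E] [Module ℂ E] (T : ProjFrame E)
    {p : ℙ ℂ E} (hp : p ∈ T.chart.source) : T.lift (T.chart p) = (T p.rep).1⁻¹ • p.rep := by
  have hp' : (T p.rep).1 ≠ 0 := hp
  apply T.injective
  rw [T.apply_lift, map_smul]
  refine Prod.ext ?_ rfl
  simp [hp']

theorem liftV_extChartAt (p b : BKSpace l m) (hb : b ∈ (extChartAt (bkI l m) p).source) :
    ∃ c : ℂ, c ≠ 0 ∧ liftV p (extChartAt (bkI l m) p b) = c • b.1.1.rep := by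
  have h1 : b.1.1 ∈ (projFrameAt p.1.1).chart.source := by
    rw [extChartAt_source] at hb
    exact hb.1.2
  exact ⟨_, inv_ne_zero h1, (projFrameAt p.1.1).lift_chart h1⟩

theorem liftW_extChartAt (p b : BKSpace l m) (hb : b ∈ (extChartAt (bkI l m) p).source) :
    ∃ c : ℂ, c ≠ 0 ∧ liftW p (extChartAt (bkI l m) p b) = c • b.2.rep := by
  have h1 : b.2 ∈ (projFrameAt p.2).chart.source := by
    rw [extChartAt_source] at hb
    exact hb.2
  exact ⟨_, inv_ne_zero h1, (projFrameAt p.2).lift_chart h1⟩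

theorem conjV_liftV_pos (p b : BKSpace l m) (hb : b ∈ (extChartAt (bkI l m) p).source) :
    0 < (conjV (liftV p (extChartAt (bkI l m) p b)) (liftV p (extChartAt (bkI l m) p b))).re := by
  obtain ⟨c, hc, h⟩ := liftV_extChartAt p b hb
  rw [h, conjV_smul_smul, Complex.re_ofReal_mul]
  exact mul_pos (Complex.normSq_pos.2 hc) b.1.2

theorem conjW_liftW_pos (p : BKSpace l m) (q : BKModel l m) :
    0 < (conjW (liftW p q) (liftW p q)).re :=
  conjW_self_re_pos (ProjFrame.lift_ne_zero _ _)

/-- The projections of a tangent vector of `M` to the orthogonal complements of the lifts. -/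
def perpTangent (p : BKSpace l m) (q : BKModel l m) : BKModel l m →ₗ[ℂ] VSpace l × WSpace m :=
  perpMap (liftV p q) (liftW p q) ∘ₗ (tangentV p).toLinearMap.prod (tangentW p).toLinearMap

theorem perpTangent_apply (p : BKSpace l m) (q u : BKModel l m) :
    perpTangent p q u = ((formV l).perp (liftV p q) (tangentV p u),
      (formW m).perp (liftW p q) (tangentW p u)) :=
  perpMap_eq _ _ _

/-- A lift has first coordinate 1 and a tangent lift has first coordinate 0, so a tangent lift
proportional to the lift is zero. -/
theorem ProjFrame.eq_zero_of_perp_tangentLift {E : Type*} [NormedAddCommGroup E] [NormedSpace ℂ E]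
    (B : HermitianForm E) (T : ProjFrame E) {q u : ProjModel E}
    (h : B.perp (T.lift q) (T.tangentLift u) = 0) : u = 0 := by
  have h1 := congrArg T h
  rw [HermitianForm.perp, map_sub, map_smul, T.apply_lift, map_zero] at h1
  have h2 : T (T.tangentLift u) = (0, u) := T.apply_symm_apply _
  rw [h2] at h1
  have h3 := congrArg Prod.fst h1
  have h4 := congrArg Prod.snd h1
  simp only [Prod.fst_sub, Prod.snd_sub, Prod.smul_fst, Prod.smul_snd, smul_eq_mul, mul_one,
    Prod.fst_zero, Prod.snd_zero, zero_sub, neg_eq_zero] at h3 h4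
  rwa [h3, zero_smul, sub_zero] at h4

theorem perpTangent_injective (p : BKSpace l m) (q : BKModel l m) :
    Function.Injective (perpTangent p q) := by
  rw [injective_iff_map_eq_zero]
  intro u hu
  rw [perpTangent_apply, Prod.mk_eq_zero] at hu
  exact Prod.ext ((projFrameAt p.1.1).eq_zero_of_perp_tangentLift _ hu.1)
    ((projFrameAt p.2).eq_zero_of_perp_tangentLift _ hu.2)

theorem HermitianForm.perp_smul_left {F : Type*} [NormedAddCommGroup F] [NormedSpace ℂ F]
    (B : HermitianForm F) {c : ℂ} (hc : c ≠ 0) (x u : F) : B.perp (c • x) u = B.perp x u := by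
  have hc' : starRingEnd ℂ c ≠ 0 := (map_ne_zero _).2 hc
  rw [perp, perp, B.smul_right, B.smul_right, B.smul_left, smul_smul]
  congr 2
  field_simp

theorem HermitianForm.perp_add {F : Type*} [NormedAddCommGroup F] [NormedSpace ℂ F]
    (B : HermitianForm F) (x u v : F) : B.perp x (u + v) = B.perp x u + B.perp x v := by
  rw [perp, perp, perp, B.add_left, add_div, add_smul]
  abel

theorem HermitianForm.perp_smul {F : Type*} [NormedAddCommGroup F] [NormedSpace ℂ F]
    (B : HermitianForm F) (c : ℂ) (x u : F) : B.perp x (c • u) = c • B.perp x u := by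
  rw [perp, perp, B.smul_left, smul_sub, smul_smul, mul_div_assoc]

theorem HermitianForm.perp_self {F : Type*} [NormedAddCommGroup F] [NormedSpace ℂ F]
    (B : HermitianForm F) {x : F} (hx : B.form x x ≠ 0) : B.perp x x = 0 := by
  rw [perp, div_self hx, one_smul, sub_self]

/-- Two lifts of the same point, to first order. -/
theorem ProjFrame.perp_comp_eq {E' E : Type*} [NormedAddCommGroup E'] [NormedSpace ℂ E']
    [NormedAddCommGroup E] [NormedSpace ℂ E] [FiniteDimensional ℂ E]
    (B : HermitianForm E) (T : ProjFrame E) {x x' : E' → E}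
    {A A' : E' →L[ℂ] E} {q : E'} (hx : HasFDerivAt x A q) (hx' : HasFDerivAt x' A' q)
    (h : ∀ᶠ s in nhds q, ∃ c : ℂ, c ≠ 0 ∧ x' s = c • x s) (hT : ∀ s, (T (x' s)).1 = 1)
    (h0 : B.form (x q) (x q) ≠ 0) :
    ∃ c : ℂ, c ≠ 0 ∧ x' q = c • x q ∧ ∀ u, B.perp (x' q) (A' u) = c • B.perp (x q) (A u) := by
  obtain ⟨c, hc, hcq⟩ := h.self_of_nhds
  -- The normalizing coordinate f gives x = f(x) x', a differentiable scaling factor, although the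
  -- scalars in the hypothesis are only known pointwise. Projecting kills the term in which f is
  -- differentiated.
  let f : E →L[ℂ] ℂ := LinearMap.toContinuousLinearMap (LinearMap.fst ℂ _ _ ∘ₗ T.toLinearMap)
  have h1 : ∀ s, ∀ c : ℂ, c ≠ 0 → x' s = c • x s → f (x s) = c⁻¹ := by
    intro s c hc hs
    have : c * f (x s) = 1 := by rw [← smul_eq_mul, ← map_smul, ← hs]; exact hT s
    exact eq_inv_of_mul_eq_one_right this
  have h2 : (fun s => f (x s) • x' s) =ᶠ[nhds q] x := by
    filter_upwards [h] with s ⟨c, hc, hs⟩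
    rw [h1 s c hc hs, hs, inv_smul_smul₀ hc]
  have h3 := ((f.hasFDerivAt.comp q hx).fun_smul hx').congr_of_eventuallyEq h2.symm
  have h4 := h3.unique hx
  refine ⟨c, hc, hcq, fun u => ?_⟩
  have h5 : A u = c⁻¹ • A' u + f (A u) • x' q := by
    rw [← h4, ← h1 q c hc hcq, h4]
    have := congrArg (fun L : E' →L[ℂ] E => L u) h4
    simpa using this.symm
  rw [h5, hcq, B.perp_add, B.perp_smul, B.perp_smul, B.perp_smul, B.perp_self h0,
    B.perp_smul_left hc]
  simp [hc]

/-- Changing affine charts rescales x and y independently; the derivatives of the scaling functions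
are radial and disappear under projection. This is the source of the GL(1) × GL(1) ambiguity. -/
theorem perpTangent_tangentCoordChange (p b : BKSpace l m)
    (hb : b ∈ (extChartAt (bkI l m) p).source) :
    ∃ c d : ℂ, c ≠ 0 ∧ d ≠ 0 ∧
      (liftV p (extChartAt (bkI l m) p b), liftW p (extChartAt (bkI l m) p b)) =
        diagMap l m c d (liftV b (extChartAt (bkI l m) b b), liftW b (extChartAt (bkI l m) b b)) ∧
      ∀ u, perpTangent p (extChartAt (bkI l m) p b) (tangentCoordChange (bkI l m) b p b u) =
        diagMap l m c d (perpTangent b (extChartAt (bkI l m) b b) u) := by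
  set q := extChartAt (bkI l m) b b with hq
  set τ := extChartAt (bkI l m) p ∘ (extChartAt (bkI l m) b).symm with hτ
  have hτq : τ q = extChartAt (bkI l m) p b := by
    rw [hτ, Function.comp_apply, hq, extChartAt_to_inv]
  have hd : HasFDerivAt τ (tangentCoordChange (bkI l m) b p b) q := by
    have := hasFDerivWithinAt_tangentCoordChange (I := bkI l m) (x := b) (y := p) (z := b)
      ⟨mem_extChartAt_source _, hb⟩
    rwa [ModelWithCorners.range_eq_univ, hasFDerivWithinAt_univ] at this
  have hev : ∀ᶠ s in nhds q, s ∈ (extChartAt (bkI l m) b).target ∧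
      (extChartAt (bkI l m) b).symm s ∈ (extChartAt (bkI l m) p).source := by
    refine Filter.Eventually.and (extChartAt_target_mem_nhds (I := bkI l m) b) ?_
    refine (continuousAt_extChartAt_symm (I := bkI l m) b).eventually_mem ?_
    rw [extChartAt_to_inv]
    exact extChartAt_source_mem_nhds' hb
  have hV := (projFrameAt p.1.1).perp_comp_eq (formV l) (hasFDerivAt_liftV b q)
    ((hasFDerivAt_liftV p (τ q)).comp q hd) (by
      filter_upwards [hev] with s ⟨h1, h2⟩
      obtain ⟨c, hc, h3⟩ := liftV_extChartAt p _ h2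
      obtain ⟨d, hd, h4⟩ := liftV_extChartAt b _ ((extChartAt (bkI l m) b).map_target h1)
      rw [(extChartAt (bkI l m) b).right_inv h1] at h4
      refine ⟨c * d⁻¹, mul_ne_zero hc (inv_ne_zero hd), ?_⟩
      refine h3.trans ?_
      rw [h4, smul_smul, inv_mul_cancel_right₀ hd])
    (fun s => by rw [Function.comp_apply, liftV, ProjFrame.apply_lift])
    ((formV l).self_ne_zero_of_re_pos (conjV_liftV_pos b b (mem_extChartAt_source _)))
  have hW := (projFrameAt p.2).perp_comp_eq (formW m) (hasFDerivAt_liftW b q)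
    ((hasFDerivAt_liftW p (τ q)).comp q hd) (by
      filter_upwards [hev] with s ⟨h1, h2⟩
      obtain ⟨c, hc, h3⟩ := liftW_extChartAt p _ h2
      obtain ⟨d, hd, h4⟩ := liftW_extChartAt b _ ((extChartAt (bkI l m) b).map_target h1)
      rw [(extChartAt (bkI l m) b).right_inv h1] at h4
      refine ⟨c * d⁻¹, mul_ne_zero hc (inv_ne_zero hd), ?_⟩
      refine h3.trans ?_
      rw [h4, smul_smul, inv_mul_cancel_right₀ hd])
    (fun s => by rw [Function.comp_apply, liftW, ProjFrame.apply_lift])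
    ((formW m).self_ne_zero_of_re_pos (conjW_liftW_pos b q))
  obtain ⟨c, hc, h1, h2⟩ := hV
  obtain ⟨d, hd0, h3, h4⟩ := hW
  rw [Function.comp_apply, hτq] at h1 h3
  simp only [Function.comp_apply, hτq] at h2 h4
  refine ⟨c, d, hc, hd0, Prod.ext h1 h3, fun u => ?_⟩
  rw [perpTangent_apply, perpTangent_apply]
  exact Prod.ext (h2 u) (h4 u)

end Base

/-! ### The plane of a twistor point, and the covering by the U_{a,b}. -/

section Frames

variable {l m k : ℕ}

/-- The vectors `(x, y)` and the projections of the tangent vectors `u₁, …, u_k`. -/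
def adaptedFrame (p : BKSpace l m) (q : BKModel l m) (u : Fin k → BKModel l m) :
    Fin (k + 1) → VSpace l × WSpace m :=
  Fin.cons (liftV p q, liftW p q) fun i => perpTangent p q (u i)

theorem span_adaptedFrame (p : BKSpace l m) (q : BKModel l m) (u : Fin k → BKModel l m) :
    Submodule.span ℂ (range (adaptedFrame p q u)) =
      Submodule.span ℂ {(liftV p q, liftW p q)} ⊔
        (Submodule.span ℂ (range u)).map (perpTangent p q) := by
  rw [adaptedFrame, Fin.range_cons, Submodule.span_insert, Submodule.map_span, ← range_comp]
  rfl

theorem conjV_perpTangent (p : BKSpace l m) {q : BKModel l m}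
    (hq : 0 < (conjV (liftV p q) (liftV p q)).re) (u : BKModel l m) :
    conjV (liftV p q) (perpTangent p q u).1 = 0 := by
  rw [perpTangent_apply]
  exact (formV l).perp_form_self ((formV l).self_ne_zero_of_re_pos hq) _

theorem conjW_perpTangent (p : BKSpace l m) (q u : BKModel l m) :
    conjW (liftW p q) (perpTangent p q u).2 = 0 := by
  rw [perpTangent_apply]
  exact (formW m).perp_form_self ((formW m).self_ne_zero_of_re_pos (conjW_liftW_pos p q)) _

/-- The projected vectors are orthogonal to x in the V-component, whereas (x, x) ≠ 0, so (x, y) is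
not in their span. -/
theorem linearIndependent_adaptedFrame (p : BKSpace l m) {q : BKModel l m}
    (hq : 0 < (conjV (liftV p q) (liftV p q)).re) {u : Fin k → BKModel l m}
    (hu : LinearIndependent ℂ u) : LinearIndependent ℂ (adaptedFrame p q u) := by
  rw [adaptedFrame, linearIndependent_finCons]
  refine ⟨hu.map' _ (LinearMap.ker_eq_bot.2 (perpTangent_injective p q)), fun h => ?_⟩
  have h1 : Submodule.span ℂ (range fun i => perpTangent p q (u i)) ≤
      LinearMap.ker (conjV (liftV p q) ∘ₗ LinearMap.fst ℂ _ _) := by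
    rw [Submodule.span_le]
    rintro _ ⟨i, rfl⟩
    exact conjV_perpTangent p hq (u i)
  have h2 : conjV (liftV p q) (liftV p q) = 0 := h1 h
  rw [h2] at hq
  exact lt_irrefl _ hq

/-- The coordinates of the base point of `κ` in the preferred chart. -/
abbrev BKTwistorSpace.coord (κ : BKTwistorSpace l m k) : BKModel l m :=
  extChartAt (bkI l m) κ.base κ.base

theorem BKTwistorSpace.coord_pos (κ : BKTwistorSpace l m k) :
    0 < (conjV (liftV κ.base (BKTwistorSpace.coord κ))
      (liftV κ.base (BKTwistorSpace.coord κ))).re :=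
  conjV_liftV_pos _ _ (mem_extChartAt_source _)

/-- The adapted frame of a point of the twistor space. -/
def BKTwistorSpace.frame (κ : BKTwistorSpace l m k) : Fin (k + 1) → VSpace l × WSpace m :=
  adaptedFrame κ.base (BKTwistorSpace.coord κ)
    fun i => (BKTwistorSpace.fiberBasis κ i : BKModel l m)

/-- The subspace of `V ⊕ W` spanned by the lift of the base point and by `L`. -/
def BKTwistorSpace.plane (κ : BKTwistorSpace l m k) : Submodule ℂ (VSpace l × WSpace m) :=
  Submodule.span ℂ (range (BKTwistorSpace.frame κ))

theorem BKTwistorSpace.phi_eq (κ : BKTwistorSpace l m k) (a b : ℕ) :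
    BKTwistorSpace.phi a b κ =
      lambdaProj a b (ExteriorAlgebra.ιMulti ℂ (k + 1) (BKTwistorSpace.frame κ)) := by
  rw [BKTwistorSpace.phi, BKTwistorSpace.z, phiTotal_ιMulti]
  rfl

theorem BKTwistorSpace.span_fiberBasis (κ : BKTwistorSpace l m k) :
    Submodule.span ℂ (range fun i => (BKTwistorSpace.fiberBasis κ i : BKModel l m)) =
      κ.subspace := by
  have h := congrArg (Submodule.map κ.subspace.subtype) (BKTwistorSpace.fiberBasis κ).span_eq
  rwa [Submodule.map_span, ← range_comp, Submodule.map_top, Submodule.range_subtype] at h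

theorem BKTwistorSpace.linearIndependent_frame (κ : BKTwistorSpace l m k) :
    LinearIndependent ℂ (BKTwistorSpace.frame κ) :=
  linearIndependent_adaptedFrame _ (BKTwistorSpace.coord_pos κ)
    ((BKTwistorSpace.fiberBasis κ).linearIndependent.map' κ.subspace.subtype
      (Submodule.ker_subtype _))

theorem BKTwistorSpace.plane_eq (κ : BKTwistorSpace l m k) :
    BKTwistorSpace.plane κ = Submodule.span ℂ {(liftV κ.base (BKTwistorSpace.coord κ),
      liftW κ.base (BKTwistorSpace.coord κ))} ⊔
      κ.subspace.map (perpTangent κ.base (BKTwistorSpace.coord κ)) := by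
  rw [plane, frame, span_adaptedFrame, span_fiberBasis]

/-- The adapted frames with respect to different affine coordinates. -/
theorem BKTwistorSpace.span_adaptedFrame_eq_map (κ : BKTwistorSpace l m k) (p : BKSpace l m)
    (hp : κ.base ∈ (extChartAt (bkI l m) p).source) {u : Fin k → BKModel l m}
    (hu : Submodule.span ℂ (range u) = κ.coordFiber p) :
    ∃ c d : ℂ, c ≠ 0 ∧ d ≠ 0 ∧
      Submodule.span ℂ (range (adaptedFrame p (extChartAt (bkI l m) p κ.base) u)) =
        (BKTwistorSpace.plane κ).map (diagMap l m c d) := by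
  obtain ⟨c, d, hc, hd, h1, h2⟩ := perpTangent_tangentCoordChange p κ.base hp
  refine ⟨c, d, hc, hd, ?_⟩
  rw [span_adaptedFrame, hu, plane_eq, Submodule.map_sup, Submodule.map_span, image_singleton, h1,
    GrassmannBundle.coordFiber]
  congr 1
  have h3 : perpTangent p (extChartAt (bkI l m) p κ.base) ∘ₗ
      (tangentCoordChange (bkI l m) κ.base p κ.base).toLinearMap =
      diagMap l m c d ∘ₗ perpTangent κ.base (BKTwistorSpace.coord κ) :=
    LinearMap.ext h2
  have h4 := congrArg (Submodule.map · κ.subspace) h3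
  simp only [Submodule.map_comp] at h4
  exact h4

/-- Pairing with y and then with x shows that (x, 0) is not in the plane. As (x, y) is, the plane is
strictly smaller than the product of its projections, whose dimensions therefore add up to at least
k + 2. -/
theorem BKTwistorSpace.exists_mem_twistorU (κ : BKTwistorSpace l m k) :
    ∃ a b : ℕ, a + b = k ∧ κ ∈ twistorU l m k a b := by
  have h := exists_lambdaProj_ne_zero (BKTwistorSpace.linearIndependent_frame κ) (by
    set P := Submodule.span ℂ (range (BKTwistorSpace.frame κ)) with hP
    set x := liftV κ.base (BKTwistorSpace.coord κ) with hx
    set y := liftW κ.base (BKTwistorSpace.coord κ) with hy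
    have hxy : (x, y) ∈ P := Submodule.subset_span ⟨0, rfl⟩
    have hx0 : (x, (0 : WSpace m)) ∉ P := by
      intro h
      rw [hP, ← plane, plane_eq, Submodule.mem_sup] at h
      obtain ⟨_, h1, _, ⟨u, -, rfl⟩, h3⟩ := h
      obtain ⟨c, rfl⟩ := Submodule.mem_span_singleton.1 h1
      have h4 := congrArg (fun z : VSpace l × WSpace m => conjW y z.2) h3
      have h5 := congrArg (fun z : VSpace l × WSpace m => conjV x z.1) h3
      simp only [Prod.snd_add, Prod.smul_snd, map_add, map_smul, Prod.fst_add, Prod.smul_fst,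
        smul_eq_mul, map_zero] at h4 h5
      rw [conjW_perpTangent, add_zero] at h4
      rw [conjV_perpTangent _ (BKTwistorSpace.coord_pos κ), add_zero] at h5
      have hy0 : conjW y y ≠ 0 := (formW m).self_ne_zero_of_re_pos (conjW_liftW_pos _ _)
      have hxx : conjV x x ≠ 0 := (formV l).self_ne_zero_of_re_pos (BKTwistorSpace.coord_pos κ)
      rw [(mul_eq_zero.1 h4).resolve_right hy0, zero_mul] at h5
      exact hxx h5.symm
    have hlt : P < (P.map (LinearMap.fst ℂ _ _)).prod (P.map (LinearMap.snd ℂ _ _)) := by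
      refine lt_of_le_of_ne (fun v hv => ⟨⟨v, hv, rfl⟩, ⟨v, hv, rfl⟩⟩) fun h => hx0 ?_
      rw [h]
      exact ⟨⟨_, hxy, rfl⟩, Submodule.zero_mem _⟩
    have h1 := Submodule.finrank_lt_finrank_of_lt hlt
    have h2 : Module.finrank ℂ P = k + 1 := by
      rw [hP, finrank_span_eq_card (BKTwistorSpace.linearIndependent_frame κ), Fintype.card_fin]
    have h3 : Module.finrank ℂ
        ((P.map (LinearMap.fst ℂ _ _)).prod (P.map (LinearMap.snd ℂ _ _)) : Submodule ℂ _) =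
        Module.finrank ℂ (P.map (LinearMap.fst ℂ (VSpace l) (WSpace m))) +
        Module.finrank ℂ (P.map (LinearMap.snd ℂ (VSpace l) (WSpace m))) := by
      rw [← Module.finrank_prod]
      exact LinearEquiv.finrank_eq
        { toFun := fun v => (⟨v.1.1, v.2.1⟩, ⟨v.1.2, v.2.2⟩)
          invFun := fun v => ⟨(v.1.1, v.2.1), v.1.2, v.2.2⟩
          map_add' := fun _ _ => rfl
          map_smul' := fun _ _ => rfl }
    omega)
  obtain ⟨a, b, hab, h1, h2⟩ := h
  refine ⟨a, b, hab, ?_, ?_⟩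
  · rwa [phi_eq]
  · rwa [phi_eq]

end Frames

/-! ### Recovering a twistor point from its plane, and injectivity of ψ. -/

section Injectivity

variable {l m k : ℕ}

/-- The inequality satisfied by the two Hermitian forms on the plane of `κ`. -/
theorem BKTwistorSpace.conjV_div_le (κ : BKTwistorSpace l m k) {v : VSpace l × WSpace m}
    (hv : v ∈ BKTwistorSpace.plane κ) :
    (conjV v.1 v.1).re / (conjV (BKTwistorSpace.x κ) (BKTwistorSpace.x κ)).re ≤
      (conjW v.2 v.2).re / (conjW (BKTwistorSpace.y κ) (BKTwistorSpace.y κ)).re ∧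
    ((conjV v.1 v.1).re / (conjV (BKTwistorSpace.x κ) (BKTwistorSpace.x κ)).re =
      (conjW v.2 v.2).re / (conjW (BKTwistorSpace.y κ) (BKTwistorSpace.y κ)).re →
      ∃ c : ℂ, v = c • (BKTwistorSpace.x κ, BKTwistorSpace.y κ)) := by
  rw [plane_eq, Submodule.mem_sup] at hv
  obtain ⟨_, h1, _, ⟨u, -, rfl⟩, rfl⟩ := hv
  obtain ⟨c, rfl⟩ := Submodule.mem_span_singleton.1 h1
  have hp1 := conjV_perpTangent κ.base (BKTwistorSpace.coord_pos κ) u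
  have hp2 := conjW_perpTangent κ.base (BKTwistorSpace.coord κ) u
  have hx := BKTwistorSpace.coord_pos κ
  have hy := conjW_liftW_pos κ.base (BKTwistorSpace.coord κ)
  change conjV (x κ) _ = 0 at hp1
  change conjW (y κ) _ = 0 at hp2
  change 0 < (conjV (x κ) (x κ)).re at hx
  change 0 < (conjW (y κ) (y κ)).re at hy
  set r := perpTangent κ.base (BKTwistorSpace.coord κ) u with hr
  change (conjV (c • x κ + r.1) (c • x κ + r.1)).re / _ ≤
    (conjW (c • y κ + r.2) (c • y κ + r.2)).re / _ ∧
    ((conjV (c • x κ + r.1) (c • x κ + r.1)).re / _ =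
    (conjW (c • y κ + r.2) (c • y κ + r.2)).re / _ → _)
  -- With v = c(x, y) + r and r orthogonal, both quotients are |c|² plus a remainder: nonpositive
  -- for V and nonnegative for W. Equality forces both remainders, hence r, to vanish.
  have e1 : (conjV (c • x κ + r.1) (c • x κ + r.1)).re / (conjV (x κ) (x κ)).re =
      Complex.normSq c + (conjV r.1 r.1).re / (conjV (x κ) (x κ)).re := by
    have : conjV (c • x κ + r.1) (c • x κ + r.1) =
        (Complex.normSq c : ℂ) * conjV (x κ) (x κ) + conjV r.1 r.1 := by
      have h3 : conjV r.1 (x κ) = 0 := by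
        rw [← formV_apply, (formV l).conj_symm, formV_apply, hp1, map_zero]
      rw [← formV_apply, (formV l).add_left, (formV l).add_right, (formV l).add_right,
        (formV l).smul_left, (formV l).smul_left, (formV l).smul_right, (formV l).smul_right]
      simp only [formV_apply, hp1, h3, ← Complex.mul_conj]
      ring
    rw [this, Complex.add_re, Complex.re_ofReal_mul]
    field_simp
  have e2 : (conjW (c • y κ + r.2) (c • y κ + r.2)).re / (conjW (y κ) (y κ)).re =
      Complex.normSq c + (conjW r.2 r.2).re / (conjW (y κ) (y κ)).re := by
    have : conjW (c • y κ + r.2) (c • y κ + r.2) =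
        (Complex.normSq c : ℂ) * conjW (y κ) (y κ) + conjW r.2 r.2 := by
      have h3 : conjW r.2 (y κ) = 0 := by
        rw [← formW_apply, (formW m).conj_symm, formW_apply, hp2, map_zero]
      rw [← formW_apply, (formW m).add_left, (formW m).add_right, (formW m).add_right,
        (formW m).smul_left, (formW m).smul_left, (formW m).smul_right, (formW m).smul_right]
      simp only [formW_apply, hp2, h3, ← Complex.mul_conj]
      ring
    rw [this, Complex.add_re, Complex.re_ofReal_mul]
    field_simp
  have n1 : r.1 ≠ 0 → (conjV r.1 r.1).re / (conjV (x κ) (x κ)).re < 0 := fun h =>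
    div_neg_of_neg_of_pos (conjV_self_re_neg hx hp1 h) hx
  have n1' : (conjV r.1 r.1).re / (conjV (x κ) (x κ)).re ≤ 0 := by
    by_cases h : r.1 = 0
    · rw [h]; simp
    · exact (n1 h).le
  have n2 : r.2 ≠ 0 → 0 < (conjW r.2 r.2).re / (conjW (y κ) (y κ)).re := fun h =>
    div_pos (conjW_self_re_pos h) hy
  have n2' : 0 ≤ (conjW r.2 r.2).re / (conjW (y κ) (y κ)).re :=
    div_nonneg (conjW_self_re_nonneg _) hy.le
  rw [e1, e2]
  refine ⟨by linarith, fun h => ⟨c, ?_⟩⟩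
  have h1 : r.1 = 0 := by
    by_contra h0
    linarith [n1 h0]
  have h2 : r.2 = 0 := by
    by_contra h0
    linarith [n2 h0]
  have h0 : r = 0 := Prod.ext h1 h2
  rw [h0, add_zero]
  rfl

/-- A point of the twistor space is determined by its plane up to `GL(1) × GL(1)`. -/
theorem BKTwistorSpace.eq_of_plane_eq_map (κ κ' : BKTwistorSpace l m k) {c d : ℂ} (hc : c ≠ 0)
    (hd : d ≠ 0)
    (h : BKTwistorSpace.plane κ' = (BKTwistorSpace.plane κ).map (diagMap l m c d)) : κ = κ' := by
  have hx := BKTwistorSpace.coord_pos κ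
  have hy := conjW_liftW_pos κ.base (BKTwistorSpace.coord κ)
  have hx' := BKTwistorSpace.coord_pos κ'
  have hy' := conjW_liftW_pos κ'.base (BKTwistorSpace.coord κ')
  change 0 < (conjV (x κ) (x κ)).re at hx
  change 0 < (conjW (y κ) (y κ)).re at hy
  change 0 < (conjV (x κ') (x κ')).re at hx'
  change 0 < (conjW (y κ') (y κ')).re at hy'
  have hc2 := Complex.normSq_pos.2 hc
  have hd2 := Complex.normSq_pos.2 hd
  have conjW_smul : ∀ (a : ℂ) (w : WSpace m),
      conjW (a • w) (a • w) = (Complex.normSq a : ℂ) * conjW w w := by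
    intro a w
    rw [← formW_apply, (formW m).smul_left, (formW m).smul_right, ← Complex.mul_conj, mul_assoc]
    rfl
  have hmem : (x κ, y κ) ∈ plane κ := Submodule.subset_span ⟨0, rfl⟩
  have hmem' : (x κ', y κ') ∈ plane κ' := Submodule.subset_span ⟨0, rfl⟩
  have h1 : diagMap l m c d (x κ, y κ) ∈ plane κ' := h ▸ ⟨_, hmem, rfl⟩
  have h2 : (c⁻¹ • x κ', d⁻¹ • y κ') ∈ plane κ := by
    rw [h] at hmem'
    obtain ⟨v, hv, hv'⟩ := hmem'
    rw [diagMap_apply, Prod.mk.injEq] at hv'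
    rw [← hv'.1, ← hv'.2, inv_smul_smul₀ hc, inv_smul_smul₀ hd]
    exact hv
  obtain ⟨i1, i2⟩ := conjV_div_le κ' h1
  obtain ⟨i3, -⟩ := conjV_div_le κ h2
  simp only [diagMap_apply, conjV_smul_smul, conjW_smul, Complex.re_ofReal_mul, map_inv₀] at i1 i2 i3
  -- The inequality for (c x, d y) in the second plane and the one for (c⁻¹ x', d⁻¹ y') in the first
  -- are opposite. The resulting equality puts (c x, d y) on the line of (x', y'), so the base
  -- points agree.
  have i4 : Complex.normSq c * (conjV (x κ) (x κ)).re / (conjV (x κ') (x κ')).re =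
      Complex.normSq d * (conjW (y κ) (y κ)).re / (conjW (y κ') (y κ')).re := by
    refine le_antisymm i1 ?_
    rw [div_le_div_iff₀ hx hy] at i3
    rw [div_le_div_iff₀ hy' hx']
    have := mul_le_mul_of_nonneg_left i3 (mul_pos hc2 hd2).le
    field_simp at this
    linarith
  obtain ⟨s, hs⟩ := i2 i4
  rw [Prod.smul_mk, Prod.mk.injEq] at hs
  have hbase : κ.base = κ'.base := by
    obtain ⟨e, he, e1⟩ := liftV_extChartAt κ.base κ.base (mem_extChartAt_source _)
    obtain ⟨e', he', e1'⟩ := liftV_extChartAt κ'.base κ'.base (mem_extChartAt_source _)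
    obtain ⟨f, hf, f1⟩ := liftW_extChartAt κ.base κ.base (mem_extChartAt_source _)
    obtain ⟨f', hf', f1'⟩ := liftW_extChartAt κ'.base κ'.base (mem_extChartAt_source _)
    have g1 : c • e • κ.base.1.1.rep = s • e' • κ'.base.1.1.rep := by
      rw [← e1, ← e1']; exact hs.1
    have g2 : d • f • κ.base.2.rep = s • f' • κ'.base.2.rep := by
      rw [← f1, ← f1']; exact hs.2
    have key : ∀ {F : Type} [AddCommGroup F] [Module ℂ F] (p p' : ℙ ℂ F) (c e s e' : ℂ), c ≠ 0 →
        e ≠ 0 → c • e • p.rep = s • e' • p'.rep → p = p' := by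
      intro F _ _ p p' c e s e' hc he h
      rw [← p.mk_rep, ← p'.mk_rep, Projectivization.mk_eq_mk_iff']
      refine ⟨(c * e)⁻¹ * (s * e'), ?_⟩
      rw [mul_smul, mul_smul s, ← h, ← mul_smul c, inv_smul_smul₀ (mul_ne_zero hc he)]
    exact Prod.ext (Subtype.ext (key _ _ c e s e' hc he g1)) (key _ _ d f s f' hd hf g2)
  obtain ⟨b, L, hL⟩ := κ
  obtain ⟨b', L', hL'⟩ := κ'
  obtain rfl : b = b' := hbase
  have hx0 : conjV (x (⟨b, L, hL⟩ : BKTwistorSpace l m k)) (x (⟨b, L, hL⟩ : BKTwistorSpace l m k)) ≠ 0 :=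
    (formV l).self_ne_zero_of_re_pos hx
  have hy0 : conjW (y (⟨b, L, hL⟩ : BKTwistorSpace l m k)) (y (⟨b, L, hL⟩ : BKTwistorSpace l m k)) ≠ 0 :=
    (formW m).self_ne_zero_of_re_pos hy
  -- Over one base point the lifts coincide, so c = s = d, the diagonal map is a scalar and the
  -- planes are equal.
  have hcs : c = s := by
    have := congrArg (conjV (x (⟨b, L, hL⟩ : BKTwistorSpace l m k))) hs.1
    rw [map_smul, map_smul] at this
    exact mul_right_cancel₀ hx0 this
  have hds : d = s := by
    have := congrArg (conjW (y (⟨b, L, hL⟩ : BKTwistorSpace l m k))) hs.2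
    rw [map_smul, map_smul] at this
    exact mul_right_cancel₀ hy0 this
  have hplane : plane (⟨b, L', hL'⟩ : BKTwistorSpace l m k) = plane (⟨b, L, hL⟩ : BKTwistorSpace l m k) := by
    rw [h, hcs, hds, ← hcs]
    have : diagMap l m c c = c • LinearMap.id := by
      ext v <;> simp
    rw [this, Submodule.map_smul _ _ _ hc, Submodule.map_id]
  -- L is recovered from the plane as its part orthogonal to x: a projected tangent vector in the
  -- plane has no (x, y)-component, and the projection is injective.
  have key : ∀ L₁ L₂ : Submodule ℂ (BKModel l m), ∀ (h₁ : Module.finrank ℂ L₁ = k)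
      (h₂ : Module.finrank ℂ L₂ = k),
      plane (⟨b, L₁, h₁⟩ : BKTwistorSpace l m k) = plane (⟨b, L₂, h₂⟩ : BKTwistorSpace l m k) →
      L₁ ≤ L₂ := by
    intro L₁ L₂ h₁ h₂ h12 u hu
    have h3 : perpTangent b (extChartAt (bkI l m) b b) u ∈
        plane (⟨b, L₁, h₁⟩ : BKTwistorSpace l m k) := by
      rw [plane_eq]
      exact Submodule.mem_sup_right ⟨u, hu, rfl⟩
    rw [h12, plane_eq, Submodule.mem_sup] at h3
    obtain ⟨_, h4, _, ⟨u', hu', rfl⟩, h5⟩ := h3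
    obtain ⟨t, rfl⟩ := Submodule.mem_span_singleton.1 h4
    have h6 := congrArg (fun v : VSpace l × WSpace m =>
      conjV (liftV b (extChartAt (bkI l m) b b)) v.1) h5
    simp only [Prod.fst_add, Prod.smul_fst, map_add, map_smul, smul_eq_mul] at h6
    rw [conjV_perpTangent _ hx, conjV_perpTangent _ hx, add_zero] at h6
    rw [(mul_eq_zero.1 h6).resolve_right hx0, zero_smul, zero_add] at h5
    rw [← perpTangent_injective _ _ h5]
    exact hu'
  exact GrassmannBundle.ext_of rfl (le_antisymm (key L L' hL hL' hplane.symm)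
    (key L' L hL' hL hplane))

theorem BKTwistorSpace.mem_plane_iff {a b : ℕ} (hab : a + b = k) {κ : BKTwistorSpace l m k}
    (hκ : κ ∈ twistorU l m k a b) (v : VSpace l × WSpace m) :
    lambdaWedge a b (BKTwistorSpace.phi (a + 1) b κ) (BKTwistorSpace.phi a (b + 1) κ) v = 0 ↔
      v ∈ BKTwistorSpace.plane κ := by
  obtain ⟨h1, h2⟩ := hκ
  rw [phi_eq] at h1 h2
  rw [phi_eq, phi_eq]
  exact lambdaWedge_eq_zero_iff (by omega) (linearIndependent_frame κ) h1 h2 v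

/-- Factors c and d on the two components transform the plane by diag(d⁻¹, c⁻¹), so
`eq_of_plane_eq_map` applies. -/
theorem BKTwistorSpace.eq_of_phi_eq_smul {a b : ℕ} (hab : a + b = k) {κ κ' : BKTwistorSpace l m k}
    (hκ : κ ∈ twistorU l m k a b) (hκ' : κ' ∈ twistorU l m k a b) {c d : ℂ}
    (hc : BKTwistorSpace.phi (a + 1) b κ' = c • BKTwistorSpace.phi (a + 1) b κ)
    (hd : BKTwistorSpace.phi a (b + 1) κ' = d • BKTwistorSpace.phi a (b + 1) κ) : κ = κ' := by
  have hc0 : c ≠ 0 := by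
    rintro rfl
    exact hκ'.1 (by rw [hc, zero_smul])
  have hd0 : d ≠ 0 := by
    rintro rfl
    exact hκ'.2 (by rw [hd, zero_smul])
  refine eq_of_plane_eq_map κ κ' (inv_ne_zero hd0) (inv_ne_zero hc0) ?_
  ext v
  rw [← mem_plane_iff hab hκ', hc, hd, lambdaWedge_smul_smul, mem_plane_iff hab hκ]
  constructor
  · intro h
    exact ⟨_, h, by ext <;> simp [hc0, hd0]⟩
  · rintro ⟨w, hw, rfl⟩
    have : diagMap l m d c (diagMap l m d⁻¹ c⁻¹ w) = w := by
      ext <;> simp [hc0, hd0]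
    rwa [this]

theorem injective_twistorPsi (a b : ℕ) (hab : a + b = k) :
    Function.Injective (twistorPsi l m k a b) := by
  intro κ κ' h
  rw [twistorPsi, twistorPsi, Prod.mk.injEq, Projectivization.mk_eq_mk_iff',
    Projectivization.mk_eq_mk_iff'] at h
  obtain ⟨⟨c, hc⟩, d, hd⟩ := h
  exact (Subtype.ext (BKTwistorSpace.eq_of_phi_eq_smul hab κ'.2 κ.2 hc.symm hd.symm)).symm

end Injectivity

/-! ### The Kähler metric of M and its connection form in affine coordinates. -/

section Metric

variable {l m : ℕ} {p : BKSpace l m} {q : BKModel l m}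

theorem kahlerMetric_bkPotential (hq : 0 < (conjV (liftV p q) (liftV p q)).re) (u v : BKModel l m) :
    kahlerMetric (bkPotential p) q u v =
      - (formV l).logMetric (liftV p q) (tangentV p u) (tangentV p v) +
        (formW m).logMetric (liftW p q) (tangentW p u) (tangentW p v) :=
  kahlerMetric_log (formV l) (formW m) (fun q => (hasFDerivAt_liftV p q).restrictScalars ℝ)
    (fun q => (hasFDerivAt_liftW p q).restrictScalars ℝ) hq (conjW_liftW_pos p q) u v

theorem kahlerMetric_add_left (hq : 0 < (conjV (liftV p q) (liftV p q)).re) (u u' v : BKModel l m) :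
    kahlerMetric (bkPotential p) q (u + u') v =
      kahlerMetric (bkPotential p) q u v + kahlerMetric (bkPotential p) q u' v := by
  simp only [kahlerMetric_bkPotential hq, map_add, HermitianForm.logMetric_add_left]
  ring

theorem kahlerMetric_smul_left (hq : 0 < (conjV (liftV p q) (liftV p q)).re) (c : ℂ)
    (u v : BKModel l m) :
    kahlerMetric (bkPotential p) q (c • u) v = c * kahlerMetric (bkPotential p) q u v := by
  simp only [kahlerMetric_bkPotential hq, map_smul, HermitianForm.logMetric_smul_left]
  ring

theorem kahlerMetric_conj_symm (hq : 0 < (conjV (liftV p q) (liftV p q)).re) (u v : BKModel l m) :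
    kahlerMetric (bkPotential p) q v u = starRingEnd ℂ (kahlerMetric (bkPotential p) q u v) := by
  simp only [kahlerMetric_bkPotential hq, map_add, map_neg, ← HermitianForm.logMetric_conj_symm]

/-- Each factor contributes a nonnegative term: the minus sign of the hyperbolic potential
compensates the negative form on x^⊥. One of the terms is positive, since the projection of u is
nonzero. -/
theorem kahlerMetric_pos (hq : 0 < (conjV (liftV p q) (liftV p q)).re) {u : BKModel l m}
    (hu : u ≠ 0) : 0 < (kahlerMetric (bkPotential p) q u u).re := by
  have hx := (formV l).self_ne_zero_of_re_pos hq
  have hw := conjW_liftW_pos p q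
  have hy := (formW m).self_ne_zero_of_re_pos hw
  have hu' : perpTangent p q u ≠ 0 := fun h => hu (perpTangent_injective p q (h.trans (map_zero _).symm))
  have h1 := conjV_perpTangent p hq u
  rw [kahlerMetric_bkPotential hq, (formV l).logMetric_eq hx, (formW m).logMetric_eq hy]
  have e1 : (formV l).perp (liftV p q) (tangentV p u) = (perpTangent p q u).1 := by
    rw [perpTangent_apply]
  have e2 : (formW m).perp (liftW p q) (tangentW p u) = (perpTangent p q u).2 := by
    rw [perpTangent_apply]
  rw [e1, e2, (formV l).self_eq_re (liftV p q),
    (formW m).self_eq_re (liftW p q)]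
  simp only [formV_apply, formW_apply, Complex.add_re, Complex.neg_re, Complex.div_ofReal_re]
  have n1 : (perpTangent p q u).1 ≠ 0 → (conjV (perpTangent p q u).1 (perpTangent p q u).1).re /
      (conjV (liftV p q) (liftV p q)).re < 0 := fun h =>
    div_neg_of_neg_of_pos (conjV_self_re_neg hq h1 h) hq
  have n1' : (conjV (perpTangent p q u).1 (perpTangent p q u).1).re /
      (conjV (liftV p q) (liftV p q)).re ≤ 0 := by
    by_cases h : (perpTangent p q u).1 = 0
    · rw [h]; simp
    · exact (n1 h).le
  have n2 : (perpTangent p q u).2 ≠ 0 → 0 < (conjW (perpTangent p q u).2 (perpTangent p q u).2).re /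
      (conjW (liftW p q) (liftW p q)).re := fun h =>
    div_pos (conjW_self_re_pos h) hw
  have n2' : 0 ≤ (conjW (perpTangent p q u).2 (perpTangent p q u).2).re /
      (conjW (liftW p q) (liftW p q)).re :=
    div_nonneg (conjW_self_re_nonneg _) hw.le
  by_cases h : (perpTangent p q u).1 = 0
  · have h2 : (perpTangent p q u).2 ≠ 0 := fun h2 => hu' (Prod.ext h h2)
    linarith [n2 h2]
  · linarith [n1 h]

theorem kahlerMetric_anisotropic (hq : 0 < (conjV (liftV p q) (liftV p q)).re) (u : BKModel l m)
    (h : kahlerMetric (bkPotential p) q u u = 0) : u = 0 := by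
  by_contra hu
  have := kahlerMetric_pos hq hu
  rw [h] at this
  exact lt_irrefl _ this

theorem kahlerProj_bkPotential_spec (hq : 0 < (conjV (liftV p q) (liftV p q)).re)
    (L : Submodule ℂ (BKModel l m)) (ξ : BKModel l m) :
    kahlerProj (bkPotential p) q L ξ ∈ L ∧
      ∀ v ∈ L, kahlerMetric (bkPotential p) q (ξ - kahlerProj (bkPotential p) q L ξ) v = 0 :=
  kahlerProj_spec _ _ _ (kahlerMetric_add_left hq) (kahlerMetric_smul_left hq)
    (kahlerMetric_conj_symm hq) (kahlerMetric_anisotropic hq) ξ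

/-- `ξ ↦ (ξ, x) / (x, x)`. -/
def radialV (p : BKSpace l m) (q : BKModel l m) : BKModel l m →ₗ[ℂ] ℂ :=
  (conjV (liftV p q) (liftV p q))⁻¹ • (conjV (liftV p q) ∘ₗ (tangentV p).toLinearMap)

/-- `ξ ↦ (ξ, y) / (y, y)`. -/
def radialW (p : BKSpace l m) (q : BKModel l m) : BKModel l m →ₗ[ℂ] ℂ :=
  (conjW (liftW p q) (liftW p q))⁻¹ • (conjW (liftW p q) ∘ₗ (tangentW p).toLinearMap)

theorem radialV_apply (p : BKSpace l m) (q ξ : BKModel l m) :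
    radialV p q ξ = (formV l).form (tangentV p ξ) (liftV p q) /
      (formV l).form (liftV p q) (liftV p q) :=
  (div_eq_inv_mul _ _).symm

theorem radialW_apply (p : BKSpace l m) (q ξ : BKModel l m) :
    radialW p q ξ = (formW m).form (tangentW p ξ) (liftW p q) /
      (formW m).form (liftW p q) (liftW p q) :=
  (div_eq_inv_mul _ _).symm

/-- The connection form of the Kähler metric of `M` in affine coordinates. -/
def affineChern (p : BKSpace l m) (q : BKModel l m) :
    BKModel l m →L[ℂ] BKModel l m →L[ℂ] BKModel l m :=
  LinearMap.toContinuousBilinearMap <| LinearMap.mk₂ ℂ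
    (fun ξ u => (-(radialV p q ξ • u.1 + radialV p q u • ξ.1),
      -(radialW p q ξ • u.2 + radialW p q u • ξ.2)))
    (fun ξ ξ' u => by ext <;> simp [add_mul] <;> ring)
    (fun c ξ u => by ext <;> simp <;> ring)
    (fun ξ u u' => by ext <;> simp [add_mul] <;> ring)
    (fun c ξ u => by ext <;> simp <;> ring)

theorem tangentV_affineChern (p : BKSpace l m) (q ξ u : BKModel l m) :
    tangentV p (affineChern p q ξ u) =
      -(radialV p q ξ • tangentV p u + radialV p q u • tangentV p ξ) := by
  change (projFrameAt p.1.1).tangentLift (-(radialV p q ξ • u.1 + radialV p q u • ξ.1)) = _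
  rw [map_neg, map_add, map_smul, map_smul]
  rfl

theorem tangentW_affineChern (p : BKSpace l m) (q ξ u : BKModel l m) :
    tangentW p (affineChern p q ξ u) =
      -(radialW p q ξ • tangentW p u + radialW p q u • tangentW p ξ) := by
  change (projFrameAt p.2).tangentLift (-(radialW p q ξ • u.2 + radialW p q u • ξ.2)) = _
  rw [map_neg, map_add, map_smul, map_smul]
  rfl

theorem HermitianForm.logMetric_neg_left {F : Type*} [NormedAddCommGroup F] [NormedSpace ℂ F]
    (B : HermitianForm F) (x u v : F) : B.logMetric x (-u) v = - B.logMetric x u v := by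
  rw [← neg_one_smul ℂ, B.logMetric_smul_left, neg_one_mul]

theorem chernForm_bkPotential (hq : 0 < (conjV (liftV p q) (liftV p q)).re) :
    chernForm (bkPotential p) q = affineChern p q := by
  refine chernForm_eq _ _ _ (fun ξ u v => ?_) (kahlerMetric_add_left hq) (kahlerMetric_anisotropic hq)
  have h := wirtinger_kahlerMetric_log (formV l) (formW m)
    (fun q => (hasFDerivAt_liftV p q).restrictScalars ℝ)
    (fun q => (hasFDerivAt_liftW p q).restrictScalars ℝ) hq (conjW_liftW_pos p q) ξ u v
  refine Eq.trans ?_ h.symm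
  rw [kahlerMetric_bkPotential hq, tangentV_affineChern, tangentW_affineChern]
  simp only [HermitianForm.logMetric_neg_left, HermitianForm.logMetric_add_left,
    HermitianForm.logMetric_smul_left, radialV_apply, radialW_apply]
  ring

end Metric

/-! ### The adapted frame in a standard chart and its derivative. -/

section LocalFrame

variable {l m k : ℕ}

/-- The adapted frame in the coordinates `(q, Z)` of the standard chart given by `p` and `T`. -/
def localFrame (p : BKSpace l m) (T : GrFrame (BKModel l m) k) (t : TwistorModel l m k) :
    Fin (k + 1) → VSpace l × WSpace m :=
  adaptedFrame p t.1 fun i => T.incl t.2 (Pi.single i 1)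

theorem span_incl_single {E : Type*} [NormedAddCommGroup E] [NormedSpace ℂ E]
    (T : GrFrame E k) (Z : GrSub k →L[ℂ] GrQuot E k) :
    Submodule.span ℂ (range fun i : Fin k => T.incl Z (Pi.single i 1)) = T.graph Z := by
  have h := congrArg (Submodule.map (T.incl Z).toLinearMap) (Pi.basisFun ℂ (Fin k)).span_eq
  rw [Submodule.map_span, ← range_comp, Submodule.map_top] at h
  rw [GrFrame.graph, ← h]
  congr 2
  funext i
  simp

theorem linearIndependent_incl_single {E : Type*} [NormedAddCommGroup E] [NormedSpace ℂ E]
    (T : GrFrame E k) (Z : GrSub k →L[ℂ] GrQuot E k) :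
    LinearIndependent ℂ fun i : Fin k => T.incl Z (Pi.single i 1) := by
  have h := (Pi.basisFun ℂ (Fin k)).linearIndependent.map' (T.incl Z).toLinearMap
    (LinearMap.ker_eq_bot.2 (T.incl_injective Z))
  have h1 : (fun i : Fin k => T.incl Z (Pi.single i 1)) =
      (T.incl Z).toLinearMap ∘ Pi.basisFun ℂ (Fin k) := by
    funext i
    simp
  rwa [h1]

theorem linearIndependent_localFrame (p : BKSpace l m) (T : GrFrame (BKModel l m) k)
    {t : TwistorModel l m k} (ht : 0 < (conjV (liftV p t.1) (liftV p t.1)).re) :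
    LinearIndependent ℂ (localFrame p T t) :=
  linearIndependent_adaptedFrame p ht (linearIndependent_incl_single T t.2)

/-- The local adapted frame spans the plane of `κ` up to `GL(1) × GL(1)`. -/
theorem span_localFrame (κ : BKTwistorSpace l m k) (p : BKSpace l m) (T : GrFrame (BKModel l m) k)
    (hp : κ.base ∈ (extChartAt (bkI l m) p).source) {Z : GrSub k →L[ℂ] GrQuot (BKModel l m) k}
    (hZ : κ.coordFiber p = T.graph Z) :
    ∃ c d : ℂ, c ≠ 0 ∧ d ≠ 0 ∧
      Submodule.span ℂ (range (localFrame p T (extChartAt (bkI l m) p κ.base, Z))) =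
        (BKTwistorSpace.plane κ).map (diagMap l m c d) :=
  BKTwistorSpace.span_adaptedFrame_eq_map κ p hp ((span_incl_single T Z).trans hZ.symm)

/-- `φ_{a,b}` in the coordinates of a standard chart. -/
def localPhi (a b : ℕ) (p : BKSpace l m) (T : GrFrame (BKModel l m) k) (t : TwistorModel l m k) :
    LambdaVW l m a b :=
  lambdaProj a b (ExteriorAlgebra.ιMulti ℂ (k + 1) (localFrame p T t))

theorem exists_localPhi_eq_smul (κ : BKTwistorSpace l m k) (p : BKSpace l m)
    (T : GrFrame (BKModel l m) k) (hκ : κ.base ∈ (extChartAt (bkI l m) p).source ∧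
      ∃ Z, κ.coordFiber p = T.graph Z) (a b : ℕ) :
    ∃ C : ℂ, C ≠ 0 ∧ localPhi a b p T (extChartAt (bkI l m) p κ.base, κ.slope p T) =
      C • BKTwistorSpace.phi a b κ := by
  obtain ⟨hp, Z, hZ⟩ := hκ
  rw [GrassmannBundle.slope_eq hZ, BKTwistorSpace.phi_eq]
  obtain ⟨c, d, hc, hd, h⟩ := span_localFrame κ p T hp hZ
  exact exists_lambdaProj_eq_smul (BKTwistorSpace.linearIndependent_frame κ) hc hd h a b

/-- The derivative of the embedding of `ℂ^k` as a graph. -/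
def inclSlope {E : Type*} [NormedAddCommGroup E] [NormedSpace ℂ E]
    (T : GrFrame E k) (i : Fin k) : (GrSub k →L[ℂ] GrQuot E k) →L[ℂ] E :=
  T.symm.toContinuousLinearMap ∘L ContinuousLinearMap.inr ℂ _ _ ∘L
    ContinuousLinearMap.apply ℂ _ (Pi.single i 1)

theorem incl_single_eq {E : Type*} [NormedAddCommGroup E] [NormedSpace ℂ E]
    (T : GrFrame E k) (Z : GrSub k →L[ℂ] GrQuot E k) (i : Fin k) :
    T.incl Z (Pi.single i 1) = T.symm (Pi.single i 1, 0) + inclSlope T i Z := by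
  change T.symm (Pi.single i 1, Z (Pi.single i 1)) = _ + T.symm (0, Z (Pi.single i 1))
  rw [← map_add]
  simp

theorem HermitianForm.contDiffAt_perp {F E : Type*} [NormedAddCommGroup F] [NormedSpace ℂ F]
    [NormedAddCommGroup E] [NormedSpace ℝ E] (B : HermitianForm F) {u x : E → F} {t : E} {n : ℕ∞ω}
    (hu : ContDiffAt ℝ n u t) (hx : ContDiffAt ℝ n x t) (h0 : B.form (x t) (x t) ≠ 0) :
    ContDiffAt ℝ n (fun s => B.perp (x s) (u s)) t := by
  have h1 : ContDiffAt ℝ n (fun s => B.form (u s) (x s)) t :=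
    (B.form.isBoundedBilinearMap.contDiff (n := n)).contDiffAt.comp t (hu.prodMk hx)
  have h2 : ContDiffAt ℝ n (fun s => B.form (x s) (x s)) t :=
    (B.form.isBoundedBilinearMap.contDiff (n := n)).contDiffAt.comp t (hx.prodMk hx)
  exact hu.sub ((h1.mul (h2.inv h0)).smul hx)

theorem ProjFrame.contDiff_lift' {E : Type*} [NormedAddCommGroup E] [NormedSpace ℂ E]
    (T : ProjFrame E) (n : ℕ∞ω) : ContDiff ℂ n T.lift := by
  have h : T.lift = fun q => T.symm (1, 0) + LinearMap.toContinuousLinearMap T.tangentLift q := by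
    funext q
    change T.symm (1, q) = T.symm (1, 0) + T.symm (0, q)
    rw [← map_add]
    simp
  rw [h]
  exact contDiff_const.add (ContinuousLinearMap.contDiff _)

theorem contDiff_liftV (p : BKSpace l m) (n : ℕ∞ω) : ContDiff ℂ n (liftV p) :=
  ((projFrameAt p.1.1).contDiff_lift' n).comp contDiff_fst

theorem contDiff_liftW (p : BKSpace l m) (n : ℕ∞ω) : ContDiff ℂ n (liftW p) :=
  ((projFrameAt p.2).contDiff_lift' n).comp contDiff_snd

theorem contDiffAt_localFrame (p : BKSpace l m) (T : GrFrame (BKModel l m) k)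
    {t : TwistorModel l m k} (ht : 0 < (conjV (liftV p t.1) (liftV p t.1)).re) (n : ℕ∞ω) :
    ContDiffAt ℝ n (localFrame p T) t := by
  have hV : ContDiff ℝ n fun t : TwistorModel l m k => liftV p t.1 :=
    ((contDiff_liftV p n).restrict_scalars ℝ).comp contDiff_fst
  have hW : ContDiff ℝ n fun t : TwistorModel l m k => liftW p t.1 :=
    ((contDiff_liftW p n).restrict_scalars ℝ).comp contDiff_fst
  have hu : ∀ i : Fin k, ContDiff ℝ n fun t : TwistorModel l m k => T.incl t.2 (Pi.single i 1) := by
    intro i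
    simp only [incl_single_eq]
    exact contDiff_const.add (((inclSlope T i).restrictScalars ℝ).contDiff.comp contDiff_snd)
  rw [contDiffAt_pi]
  intro j
  refine Fin.cases ?_ (fun i => ?_) j
  · exact (hV.prodMk hW).contDiffAt
  · change ContDiffAt ℝ n (fun t : TwistorModel l m k =>
      perpTangent p t.1 (T.incl t.2 (Pi.single i 1))) t
    simp only [perpTangent_apply]
    refine ContDiffAt.prodMk ?_ ?_
    · exact (formV l).contDiffAt_perp
        (((tangentV p).restrictScalars ℝ).contDiff.comp (hu i)).contDiffAt hV.contDiffAt
        ((formV l).self_ne_zero_of_re_pos ht)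
    · exact (formW m).contDiffAt_perp
        (((tangentW p).restrictScalars ℝ).contDiff.comp (hu i)).contDiffAt hW.contDiffAt
        ((formW m).self_ne_zero_of_re_pos (conjW_liftW_pos _ _))

theorem differentiableAt_localFrame (p : BKSpace l m) (T : GrFrame (BKModel l m) k)
    {t : TwistorModel l m k} (ht : 0 < (conjV (liftV p t.1) (liftV p t.1)).re) :
    DifferentiableAt ℝ (localFrame p T) t :=
  (contDiffAt_localFrame p T ht 1).differentiableAt one_ne_zero

/-- The lifts move by the lifted tangent vector, which is split into its radial part, an
infinitesimal diagonal motion, and its projection. -/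
theorem fderiv_localFrame_zero (p : BKSpace l m) (T : GrFrame (BKModel l m) k)
    {t : TwistorModel l m k} (ht : 0 < (conjV (liftV p t.1) (liftV p t.1)).re)
    (τ : TwistorModel l m k) :
    fderiv ℝ (localFrame p T) t τ 0 =
      diagMap l m (radialV p t.1 τ.1) (radialW p t.1 τ.1) (localFrame p T t 0) +
        perpTangent p t.1 τ.1 := by
  have h := hasFDerivAt_pi'.1 (differentiableAt_localFrame p T ht).hasFDerivAt 0
  have hV : HasFDerivAt (fun t : TwistorModel l m k => liftV p t.1) _ t :=
    ((hasFDerivAt_liftV p t.1).restrictScalars ℝ).comp t hasFDerivAt_fst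
  have hW : HasFDerivAt (fun t : TwistorModel l m k => liftW p t.1) _ t :=
    ((hasFDerivAt_liftW p t.1).restrictScalars ℝ).comp t hasFDerivAt_fst
  have h1 := congrArg (fun L : TwistorModel l m k →L[ℝ] VSpace l × WSpace m => L τ)
    (h.unique (hV.prodMk hW))
  refine Eq.trans h1 ?_
  change (tangentV p τ.1, tangentW p τ.1) =
    (radialV p t.1 τ.1 • liftV p t.1, radialW p t.1 τ.1 • liftW p t.1) + perpTangent p t.1 τ.1
  rw [perpTangent_apply, HermitianForm.perp, HermitianForm.perp, ← radialV_apply, ← radialW_apply]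
  simp

/-- Here w is the derivative of u corrected by the connection terms of the log metric. They absorb
the tangential terms of `hasFDerivAt_perp` up to a scaling of the projected vector; the only other
term is radial, with the metric as its coefficient. -/
theorem HermitianForm.hasFDerivAt_perp_connection {F E : Type*} [NormedAddCommGroup F]
    [NormedSpace ℂ F] [NormedAddCommGroup E] [NormedSpace ℝ E] (B : HermitianForm F) {u x : E → F}
    {u' x' : E →L[ℝ] F} {t : E} (hu : HasFDerivAt u u' t) (hx : HasFDerivAt x x' t)
    (h0 : B.form (x t) (x t) ≠ 0) :
    ∃ L : E →L[ℝ] F, HasFDerivAt (fun s => B.perp (x s) (u s)) L t ∧ ∀ τ w,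
      w = u' τ + -((B.form (x' τ) (x t) / B.form (x t) (x t)) • u t +
        (B.form (u t) (x t) / B.form (x t) (x t)) • x' τ) →
      L τ = (B.form (x' τ) (x t) / B.form (x t) (x t)) • B.perp (x t) (u t) + B.perp (x t) w -
        B.logMetric (x t) (u t) (x' τ) • x t := by
  obtain ⟨L, h1, h2⟩ := B.hasFDerivAt_perp hu hx h0
  refine ⟨L, h1, fun τ w hw => ?_⟩
  rw [h2, hw, B.logMetric_eq h0, ← neg_one_smul ℂ (_ + _)]
  simp only [B.perp_add, B.perp_smul]
  module

theorem exists_hasFDerivAt_perp_tangentV (p : BKSpace l m) {t : TwistorModel l m k}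
    (ht : 0 < (conjV (liftV p t.1) (liftV p t.1)).re) {u : TwistorModel l m k → BKModel l m}
    {u' : TwistorModel l m k →L[ℝ] BKModel l m} (hu : HasFDerivAt u u' t) :
    ∃ L : TwistorModel l m k →L[ℝ] VSpace l,
      HasFDerivAt (fun t => (formV l).perp (liftV p t.1) (tangentV p (u t))) L t ∧ ∀ τ, L τ =
        radialV p t.1 τ.1 • (formV l).perp (liftV p t.1) (tangentV p (u t)) +
        (formV l).perp (liftV p t.1) (tangentV p (u' τ + affineChern p t.1 τ.1 (u t))) -
        (formV l).logMetric (liftV p t.1) (tangentV p (u t)) (tangentV p τ.1) • liftV p t.1 := by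
  have hV : HasFDerivAt (fun t : TwistorModel l m k => liftV p t.1)
      ((tangentV p).restrictScalars ℝ ∘L ContinuousLinearMap.fst ℝ _ _) t :=
    ((hasFDerivAt_liftV p t.1).restrictScalars ℝ).comp t hasFDerivAt_fst
  obtain ⟨L, h1, h2⟩ := (formV l).hasFDerivAt_perp_connection
    (((tangentV p).restrictScalars ℝ).hasFDerivAt.comp t hu) hV
    ((formV l).self_ne_zero_of_re_pos ht)
  refine ⟨L, h1, fun τ => ?_⟩
  rw [radialV_apply]
  refine h2 τ _ ?_
  rw [map_add, tangentV_affineChern, radialV_apply, radialV_apply]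
  rfl

theorem exists_hasFDerivAt_perp_tangentW (p : BKSpace l m)
    {t : TwistorModel l m k} {u : TwistorModel l m k → BKModel l m}
    {u' : TwistorModel l m k →L[ℝ] BKModel l m} (hu : HasFDerivAt u u' t) :
    ∃ L : TwistorModel l m k →L[ℝ] WSpace m,
      HasFDerivAt (fun t => (formW m).perp (liftW p t.1) (tangentW p (u t))) L t ∧ ∀ τ, L τ =
        radialW p t.1 τ.1 • (formW m).perp (liftW p t.1) (tangentW p (u t)) +
        (formW m).perp (liftW p t.1) (tangentW p (u' τ + affineChern p t.1 τ.1 (u t))) -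
        (formW m).logMetric (liftW p t.1) (tangentW p (u t)) (tangentW p τ.1) • liftW p t.1 := by
  have hW : HasFDerivAt (fun t : TwistorModel l m k => liftW p t.1)
      ((tangentW p).restrictScalars ℝ ∘L ContinuousLinearMap.fst ℝ _ _) t :=
    ((hasFDerivAt_liftW p t.1).restrictScalars ℝ).comp t hasFDerivAt_fst
  obtain ⟨L, h1, h2⟩ := (formW m).hasFDerivAt_perp_connection
    (((tangentW p).restrictScalars ℝ).hasFDerivAt.comp t hu) hW
    ((formW m).self_ne_zero_of_re_pos (conjW_liftW_pos p t.1))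
  refine ⟨L, h1, fun τ => ?_⟩
  rw [radialW_apply]
  refine h2 τ _ ?_
  rw [map_add, tangentW_affineChern, radialW_apply, radialW_apply]
  rfl

theorem hasFDerivAt_incl_single (T : GrFrame (BKModel l m) k) (t : TwistorModel l m k) (i : Fin k) :
    HasFDerivAt (fun t : TwistorModel l m k => T.incl t.2 (Pi.single i 1))
      ((inclSlope T i).restrictScalars ℝ ∘L ContinuousLinearMap.snd ℝ _ _) t := by
  simp only [incl_single_eq]
  exact ((((inclSlope T i).restrictScalars ℝ).hasFDerivAt.comp t hasFDerivAt_snd).const_add _)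

theorem prod_smul_add_sub {F G : Type*} [AddCommGroup F] [Module ℂ F] [AddCommGroup G] [Module ℂ G]
    (c d r s : ℂ) (u u' x : F) (w w' y : G) :
    (c • u, d • w) + (u', w') + (-r + s) • (x, (0 : G)) - s • (x, y) =
      (c • u + u' - r • x, d • w + w' - s • y) := by
  refine Prod.ext ?_ ?_
  · simp only [Prod.fst_add, Prod.fst_sub, Prod.fst_neg, Prod.smul_fst, add_smul, neg_smul]
    abel
  · simp only [Prod.snd_add, Prod.snd_sub, Prod.smul_snd, smul_zero, add_zero]

/-- The radial terms in V and W carry the two log metrics as coefficients. Writing them as a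
multiple of (x, y), which is in the plane, plus a multiple of (x, 0) leaves the Kähler metric as
coefficient of (x, 0), because h is the difference of the log metrics. -/
theorem fderiv_localFrame_succ (p : BKSpace l m) (T : GrFrame (BKModel l m) k)
    {t : TwistorModel l m k} (ht : 0 < (conjV (liftV p t.1) (liftV p t.1)).re)
    (τ : TwistorModel l m k) (i : Fin k) :
    fderiv ℝ (localFrame p T) t τ i.succ =
      diagMap l m (radialV p t.1 τ.1) (radialW p t.1 τ.1) (localFrame p T t i.succ) +
        perpTangent p t.1 (inclSlope T i τ.2 +
          chernForm (bkPotential p) t.1 τ.1 (T.incl t.2 (Pi.single i 1))) +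
        kahlerMetric (bkPotential p) t.1 (T.incl t.2 (Pi.single i 1)) τ.1 • (liftV p t.1, 0) -
        (formW m).logMetric (liftW p t.1) (tangentW p (T.incl t.2 (Pi.single i 1)))
          (tangentW p τ.1) • localFrame p T t 0 := by
  have h := hasFDerivAt_pi'.1 (differentiableAt_localFrame p T ht).hasFDerivAt i.succ
  obtain ⟨L₁, h1, h2⟩ := exists_hasFDerivAt_perp_tangentV p ht (hasFDerivAt_incl_single T t i)
  obtain ⟨L₂, h3, h4⟩ := exists_hasFDerivAt_perp_tangentW p (hasFDerivAt_incl_single T t i)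
  have h5 : HasFDerivAt (fun t => localFrame p T t i.succ) (L₁.prod L₂) t := by
    refine (h1.prodMk h3).congr_of_eventuallyEq (Filter.Eventually.of_forall fun s => ?_)
    exact perpTangent_apply p s.1 _
  have h6 := congrArg (fun L : TwistorModel l m k →L[ℝ] VSpace l × WSpace m => L τ) (h.unique h5)
  refine Eq.trans h6 ?_
  have e0 : localFrame p T t 0 = (liftV p t.1, liftW p t.1) := rfl
  have e1 : localFrame p T t i.succ = perpTangent p t.1 (T.incl t.2 (Pi.single i 1)) := rfl
  rw [e0, e1, chernForm_bkPotential ht, kahlerMetric_bkPotential ht, perpTangent_apply,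
    perpTangent_apply, diagMap_apply, prod_smul_add_sub]
  exact Prod.ext (h2 τ) (h4 τ)

end LocalFrame

/-! ### The derivative of the frame and the twistor complex structure. -/

section TwistorStructure

variable {l m k : ℕ}

theorem GrFrame.mem_graph_zero {E : Type*} [NormedAddCommGroup E] [NormedSpace ℂ E]
    (T : GrFrame E k) (v : E) : v ∈ T.graph 0 ↔ (T v).2 = 0 := by
  constructor
  · rintro ⟨c, rfl⟩
    exact congrArg Prod.snd (T.apply_incl 0 c)
  · intro h
    refine ⟨(T v).1, T.injective ?_⟩
    refine (T.apply_incl 0 _).trans ?_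
    exact Prod.ext rfl h.symm

/-- Pairing with x and with y isolates the two radial coefficients; in the plane both come from the
same multiple of (x, y). -/
theorem mem_of_smul_add_perpTangent_mem (p : BKSpace l m) {q : BKModel l m}
    (hq : 0 < (conjV (liftV p q) (liftV p q)).re) {u : Fin k → BKModel l m} {a b : ℂ}
    {v : BKModel l m} (h : (a • liftV p q, b • liftW p q) + perpTangent p q v ∈
      Submodule.span ℂ (range (adaptedFrame p q u))) :
    a = b ∧ v ∈ Submodule.span ℂ (range u) := by
  rw [span_adaptedFrame, Submodule.mem_sup] at h
  obtain ⟨_, h1, _, ⟨v', hv', rfl⟩, h2⟩ := h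
  obtain ⟨s, rfl⟩ := Submodule.mem_span_singleton.1 h1
  have hx := (formV l).self_ne_zero_of_re_pos hq
  have hy := (formW m).self_ne_zero_of_re_pos (conjW_liftW_pos p q)
  have h3 := congrArg (fun z : VSpace l × WSpace m => conjV (liftV p q) z.1) h2
  have h4 := congrArg (fun z : VSpace l × WSpace m => conjW (liftW p q) z.2) h2
  simp only [Prod.fst_add, Prod.snd_add, Prod.smul_fst, Prod.smul_snd, map_add, map_smul,
    conjV_perpTangent p hq, conjW_perpTangent, add_zero, smul_eq_mul] at h3 h4
  have ha := mul_right_cancel₀ hx h3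
  have hb := mul_right_cancel₀ hy h4
  subst ha
  subst hb
  refine ⟨rfl, ?_⟩
  rw [Prod.smul_mk, add_right_inj] at h2
  rwa [← perpTangent_injective p q h2]

theorem perpTangent_mem (p : BKSpace l m) (q : BKModel l m) {u : Fin k → BKModel l m}
    {v : BKModel l m} (hv : v ∈ Submodule.span ℂ (range u)) :
    perpTangent p q v ∈ Submodule.span ℂ (range (adaptedFrame p q u)) := by
  rw [span_adaptedFrame]
  exact Submodule.mem_sup_right ⟨v, hv, rfl⟩

/-- The coordinates of `κ` in its preferred chart. -/
abbrev BKTwistorSpace.center (κ : BKTwistorSpace l m k) : TwistorModel l m k :=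
  (BKTwistorSpace.coord κ, 0)

theorem BKTwistorSpace.slope_frameAt (κ : BKTwistorSpace l m k) :
    κ.slope κ.base κ.frameAt = 0 :=
  GrassmannBundle.slope_eq (κ.coordFiber_base.trans κ.frameAt_spec)

theorem zero_comp_sub (T : GrFrame (BKModel l m) k) :
    (ContinuousLinearMap.snd ℂ (GrSub k) (GrQuot (BKModel l m) k) -
      (0 : GrSub k →L[ℂ] GrQuot (BKModel l m) k) ∘L ContinuousLinearMap.fst ℂ _ _) ∘L
        T.toContinuousLinearMap = ContinuousLinearMap.snd ℂ _ _ ∘L T.toContinuousLinearMap := by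
  rw [ContinuousLinearMap.zero_comp, sub_zero]

theorem BKTwistorSpace.connForm_single (κ : BKTwistorSpace l m k) (ξ : BKModel l m) (i : Fin k) :
    κ.connForm bkPotential ξ (Pi.single i 1) =
      (κ.frameAt (chernForm (bkPotential κ.base) (BKTwistorSpace.coord κ) ξ
        (κ.frameAt.incl 0 (Pi.single i 1)))).2 := by
  rw [GrassmannBundle.connForm, slope_frameAt, GrFrame.quot, zero_comp_sub]
  rfl

theorem BKTwistorSpace.frameAt_vertical (κ : BKTwistorSpace l m k) (τ : TwistorModel l m k)
    (i : Fin k) :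
    (κ.frameAt (inclSlope κ.frameAt i τ.2 + chernForm (bkPotential κ.base)
      (BKTwistorSpace.coord κ) τ.1 (κ.frameAt.incl 0 (Pi.single i 1)))).2 =
      (τ.2 + κ.connForm bkPotential τ.1) (Pi.single i 1) := by
  rw [map_add, Prod.snd_add, ← connForm_single, add_apply]
  congr 1
  have : κ.frameAt (inclSlope κ.frameAt i τ.2) = (0, τ.2 (Pi.single i 1)) :=
    κ.frameAt.apply_symm_apply _
  rw [this]

theorem BKTwistorSpace.span_incl_eq (κ : BKTwistorSpace l m k) :
    Submodule.span ℂ (range fun i : Fin k => κ.frameAt.incl 0 (Pi.single i 1)) = κ.subspace :=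
  (span_incl_single κ.frameAt 0).trans κ.frameAt_spec.symm

theorem BKTwistorSpace.mem_subspace_iff (κ : BKTwistorSpace l m k) (v : BKModel l m) :
    v ∈ κ.subspace ↔ (κ.frameAt v).2 = 0 := by
  rw [← κ.frameAt.mem_graph_zero, GrassmannBundle.subspace, κ.frameAt_spec]

/-- For u in L the metric sees only the L-component of the second argument. There J is -√-1, and
conjugate linearity turns this into √-1: this is what the opposite sign on L is for. -/
theorem BKTwistorSpace.kahlerMetric_horizontalJ (κ : BKTwistorSpace l m k) (ξ : BKModel l m)
    {u : BKModel l m} (hu : u ∈ κ.subspace) :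
    kahlerMetric (bkPotential κ.base) (BKTwistorSpace.coord κ) u (κ.horizontalJ bkPotential ξ) =
      Complex.I * kahlerMetric (bkPotential κ.base) (BKTwistorSpace.coord κ) u ξ := by
  have hq := BKTwistorSpace.coord_pos κ
  obtain ⟨-, h1⟩ := kahlerProj_bkPotential_spec hq κ.subspace ξ
  have h2 := h1 u hu
  have e : κ.horizontalJ bkPotential ξ = Complex.I • (-ξ + (2 : ℂ) •
      (ξ - kahlerProj (bkPotential κ.base) (BKTwistorSpace.coord κ) κ.subspace ξ)) := by
    rw [GrassmannBundle.horizontalJ]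
    module
  rw [e, kahlerMetric_conj_symm hq, kahlerMetric_smul_left hq, kahlerMetric_add_left hq,
    kahlerMetric_smul_left hq, h2, mul_zero, add_zero, ← neg_one_smul ℂ ξ,
    kahlerMetric_smul_left hq, kahlerMetric_conj_symm hq u ξ]
  simp

theorem BKTwistorSpace.horizontalJ_sub_mem (κ : BKTwistorSpace l m k) (ξ : BKModel l m) :
    κ.horizontalJ bkPotential ξ - Complex.I • ξ ∈ κ.subspace := by
  obtain ⟨h1, -⟩ := kahlerProj_bkPotential_spec (BKTwistorSpace.coord_pos κ) κ.subspace ξ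
  have e : κ.horizontalJ bkPotential ξ - Complex.I • ξ = (-2 * Complex.I) •
      kahlerProj (bkPotential κ.base) (BKTwistorSpace.coord κ) κ.subspace ξ := by
    rw [GrassmannBundle.horizontalJ]
    module
  rw [e]
  exact Submodule.smul_mem _ _ h1

theorem BKTwistorSpace.twistorJ_vertical (κ : BKTwistorSpace l m k) (τ : TwistorModel l m k) :
    (κ.twistorJ bkPotential τ).2 + κ.connForm bkPotential (κ.twistorJ bkPotential τ).1 =
      Complex.I • (τ.2 + κ.connForm bkPotential τ.1) :=
  sub_add_cancel _ _

namespace BKTwistorSpace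

/-- The adapted frame at `κ` in the coordinates of the preferred chart. -/
def coordFrame (κ : BKTwistorSpace l m k) : Fin (k + 1) → VSpace l × WSpace m :=
  localFrame κ.base κ.frameAt (center κ)

/-- The derivative of the adapted frame at `κ` in the preferred chart. -/
def frameDeriv (κ : BKTwistorSpace l m k) :
    TwistorModel l m k →L[ℝ] Fin (k + 1) → VSpace l × WSpace m :=
  fderiv ℝ (localFrame κ.base κ.frameAt) (center κ)

/-- The tangent vectors of `M` as elements of the orthogonal complements of `x` and `y`. -/
def perpLift (κ : BKTwistorSpace l m k) : BKModel l m →ₗ[ℂ] VSpace l × WSpace m :=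
  perpTangent κ.base (coord κ)

/-- The covariant derivatives of the basis of the fiber in the direction of `τ`. -/
def covDeriv (κ : BKTwistorSpace l m k) (τ : TwistorModel l m k) (i : Fin k) : BKModel l m :=
  inclSlope κ.frameAt i τ.2 + chernForm (bkPotential κ.base) (coord κ) τ.1
    (κ.frameAt.incl 0 (Pi.single i 1))

/-- The metric of `M` evaluated on a basis vector of the fiber. -/
def basisMetric (κ : BKTwistorSpace l m k) (i : Fin k) (ξ : BKModel l m) : ℂ :=
  kahlerMetric (bkPotential κ.base) (coord κ) (κ.frameAt.incl 0 (Pi.single i 1)) ξ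

/-- The infinitesimal change of the lift `x`. -/
def radialX (κ : BKTwistorSpace l m k) : BKModel l m →ₗ[ℂ] ℂ := radialV κ.base (coord κ)

/-- The infinitesimal change of the lift `y`. -/
def radialY (κ : BKTwistorSpace l m k) : BKModel l m →ₗ[ℂ] ℂ := radialW κ.base (coord κ)

theorem frameDeriv_zero (κ : BKTwistorSpace l m k) (τ : TwistorModel l m k) :
    frameDeriv κ τ 0 = diagMap l m (radialX κ τ.1) (radialY κ τ.1) (coordFrame κ 0) +
      perpLift κ τ.1 :=
  fderiv_localFrame_zero κ.base κ.frameAt (t := center κ) (coord_pos κ) τ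

theorem frameDeriv_succ (κ : BKTwistorSpace l m k) (τ : TwistorModel l m k) (i : Fin k) :
    ∃ r : ℂ, frameDeriv κ τ i.succ =
      diagMap l m (radialX κ τ.1) (radialY κ τ.1) (coordFrame κ i.succ) +
        perpLift κ (covDeriv κ τ i) + basisMetric κ i τ.1 • (x κ, 0) - r • coordFrame κ 0 :=
  ⟨_, fderiv_localFrame_succ κ.base κ.frameAt (t := center κ) (coord_pos κ) τ i⟩

theorem coordFrame_zero (κ : BKTwistorSpace l m k) : coordFrame κ 0 = (x κ, y κ) := rfl

theorem perpLift_mem (κ : BKTwistorSpace l m k) {v : BKModel l m} (hv : v ∈ κ.subspace) :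
    perpLift κ v ∈ Submodule.span ℂ (range (coordFrame κ)) :=
  perpTangent_mem κ.base (coord κ) (by rwa [span_incl_eq])

theorem mem_of_smul_add_perpLift_mem (κ : BKTwistorSpace l m k) {a b : ℂ} {v : BKModel l m}
    (h : (a • x κ, b • y κ) + perpLift κ v ∈ Submodule.span ℂ (range (coordFrame κ))) :
    a = b ∧ v ∈ κ.subspace := by
  obtain ⟨h1, h2⟩ := mem_of_smul_add_perpTangent_mem κ.base (coord_pos κ) h
  exact ⟨h1, by rwa [span_incl_eq] at h2⟩

theorem coordFrame_mem (κ : BKTwistorSpace l m k) (j : Fin (k + 1)) :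
    coordFrame κ j ∈ Submodule.span ℂ (range (coordFrame κ)) :=
  Submodule.subset_span ⟨j, rfl⟩

theorem linearIndependent_coordFrame (κ : BKTwistorSpace l m k) :
    LinearIndependent ℂ (coordFrame κ) :=
  linearIndependent_localFrame κ.base κ.frameAt (t := center κ) (coord_pos κ)

theorem incl_single_mem (κ : BKTwistorSpace l m k) (i : Fin k) :
    κ.frameAt.incl 0 (Pi.single i 1) ∈ κ.subspace := by
  rw [← span_incl_eq]
  exact Submodule.subset_span ⟨i, rfl⟩

theorem basisMetric_twistorJ (κ : BKTwistorSpace l m k) (τ : TwistorModel l m k) (i : Fin k) :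
    basisMetric κ i (κ.twistorJ bkPotential τ).1 = Complex.I * basisMetric κ i τ.1 :=
  kahlerMetric_horizontalJ κ τ.1 (incl_single_mem κ i)

theorem frameAt_covDeriv (κ : BKTwistorSpace l m k) (τ : TwistorModel l m k) (i : Fin k) :
    (κ.frameAt (covDeriv κ τ i)).2 = (τ.2 + κ.connForm bkPotential τ.1) (Pi.single i 1) :=
  frameAt_vertical κ τ i

theorem covDeriv_twistorJ (κ : BKTwistorSpace l m k) (τ : TwistorModel l m k) (i : Fin k) :
    covDeriv κ (κ.twistorJ bkPotential τ) i - Complex.I • covDeriv κ τ i ∈ κ.subspace := by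
  rw [mem_subspace_iff, map_sub, map_smul, Prod.snd_sub, Prod.smul_snd, frameAt_covDeriv,
    frameAt_covDeriv, twistorJ_vertical, smul_apply, sub_self]

theorem eq_zero_of_basisMetric (κ : BKTwistorSpace l m k) {ξ : BKModel l m} (hξ : ξ ∈ κ.subspace)
    (h : ∀ i, basisMetric κ i ξ = 0) : ξ = 0 := by
  apply kahlerMetric_anisotropic (coord_pos κ)
  let s : BKModel l m →ₗ[ℂ] ℂ :=
    { toFun := fun v => kahlerMetric (bkPotential κ.base) (coord κ) v ξ
      map_add' := fun v v' => kahlerMetric_add_left (coord_pos κ) v v' _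
      map_smul' := fun c v => kahlerMetric_smul_left (coord_pos κ) c v _ }
  have h1 : κ.subspace ≤ LinearMap.ker s := by
    rw [← span_incl_eq, Submodule.span_le]
    rintro _ ⟨i, rfl⟩
    exact h i
  exact h1 hξ

theorem frameDeriv_twistorJ_aux {P : Submodule ℂ (VSpace l × WSpace m)}
    {f w w' e f₀ : VSpace l × WSpace m} (a b a' b' h r r' : ℂ) (hw : w' - Complex.I • w ∈ P)
    (hf : f₀ ∈ P) :
    (diagMap l m a' b' f + w' + (Complex.I * h) • e - r' • f₀) -
      Complex.I • (diagMap l m a b f + w + h • e - r • f₀) -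
      diagMap l m (a' - Complex.I * a) (b' - Complex.I * b) f ∈ P := by
  have hd : diagMap l m (a' - Complex.I * a) (b' - Complex.I * b) f =
      diagMap l m a' b' f - Complex.I • diagMap l m a b f := by
    refine Prod.ext ?_ ?_
    · simp [sub_smul, mul_smul]
    · simp [sub_smul, mul_smul]
  rw [hd]
  have h2 := P.add_mem hw (P.smul_mem (Complex.I * r - r') hf)
  convert h2 using 1
  module

/-- The derivative of the adapted frame is complex linear with respect to the almost complex
structure of the twistor space, modulo the plane and the infinitesimal action of `GL(1) × GL(1)`. -/
theorem frameDeriv_twistorJ (κ : BKTwistorSpace l m k) (τ : TwistorModel l m k) :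
    ∃ c d : ℂ, ∀ j, frameDeriv κ (κ.twistorJ bkPotential τ) j - Complex.I • frameDeriv κ τ j -
      diagMap l m c d (coordFrame κ j) ∈ Submodule.span ℂ (range (coordFrame κ)) := by
  -- The diagonal correction is the failure of the radial parts to be complex linear for J.
  refine ⟨radialX κ (κ.twistorJ bkPotential τ).1 - Complex.I * radialX κ τ.1,
    radialY κ (κ.twistorJ bkPotential τ).1 - Complex.I * radialY κ τ.1, fun j => ?_⟩
  have h0 := coordFrame_mem κ 0
  induction j using Fin.cases with
  | zero =>
    have h1 : perpLift κ ((κ.twistorJ bkPotential τ).1 - Complex.I • τ.1) ∈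
        Submodule.span ℂ (range (coordFrame κ)) :=
      perpLift_mem κ (horizontalJ_sub_mem κ τ.1)
    rw [map_sub, map_smul] at h1
    rw [frameDeriv_zero, frameDeriv_zero]
    simpa using frameDeriv_twistorJ_aux (f := coordFrame κ 0) (e := 0)
      (radialX κ τ.1) (radialY κ τ.1) (radialX κ (κ.twistorJ bkPotential τ).1)
      (radialY κ (κ.twistorJ bkPotential τ).1) 0 0 0 h1 h0
  | succ i =>
    have h1 := perpLift_mem κ (covDeriv_twistorJ κ τ i)
    rw [map_sub, map_smul] at h1
    obtain ⟨r, hr⟩ := frameDeriv_succ κ τ i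
    obtain ⟨r', hr'⟩ := frameDeriv_succ κ (κ.twistorJ bkPotential τ) i
    rw [hr, hr', basisMetric_twistorJ]
    exact frameDeriv_twistorJ_aux _ _ _ _ _ _ _ h1 h0

/-- The derivative of the adapted frame is injective modulo the plane and the infinitesimal action
of `GL(1) × GL(1)`. -/
theorem eq_zero_of_frameDeriv_mem (κ : BKTwistorSpace l m k) {τ : TwistorModel l m k} {c d : ℂ}
    (h : ∀ j, frameDeriv κ τ j + diagMap l m c d (coordFrame κ j) ∈
      Submodule.span ℂ (range (coordFrame κ))) :
    τ = 0 ∧ c = d := by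
  have h0 := h 0
  have e0 : frameDeriv κ τ 0 + diagMap l m c d (coordFrame κ 0) =
      ((radialX κ τ.1 + c) • x κ, (radialY κ τ.1 + d) • y κ) + perpLift κ τ.1 := by
    rw [frameDeriv_zero, coordFrame_zero, diagMap_apply, diagMap_apply, add_smul, add_smul,
      ← Prod.mk_add_mk]
    abel
  rw [e0] at h0
  -- The vector (x, y) gives that ξ lies in L and that the two total diagonal coefficients agree.
  obtain ⟨hcd, hξ⟩ := mem_of_smul_add_perpLift_mem κ h0
  have hs : ∀ i : Fin k, basisMetric κ i τ.1 = 0 ∧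
      (τ.2 + κ.connForm bkPotential τ.1) (Pi.single i 1) = 0 := by
    intro i
    have h1 := h i.succ
    obtain ⟨r, hr⟩ := frameDeriv_succ κ τ i
    rw [hr] at h1
    -- With equal coefficients the diagonal terms are a scalar multiple of a frame vector and may be
    -- dropped modulo the plane. What remains forces h(uᵢ, ξ) = 0 and makes the vertical component
    -- vanish.
    have hdiag : diagMap l m (radialX κ τ.1) (radialY κ τ.1) (coordFrame κ i.succ) +
        diagMap l m c d (coordFrame κ i.succ) = (radialX κ τ.1 + c) • coordFrame κ i.succ := by
      refine Prod.ext ?_ ?_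
      · simp [add_smul]
      · simp [hcd, add_smul]
    have h2 := Submodule.add_mem _ (Submodule.sub_mem _ h1
      (Submodule.smul_mem _ (radialX κ τ.1 + c) (coordFrame_mem κ i.succ)))
      (Submodule.smul_mem _ r (coordFrame_mem κ 0))
    rw [← hdiag] at h2
    have h3 : (basisMetric κ i τ.1 • x κ, (0 : ℂ) • y κ) + perpLift κ (covDeriv κ τ i) ∈
        Submodule.span ℂ (range (coordFrame κ)) := by
      have e : (basisMetric κ i τ.1 • x κ, (0 : ℂ) • y κ) =
          basisMetric κ i τ.1 • (x κ, (0 : WSpace m)) := by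
        rw [Prod.smul_mk, smul_zero, zero_smul]
      rw [e]
      convert h2 using 1
      abel
    obtain ⟨h4, h5⟩ := mem_of_smul_add_perpLift_mem κ h3
    exact ⟨h4, by rw [← frameAt_covDeriv, ← mem_subspace_iff]; exact h5⟩
  have hτ1 : τ.1 = 0 := eq_zero_of_basisMetric κ hξ fun i => (hs i).1
  have hτ2 : τ.2 = 0 := by
    have h1 : κ.connForm bkPotential τ.1 = 0 := by
      rw [hτ1, GrassmannBundle.connForm, map_zero, ContinuousLinearMap.zero_comp,
        ContinuousLinearMap.comp_zero]
    have h2 : τ.2.toLinearMap = 0 := by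
      refine (Pi.basisFun ℂ (Fin k)).ext fun i => ?_
      have h3 := (hs i).2
      rw [h1, add_zero] at h3
      rw [Pi.basisFun_apply]
      exact h3
    ext1 v
    exact LinearMap.congr_fun h2 v
  refine ⟨Prod.ext hτ1 hτ2, ?_⟩
  rw [hτ1, map_zero, map_zero, zero_add, zero_add] at hcd
  exact hcd

end BKTwistorSpace

end TwistorStructure

/-! ### Affine coordinates on a projective space and their derivative. -/

section AffinePart

variable {F : Type*} [NormedAddCommGroup F] [NormedSpace ℂ F]

/-- The affine coordinates of the line through `v`. -/
def affinePart (v : ℂ × F) : F := v.1⁻¹ • v.2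

theorem affinePart_smul {c : ℂ} (hc : c ≠ 0) (v : ℂ × F) : affinePart (c • v) = affinePart v := by
  rw [affinePart, affinePart, Prod.smul_fst, Prod.smul_snd, smul_smul, smul_eq_mul]
  congr 1
  field_simp

theorem contDiffAt_affinePart {v : ℂ × F} (hv : v.1 ≠ 0) (n : ℕ∞ω) :
    ContDiffAt ℂ n (affinePart (F := F)) v :=
  (contDiffAt_fst.inv hv).smul contDiffAt_snd

/-- The derivative of the affine coordinates. -/
def affineDeriv (v : ℂ × F) : ℂ × F →L[ℂ] F := fderiv ℂ affinePart v

theorem hasFDerivAt_affinePart {v : ℂ × F} (hv : v.1 ≠ 0) :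
    HasFDerivAt affinePart (affineDeriv v) v :=
  ((contDiffAt_affinePart hv 1).differentiableAt one_ne_zero).hasFDerivAt

theorem affineDeriv_apply {v : ℂ × F} (hv : v.1 ≠ 0) (w : ℂ × F) :
    affineDeriv v w = v.1⁻¹ • (w.2 - (w.1 / v.1) • v.2) := by
  have h1 : HasFDerivAt (fun v : ℂ × F => v.1⁻¹) _ v :=
    (hasFDerivAt_inv hv).comp v hasFDerivAt_fst
  have h2 : HasFDerivAt (affinePart (F := F)) _ v := h1.fun_smul hasFDerivAt_snd
  rw [(hasFDerivAt_affinePart hv).unique h2]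
  simp only [add_apply, smul_apply, ContinuousLinearMap.smulRight_apply,
    ContinuousLinearMap.comp_apply, ContinuousLinearMap.coe_fst', ContinuousLinearMap.coe_snd',
    smul_sub, smul_smul, ContinuousLinearMap.toSpanSingleton_apply, smul_eq_mul]
  rw [sub_eq_add_neg, ← neg_smul]
  congr 2
  field_simp

/-- Normalizing the first coordinate forgets, to first order, exactly the motions along the line
itself. -/
theorem affineDeriv_eq_zero_iff {v : ℂ × F} (hv : v.1 ≠ 0) (w : ℂ × F) :
    affineDeriv v w = 0 ↔ ∃ c : ℂ, w = c • v := by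
  rw [affineDeriv_apply hv]
  constructor
  · intro h
    have h1 := (smul_eq_zero.1 h).resolve_left (inv_ne_zero hv)
    refine ⟨w.1 / v.1, Prod.ext ?_ (sub_eq_zero.1 h1)⟩
    simp [hv]
  · rintro ⟨c, rfl⟩
    simp [hv]

theorem ProjFrame.chart_mk {E : Type*} [AddCommGroup E] [Module ℂ E] (S : ProjFrame E) {v : E}
    (hv : v ≠ 0) : S.chart (Projectivization.mk ℂ v hv) = affinePart (S v) := by
  obtain ⟨a, ha, h⟩ := exists_rep_mk_eq v hv
  change affinePart (S (Projectivization.mk ℂ v hv).rep) = _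
  rw [h, map_smul, affinePart_smul ha]

theorem ProjFrame.mk_mem_source {E : Type*} [AddCommGroup E] [Module ℂ E] (S : ProjFrame E) {v : E}
    (hv : v ≠ 0) : Projectivization.mk ℂ v hv ∈ S.chart.source ↔ (S v).1 ≠ 0 := by
  obtain ⟨a, ha, h⟩ := exists_rep_mk_eq v hv
  change (S (Projectivization.mk ℂ v hv).rep).1 ≠ 0 ↔ _
  rw [h, map_smul]
  simp [ha]

theorem ProjFrame.ne_zero_of_fst_ne_zero {E : Type*} [AddCommGroup E] [Module ℂ E]
    (S : ProjFrame E) {v : E} (h : (S v).1 ≠ 0) : v ≠ 0 := by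
  rintro rfl
  exact h (by rw [map_zero]; rfl)

theorem ProjFrame.affineDeriv_eq_smul {E : Type*} [AddCommGroup E] [Module ℂ E] (S : ProjFrame E)
    {v w w' : E} {C c : ℂ} (hv : (S v).1 ≠ 0) (h : w' = C • v + c • w) :
    affineDeriv (S v) (S w') = c • affineDeriv (S v) (S w) := by
  have h0 := (affineDeriv_eq_zero_iff hv (S v)).2 ⟨1, (one_smul _ _).symm⟩
  rw [h, map_add, map_smul, map_smul, map_add, map_smul, map_smul, h0, smul_zero, zero_add]

theorem ProjFrame.exists_eq_smul_of_affineDeriv {E : Type*} [AddCommGroup E] [Module ℂ E]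
    (S : ProjFrame E) {v w : E} (hv : (S v).1 ≠ 0) (h : affineDeriv (S v) (S w) = 0) :
    ∃ c : ℂ, w = c • v := by
  obtain ⟨c, hc⟩ := (affineDeriv_eq_zero_iff hv _).1 h
  rw [← map_smul] at hc
  exact ⟨c, S.injective hc⟩

theorem ProjFrame.affinePart_smul {E : Type*} [AddCommGroup E] [Module ℂ E] (S : ProjFrame E)
    {v w : E} {c : ℂ} (hc : c ≠ 0) (h : w = c • v) : affinePart (S w) = affinePart (S v) := by
  rw [h, map_smul, BKTwistor.affinePart_smul hc]

theorem ProjFrame.fst_ne_zero {E : Type*} [AddCommGroup E] [Module ℂ E] (S : ProjFrame E)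
    {v w : E} {c : ℂ} (hc : c ≠ 0) (h : w = c • v) : (S w).1 ≠ 0 ↔ (S v).1 ≠ 0 := by
  rw [h, map_smul]
  simp [hc]

end AffinePart

/-! ### ψ in standard charts: smoothness and its differential. -/

section LocalPsi

variable {l m k a b : ℕ}

/-- A component of `ψ` in the affine coordinates given by `S`. -/
def localCoord (S : ProjFrame (LambdaVW l m a b)) (p : BKSpace l m) (T : GrFrame (BKModel l m) k)
    (t : TwistorModel l m k) : ProjModel (LambdaVW l m a b) :=
  affinePart (S (localPhi a b p T t))

theorem contDiffAt_localPhi {F : Type*} [NormedAddCommGroup F] [NormedSpace ℂ F]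
    (S : LambdaVW l m a b →ₗ[ℂ] F) (p : BKSpace l m)
    (T : GrFrame (BKModel l m) k) {t : TwistorModel l m k}
    (ht : 0 < (conjV (liftV p t.1) (liftV p t.1)).re) (n : ℕ∞ω) :
    ContDiffAt ℝ n (fun t => S (localPhi a b p T t)) t :=
  ((lambdaMultilinear (k + 1) S).contDiff.restrict_scalars ℝ).contDiffAt.comp t
    (contDiffAt_localFrame p T ht n)

theorem contDiffAt_localCoord (S : ProjFrame (LambdaVW l m a b)) (p : BKSpace l m)
    (T : GrFrame (BKModel l m) k) {t : TwistorModel l m k}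
    (ht : 0 < (conjV (liftV p t.1) (liftV p t.1)).re) (hS : (S (localPhi a b p T t)).1 ≠ 0)
    (n : ℕ∞ω) : ContDiffAt ℝ n (localCoord S p T) t :=
  ((contDiffAt_affinePart hS n).restrict_scalars ℝ).comp t
    (contDiffAt_localPhi S.toLinearMap p T ht n)

theorem hasFDerivAt_localCoord (S : ProjFrame (LambdaVW l m a b)) (κ : BKTwistorSpace l m k)
    (hS : (S (localPhi a b κ.base κ.frameAt (BKTwistorSpace.center κ))).1 ≠ 0) :
    ∃ L : TwistorModel l m k →L[ℝ] ProjModel (LambdaVW l m a b),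
      HasFDerivAt (localCoord S κ.base κ.frameAt) L (BKTwistorSpace.center κ) ∧
      ∀ τ, L τ = affineDeriv (S (localPhi a b κ.base κ.frameAt (BKTwistorSpace.center κ)))
        (S (lambdaProj a b (ιMultiDeriv (BKTwistorSpace.coordFrame κ)
          (BKTwistorSpace.frameDeriv κ τ)))) := by
  have h1 : HasFDerivAt (localFrame κ.base κ.frameAt) (BKTwistorSpace.frameDeriv κ)
      (BKTwistorSpace.center κ) :=
    (differentiableAt_localFrame κ.base κ.frameAt (t := BKTwistorSpace.center κ)
      (BKTwistorSpace.coord_pos κ)).hasFDerivAt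
  have h2 := (((lambdaMultilinear (k + 1) S.toLinearMap).hasFDerivAt
    (localFrame κ.base κ.frameAt (BKTwistorSpace.center κ))).restrictScalars ℝ).comp _ h1
  have h3 := HasFDerivAt.comp (g := affinePart)
    (f := lambdaMultilinear (k + 1) S.toLinearMap ∘ localFrame κ.base κ.frameAt)
    (BKTwistorSpace.center κ) ((hasFDerivAt_affinePart hS).restrictScalars ℝ) h2
  refine ⟨_, h3, fun τ => ?_⟩
  refine congrArg (affineDeriv _) ?_
  exact linearDeriv_lambdaMultilinear S.toLinearMap _ _

theorem lambdaProj_ιMultiDeriv_add_smul {n : ℕ} (p d d' : Fin n → VSpace l × WSpace m) (c : ℂ)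
    (a b : ℕ) :
    lambdaProj a b (ιMultiDeriv p d') = lambdaProj a b (ιMultiDeriv p fun i => d' i - c • d i) +
      c • lambdaProj a b (ιMultiDeriv p d) := by
  have e : d' = fun i => (d' i - c • d i) + c • d i := funext fun i => (sub_add_cancel _ _).symm
  conv_lhs => rw [e, ιMultiDeriv_add p (fun i => d' i - c • d i) (fun i => c • d i),
    ιMultiDeriv_smul]
  exact (LinearMap.map_add (lambdaProj a b) _ _).trans
    (congrArg _ (LinearMap.map_smul (lambdaProj a b) _ _))

/-- The error in `frameDeriv_twistorJ` lies in the plane or is diagonal, and such motions only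
rescale each component. -/
theorem lambdaProj_ιMultiDeriv_twistorJ (κ : BKTwistorSpace l m k) (τ : TwistorModel l m k)
    (a b : ℕ) : ∃ C : ℂ,
    lambdaProj a b (ιMultiDeriv (BKTwistorSpace.coordFrame κ)
      (BKTwistorSpace.frameDeriv κ (κ.twistorJ bkPotential τ))) =
    C • localPhi a b κ.base κ.frameAt (BKTwistorSpace.center κ) +
    Complex.I • lambdaProj a b (ιMultiDeriv (BKTwistorSpace.coordFrame κ)
      (BKTwistorSpace.frameDeriv κ τ)) := by
  obtain ⟨c, d, hcd⟩ := BKTwistorSpace.frameDeriv_twistorJ κ τ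
  obtain ⟨C, hC⟩ := exists_lambdaProj_ιMultiDeriv_eq_smul
    (d := fun i => BKTwistorSpace.frameDeriv κ (κ.twistorJ bkPotential τ) i -
      Complex.I • BKTwistorSpace.frameDeriv κ τ i) hcd a b
  refine ⟨C, ?_⟩
  rw [lambdaProj_ιMultiDeriv_add_smul _ (BKTwistorSpace.frameDeriv κ τ) _ Complex.I, hC]
  rfl

theorem affineDeriv_twistorJ (S : ProjFrame (LambdaVW l m a b)) (κ : BKTwistorSpace l m k)
    (hS : (S (localPhi a b κ.base κ.frameAt (BKTwistorSpace.center κ))).1 ≠ 0)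
    (τ : TwistorModel l m k) :
    affineDeriv (S (localPhi a b κ.base κ.frameAt (BKTwistorSpace.center κ)))
      (S (lambdaProj a b (ιMultiDeriv (BKTwistorSpace.coordFrame κ)
        (BKTwistorSpace.frameDeriv κ (κ.twistorJ bkPotential τ))))) =
    Complex.I • affineDeriv (S (localPhi a b κ.base κ.frameAt (BKTwistorSpace.center κ)))
      (S (lambdaProj a b (ιMultiDeriv (BKTwistorSpace.coordFrame κ)
        (BKTwistorSpace.frameDeriv κ τ)))) := by
  obtain ⟨C, hC⟩ := lambdaProj_ιMultiDeriv_twistorJ κ τ a b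
  exact S.affineDeriv_eq_smul hS hC

theorem exists_localPhi_center_eq_smul (κ : BKTwistorSpace l m k) (a b : ℕ) :
    ∃ C : ℂ, C ≠ 0 ∧ localPhi a b κ.base κ.frameAt (BKTwistorSpace.center κ) =
      C • BKTwistorSpace.phi a b κ := by
  have h := exists_localPhi_eq_smul κ κ.base κ.frameAt ⟨mem_extChartAt_source _, 0,
    κ.coordFiber_base.trans κ.frameAt_spec⟩ a b
  rwa [BKTwistorSpace.slope_frameAt] at h

/-- `ψ_{a,b}` in a standard chart and the affine coordinates given by `S₁` and `S₂`. -/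
def localPsi (S₁ : ProjFrame (LambdaVW l m (a + 1) b)) (S₂ : ProjFrame (LambdaVW l m a (b + 1)))
    (p : BKSpace l m) (T : GrFrame (BKModel l m) k) (t : TwistorModel l m k) :
    TargetModel l m a b :=
  (localCoord S₁ p T t, localCoord S₂ p T t)

/-- The coordinates in which `localPsi` represents `ψ_{a,b}`. -/
def localDomain (S₁ : ProjFrame (LambdaVW l m (a + 1) b)) (S₂ : ProjFrame (LambdaVW l m a (b + 1)))
    (p : BKSpace l m) (T : GrFrame (BKModel l m) k) : Set (TwistorModel l m k) :=
  {t | 0 < (conjV (liftV p t.1) (liftV p t.1)).re ∧ (S₁ (localPhi (a + 1) b p T t)).1 ≠ 0 ∧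
    (S₂ (localPhi a (b + 1) p T t)).1 ≠ 0}

variable {S₁ : ProjFrame (LambdaVW l m (a + 1) b)} {S₂ : ProjFrame (LambdaVW l m a (b + 1))}

theorem contDiffAt_localPsi {p : BKSpace l m} {T : GrFrame (BKModel l m) k}
    {t : TwistorModel l m k} (ht : t ∈ localDomain S₁ S₂ p T) (n : ℕ∞ω) :
    ContDiffAt ℝ n (localPsi S₁ S₂ p T) t :=
  (contDiffAt_localCoord S₁ p T ht.1 ht.2.1 n).prodMk (contDiffAt_localCoord S₂ p T ht.1 ht.2.2 n)

theorem continuous_conjV_liftV (p : BKSpace l m) :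
    Continuous fun q : BKModel l m => (conjV (liftV p q) (liftV p q)).re :=
  continuous_conjV.comp (contDiff_liftV p 0).continuous

theorem isOpen_localDomain (p : BKSpace l m) (T : GrFrame (BKModel l m) k) :
    IsOpen (localDomain S₁ S₂ p T) := by
  rw [isOpen_iff_mem_nhds]
  intro t ht
  have h1 : ∀ᶠ s : TwistorModel l m k in nhds t, 0 < (conjV (liftV p s.1) (liftV p s.1)).re :=
    ((continuous_conjV_liftV p).comp continuous_fst).continuousAt.eventually_const_lt ht.1
  have h2 := ((contDiffAt_localPhi S₁.toLinearMap p T ht.1 0).continuousAt.fst).eventually_ne ht.2.1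
  have h3 := ((contDiffAt_localPhi S₂.toLinearMap p T ht.1 0).continuousAt.fst).eventually_ne ht.2.2
  filter_upwards [h1, h2, h3] with s h4 h5 h6
  exact ⟨h4, h5, h6⟩

theorem center_mem_localDomain {κ : BKTwistorSpace l m k}
    (h₁ : (S₁ (BKTwistorSpace.phi (a + 1) b κ)).1 ≠ 0)
    (h₂ : (S₂ (BKTwistorSpace.phi a (b + 1) κ)).1 ≠ 0) :
    BKTwistorSpace.center κ ∈ localDomain S₁ S₂ κ.base κ.frameAt := by
  obtain ⟨C, hC, h⟩ := exists_localPhi_center_eq_smul κ (a + 1) b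
  obtain ⟨C', hC', h'⟩ := exists_localPhi_center_eq_smul κ a (b + 1)
  refine ⟨BKTwistorSpace.coord_pos κ, ?_, ?_⟩
  · exact (S₁.fst_ne_zero hC h).2 h₁
  · exact (S₂.fst_ne_zero hC' h').2 h₂

/-- The derivative of `ψ_{a,b}` at `κ` in coordinates is injective and complex linear with respect
to the almost complex structure of the twistor space. -/
theorem fderiv_localPsi (hab : a + b = k) {κ : BKTwistorSpace l m k}
    (hκ : BKTwistorSpace.center κ ∈ localDomain S₁ S₂ κ.base κ.frameAt) :
    Function.Injective (fderiv ℝ (localPsi S₁ S₂ κ.base κ.frameAt) (BKTwistorSpace.center κ)) ∧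
    ∀ τ, fderiv ℝ (localPsi S₁ S₂ κ.base κ.frameAt) (BKTwistorSpace.center κ)
        (κ.twistorJ bkPotential τ) =
      Complex.I • fderiv ℝ (localPsi S₁ S₂ κ.base κ.frameAt) (BKTwistorSpace.center κ) τ := by
  obtain ⟨L₁, h1, h2⟩ := hasFDerivAt_localCoord S₁ κ hκ.2.1
  obtain ⟨L₂, h3, h4⟩ := hasFDerivAt_localCoord S₂ κ hκ.2.2
  have h5 : HasFDerivAt (localPsi S₁ S₂ κ.base κ.frameAt) (L₁.prod L₂) (BKTwistorSpace.center κ) :=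
    h1.prodMk h3
  rw [h5.fderiv]
  have hα : lambdaProj (a + 1) b
      (ExteriorAlgebra.ιMulti ℂ (k + 1) (BKTwistorSpace.coordFrame κ)) ≠ 0 :=
    S₁.ne_zero_of_fst_ne_zero hκ.2.1
  have hβ : lambdaProj a (b + 1)
      (ExteriorAlgebra.ιMulti ℂ (k + 1) (BKTwistorSpace.coordFrame κ)) ≠ 0 :=
    S₂.ne_zero_of_fst_ne_zero hκ.2.2
  constructor
  · refine (injective_iff_map_eq_zero _).2 fun τ hτ => ?_
    obtain ⟨h6, h7⟩ := Prod.mk_eq_zero.1 hτ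
    -- A vanishing derivative in affine coordinates makes the derivative of each component a
    -- multiple of that component.
    obtain ⟨c, hc⟩ := S₁.exists_eq_smul_of_affineDeriv hκ.2.1 ((h2 τ).symm.trans h6)
    obtain ⟨c', hc'⟩ := S₂.exists_eq_smul_of_affineDeriv hκ.2.2 ((h4 τ).symm.trans h7)
    exact (BKTwistorSpace.eq_zero_of_frameDeriv_mem κ (add_diagMap_mem_span (by omega)
      (BKTwistorSpace.linearIndependent_coordFrame κ) hα hβ hc hc')).1
  · intro τ
    refine Prod.ext ?_ ?_
    · exact (h2 _).trans ((affineDeriv_twistorJ S₁ κ hκ.2.1 τ).trans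
        (congrArg (Complex.I • ·) (h2 τ).symm))
    · exact (h4 _).trans ((affineDeriv_twistorJ S₂ κ hκ.2.2 τ).trans
        (congrArg (Complex.I • ·) (h4 τ).symm))

theorem localCoord_eq (S : ProjFrame (LambdaVW l m a b)) (p : BKSpace l m)
    (T : GrFrame (BKModel l m) k) (κ : BKTwistorSpace l m k)
    (hκ : κ.base ∈ (extChartAt (bkI l m) p).source ∧ ∃ Z, κ.coordFiber p = T.graph Z)
    (h0 : BKTwistorSpace.phi a b κ ≠ 0) :
    localCoord S p T (extChartAt (bkI l m) p κ.base, κ.slope p T) =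
      S.chart (Projectivization.mk ℂ (BKTwistorSpace.phi a b κ) h0) := by
  obtain ⟨C, hC, h⟩ := exists_localPhi_eq_smul κ p T hκ a b
  rw [S.chart_mk]
  exact S.affinePart_smul hC h

/-- `localPsi` represents `ψ_{a,b}`. -/
theorem localPsi_eq (S₁ : ProjFrame (LambdaVW l m (a + 1) b)) (S₂ : ProjFrame (LambdaVW l m a (b + 1)))
    (p : BKSpace l m) (T : GrFrame (BKModel l m) k) (κ : twistorU l m k a b)
    (hκ : κ.1.base ∈ (extChartAt (bkI l m) p).source ∧ ∃ Z, κ.1.coordFiber p = T.graph Z) :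
    localPsi S₁ S₂ p T (extChartAt (bkI l m) p κ.1.base, κ.1.slope p T) =
      (S₁.chart (twistorPsi l m k a b κ).1, S₂.chart (twistorPsi l m k a b κ).2) := by
  rw [localPsi, localCoord_eq S₁ p T κ.1 hκ κ.2.1, localCoord_eq S₂ p T κ.1 hκ κ.2.2, twistorPsi]

end LocalPsi

/-! ### Cutting down the target of a linear map; stability of surjectivity. -/

section LinearAlgebraAux

/-- Composing with ρ discards redundant equations for the kernel: exactly as many remain as its
codimension, which later makes the system for nearby planes square. -/
theorem exists_comp_ker_eq {X Y : Type*} [AddCommGroup X] [Module ℂ X] [FiniteDimensional ℂ X]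
    [AddCommGroup Y] [Module ℂ Y] (f : X →ₗ[ℂ] Y) {r q : ℕ}
    (hr : Module.finrank ℂ (LinearMap.ker f) = r) (hq : Module.finrank ℂ X = r + q) :
    ∃ ρ : Y →ₗ[ℂ] (Fin q → ℂ), LinearMap.ker (ρ ∘ₗ f) = LinearMap.ker f ∧
      Function.Surjective (ρ ∘ₗ f) := by
  have h1 := f.finrank_range_add_finrank_ker
  let e : LinearMap.range f ≃ₗ[ℂ] (Fin q → ℂ) := LinearEquiv.ofFinrankEq _ _ (by
    rw [Module.finrank_fin_fun]; omega)
  obtain ⟨ρ, hρ⟩ := LinearMap.exists_extend e.toLinearMap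
  have h2 : ∀ x, ρ (f x) = e ⟨f x, x, rfl⟩ := fun x =>
    LinearMap.congr_fun hρ ⟨f x, x, rfl⟩
  refine ⟨ρ, ?_, ?_⟩
  · ext x
    rw [LinearMap.mem_ker, LinearMap.mem_ker, LinearMap.comp_apply, h2, e.map_eq_zero_iff,
      Subtype.ext_iff]
    rfl
  · intro w
    obtain ⟨x, hx⟩ := (e.symm w).2
    refine ⟨x, ?_⟩
    rw [LinearMap.comp_apply, h2]
    have : (⟨f x, x, rfl⟩ : LinearMap.range f) = e.symm w := Subtype.ext hx
    rw [this, e.apply_symm_apply]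

/-- Composition with a fixed right inverse of A₀ is near the identity, hence invertible. -/
theorem eventually_surjective {X Y : Type*} [NormedAddCommGroup X] [NormedSpace ℂ X]
    [NormedAddCommGroup Y] [NormedSpace ℂ Y] [FiniteDimensional ℂ Y] (A₀ : X →L[ℂ] Y)
    (h : Function.Surjective A₀) : ∀ᶠ A : X →L[ℂ] Y in nhds A₀, Function.Surjective A := by
  obtain ⟨σ, hσ⟩ := A₀.toLinearMap.exists_rightInverse_of_surjective (LinearMap.range_eq_top.2 h)
  have : CompleteSpace Y := FiniteDimensional.complete ℂ Y
  let σ' : Y →L[ℂ] X := LinearMap.toContinuousLinearMap σ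
  have h1 : A₀ ∘L σ' = 1 := by
    ext1 y
    exact LinearMap.congr_fun hσ y
  have h2 : Continuous fun A : X →L[ℂ] Y => A ∘L σ' := continuous_id.clm_comp continuous_const
  have h3 : {u : Y →L[ℂ] Y | IsUnit u} ∈ nhds (A₀ ∘L σ') :=
    Units.isOpen.mem_nhds (by rw [h1]; exact isUnit_one)
  filter_upwards [h2.continuousAt.preimage_mem_nhds h3] with A hA y
  obtain ⟨z, hz⟩ := ((ContinuousLinearMap.isUnit_iff_bijective).1 hA).2 y
  exact ⟨σ' z, hz⟩

end LinearAlgebraAux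

/-! ### The diagonal action on planes and the wedge equation as a linear map. -/

section DiagMap

variable {l m : ℕ}

theorem map_diagMap_map (c d c' d' : ℂ) (P : Submodule ℂ (VSpace l × WSpace m)) :
    (P.map (diagMap l m c' d')).map (diagMap l m c d) = P.map (diagMap l m (c * c') (d * d')) := by
  rw [← Submodule.map_comp]
  congr 1
  ext v <;> simp [mul_assoc]

theorem eq_map_diagMap_of_map_eq {c d : ℂ} (hc : c ≠ 0) (hd : d ≠ 0)
    {P Q : Submodule ℂ (VSpace l × WSpace m)} (h : P.map (diagMap l m c d) = Q) :
    P = Q.map (diagMap l m c⁻¹ d⁻¹) := by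
  rw [← h, map_diagMap_map, inv_mul_cancel₀ hc, inv_mul_cancel₀ hd]
  have : diagMap l m 1 1 = LinearMap.id := by
    ext v <;> simp
  rw [this, Submodule.map_id]

/-- `lambdaWedge` as a linear map. -/
def wedgeMap (l m a b : ℕ) : (LambdaVW l m (a + 1) b × LambdaVW l m a (b + 1)) →ₗ[ℂ]
    (VSpace l × WSpace m) →ₗ[ℂ] LambdaVW l m (a + 1) (b + 1) :=
  ((((LinearMap.mul ℂ (ExteriorAlgebra ℂ (VSpace l × WSpace m))).flip.compl₂
      (ExteriorAlgebra.ι ℂ ∘ₗ LinearMap.inl ℂ _ _ ∘ₗ LinearMap.fst ℂ _ _)) ∘ₗ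
        lambdaIncl a (b + 1) ∘ₗ LinearMap.snd ℂ _ _) +
    (((LinearMap.mul ℂ (ExteriorAlgebra ℂ (VSpace l × WSpace m))).flip.compl₂
      (ExteriorAlgebra.ι ℂ ∘ₗ LinearMap.inr ℂ _ _ ∘ₗ LinearMap.snd ℂ _ _)) ∘ₗ
        lambdaIncl (a + 1) b ∘ₗ LinearMap.fst ℂ _ _)).compr₂ (lambdaProj (a + 1) (b + 1))

theorem wedgeMap_apply {a b : ℕ} (α : LambdaVW l m (a + 1) b) (β : LambdaVW l m a (b + 1))
    (p : VSpace l × WSpace m) : wedgeMap l m a b (α, β) p = lambdaWedge a b α β p := rfl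

end DiagMap

/-! ### Persistence of solutions of the kernel equation. -/

section Perturbation

/-- If the equation `A₀ (F t j + c • E (F t j)) = 0` in `(t, c)` has the nondegenerate solution
`(t₀, 0)`, then the equation for `A` close to `A₀` has a solution close to it. -/
theorem eventually_exists_solution {T X Y ι : Type*} [Fintype ι]
    [NormedAddCommGroup T] [NormedSpace ℝ T] [FiniteDimensional ℝ T]
    [NormedAddCommGroup X] [NormedSpace ℂ X] [FiniteDimensional ℂ X]
    [NormedAddCommGroup Y] [NormedSpace ℂ Y] [FiniteDimensional ℂ Y]
    {F : T → ι → X} {F' : T →L[ℝ] ι → X} {t₀ : T} (hF : HasStrictFDerivAt F F' t₀)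
    (E : X →L[ℂ] X) (A₀ : X →L[ℂ] Y) (h0 : ∀ j, A₀ (F t₀ j) = 0)
    (hinj : ∀ τ (c : ℂ), (∀ j, A₀ (F' τ j + c • E (F t₀ j)) = 0) → τ = 0 ∧ c = 0)
    (hdim : Module.finrank ℝ (T × ℂ) = Module.finrank ℝ (ι → Y)) {N : Set T} (hN : N ∈ nhds t₀) :
    ∀ᶠ A : X →L[ℂ] Y in nhds A₀, ∃ t ∈ N, ∃ c : ℂ, 1 + c ≠ 0 ∧
      ∀ j, A (F t j + c • E (F t j)) = 0 := by
  have : FiniteDimensional ℝ X := FiniteDimensional.complexToReal X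
  have : FiniteDimensional ℝ Y := FiniteDimensional.complexToReal Y
  have : FiniteDimensional ℝ (X →L[ℂ] Y) := FiniteDimensional.complexToReal _
  have : CompleteSpace T := FiniteDimensional.complete ℝ T
  have : CompleteSpace Y := FiniteDimensional.complete ℝ Y
  have : CompleteSpace (X →L[ℂ] Y) := FiniteDimensional.complete ℝ _
  let Ω := (T × ℂ) × (X →L[ℂ] Y)
  let z₀ : Ω := ((t₀, 0), A₀)
  have hF' : ∀ j, HasStrictFDerivAt (fun z : Ω => F z.1.1 j)
      ((ContinuousLinearMap.proj (R := ℝ) (φ := fun _ : ι => X) j ∘L F') ∘L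
        (ContinuousLinearMap.fst ℝ T ℂ ∘L ContinuousLinearMap.fst ℝ (T × ℂ) (X →L[ℂ] Y))) z₀ := by
    intro j
    have h1 : HasStrictFDerivAt (fun t => F t j)
      (ContinuousLinearMap.proj (R := ℝ) (φ := fun _ : ι => X) j ∘L F') t₀ :=
      (ContinuousLinearMap.proj (R := ℝ) (φ := fun _ : ι => X) j).hasStrictFDerivAt.comp t₀ hF
    exact HasStrictFDerivAt.comp (g := fun t => F t j) z₀ h1
      (ContinuousLinearMap.fst ℝ T ℂ ∘L
        ContinuousLinearMap.fst ℝ (T × ℂ) (X →L[ℂ] Y)).hasStrictFDerivAt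
  have hc : HasStrictFDerivAt (fun z : Ω => z.1.2)
      (ContinuousLinearMap.snd ℝ T ℂ ∘L ContinuousLinearMap.fst ℝ (T × ℂ) (X →L[ℂ] Y)) z₀ :=
    (ContinuousLinearMap.snd ℝ T ℂ ∘L
      ContinuousLinearMap.fst ℝ (T × ℂ) (X →L[ℂ] Y)).hasStrictFDerivAt
  have hA : HasStrictFDerivAt (fun z : Ω => z.2)
      (ContinuousLinearMap.snd ℝ (T × ℂ) (X →L[ℂ] Y)) z₀ := hasStrictFDerivAt_snd
  have hv : ∀ j, HasStrictFDerivAt (fun z : Ω => F z.1.1 j + z.1.2 • E (F z.1.1 j)) _ z₀ :=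
    fun j => (hF' j).fun_add (hc.fun_smul
      ((E.restrictScalars ℝ).hasStrictFDerivAt.comp z₀ (hF' j)))
  have hG : ∀ j, HasStrictFDerivAt (fun z : Ω => z.2 (F z.1.1 j + z.1.2 • E (F z.1.1 j))) _ z₀ :=
    fun j => HasStrictFDerivAt.comp
      (g := fun w : (X →L[ℂ] Y) × X => w.1 w.2)
      (f := fun z : Ω => (z.2, F z.1.1 j + z.1.2 • E (F z.1.1 j))) z₀
      (((isBoundedBilinearMap_apply (𝕜 := ℂ) (E := X) (F := Y)).hasStrictFDerivAt _).restrictScalars ℝ)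
      (hA.prodMk (hv j))
  -- The parameter A is kept as an output, so surjectivity onto a neighbourhood of (0, A₀) solves
  -- the equation for every nearby A at once.
  have hH := (hasStrictFDerivAt_pi.2 hG).prodMk hA
  obtain ⟨L, hL, hL'⟩ : ∃ L : Ω →L[ℝ] (ι → Y) × (X →L[ℂ] Y),
      HasStrictFDerivAt (fun z : Ω => ((fun j => z.2 (F z.1.1 j + z.1.2 • E (F z.1.1 j)), z.2) :
        (ι → Y) × (X →L[ℂ] Y))) L z₀ ∧ ∀ τ c B, L ((τ, c), B) =
        (fun j => A₀ (F' τ j + c • E (F t₀ j)) + B (F t₀ j), B) := by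
    refine ⟨_, hH, fun τ c B => Prod.ext (funext fun j => ?_) rfl⟩
    have e1 : F t₀ j + (0 : ℂ) • E (F t₀ j) = F t₀ j := by rw [zero_smul, add_zero]
    have e2 : ∀ w : X, F' τ j + ((0 : ℂ) • w + c • E (F t₀ j)) = F' τ j + c • E (F t₀ j) :=
      fun w => by rw [zero_smul, zero_add]
    exact congrArg₂ (fun u w => A₀ u + B w) (e2 _) e1
  let D : T × ℂ →ₗ[ℝ] ι → Y := (LinearMap.fst ℝ (ι → Y) (X →L[ℂ] Y) ∘ₗ L.toLinearMap) ∘ₗ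
    LinearMap.inl ℝ (T × ℂ) (X →L[ℂ] Y)
  have hD : ∀ τ c j, D (τ, c) j = A₀ (F' τ j + c • E (F t₀ j)) := fun τ c j =>
    (congrFun (congrArg Prod.fst (hL' τ c 0)) j).trans (by simp)
  have hDinj : Function.Injective D := (injective_iff_map_eq_zero _).2 fun τc h => by
    obtain ⟨τ, c⟩ := τc
    obtain ⟨h1, h2⟩ := hinj τ c fun j => (hD τ c j).symm.trans (congrFun h j)
    rw [h1, h2]
    rfl
  -- The linearization in (t, c) is square, so nondegeneracy alone makes it surjective.
  have hDsurj := (LinearMap.injective_iff_surjective_of_finrank_eq_finrank hdim).1 hDinj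
  have hsurj : L.range = ⊤ := LinearMap.range_eq_top.2 fun w => by
    obtain ⟨y, B⟩ := w
    obtain ⟨⟨τ, c⟩, h⟩ := hDsurj (fun j => y j - B (F t₀ j))
    refine ⟨((τ, c), B), (hL' τ c B).trans (Prod.ext (funext fun j => ?_) rfl)⟩
    have h1 := (hD τ c j).symm.trans (congrFun h j)
    exact (congrArg (· + B (F t₀ j)) h1).trans (sub_add_cancel _ _)
  have hmap := hL.map_nhds_eq_of_surj hsurj
  have hV : {z : Ω | z.1.1 ∈ N ∧ 1 + z.1.2 ≠ 0} ∈ nhds z₀ := by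
    refine Filter.inter_mem ((continuous_fst.comp continuous_fst).continuousAt.preimage_mem_nhds hN)
      (ContinuousAt.eventually_ne (by fun_prop) ?_)
    simp [z₀]
  have himg := Filter.image_mem_map (m := fun z : Ω =>
    ((fun j => z.2 (F z.1.1 j + z.1.2 • E (F z.1.1 j)), z.2) : (ι → Y) × (X →L[ℂ] Y))) hV
  rw [hmap] at himg
  have hz : ((fun j => A₀ (F t₀ j + (0 : ℂ) • E (F t₀ j)), A₀) : (ι → Y) × (X →L[ℂ] Y)) =
      ((0 : ι → Y), A₀) := Prod.ext (funext fun j => by simp [h0]) rfl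
  have hcont : Filter.Tendsto (fun A : X →L[ℂ] Y => ((0 : ι → Y), A)) (nhds A₀)
      (nhds ((fun j => A₀ (F t₀ j + (0 : ℂ) • E (F t₀ j)), A₀) : (ι → Y) × (X →L[ℂ] Y))) := by
    rw [hz]
    exact (Continuous.prodMk_right (0 : ι → Y)).tendsto A₀
  filter_upwards [hcont himg] with A hA
  obtain ⟨z, hz1, hz2⟩ := hA
  obtain ⟨h1, h2⟩ := Prod.mk.inj hz2
  subst h2
  exact ⟨z.1.1, hz1.1, z.1.2, hz1.2, congrFun h1⟩

end Perturbation

/-! ### The dimension count for the kernel equation. -/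

section Recovery

variable {l m k a b : ℕ}

/-- The quotient by the plane of a point of the twistor space, up to isomorphism. -/
abbrev PlaneQuot (l m k : ℕ) : Type := Fin (l + m + 1 - k) → ℂ

theorem finrank_twistorModel (l m k : ℕ) :
    Module.finrank ℂ (TwistorModel l m k) = l + m + k * (l + m - k) := by
  have h1 : Module.finrank ℂ (BKModel l m) = l + m := by
    simp [Module.finrank_prod]
  have h2 : Module.finrank ℂ (GrSub k →L[ℂ] GrQuot (BKModel l m) k) = k * (l + m - k) := by
    rw [← (LinearMap.toContinuousLinearMap (𝕜 := ℂ) (E := GrSub k)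
      (F' := GrQuot (BKModel l m) k)).finrank_eq, Module.finrank_linearMap, Module.finrank_fin_fun,
      Module.finrank_fin_fun, h1]
  exact Module.finrank_prod.trans (congrArg₂ (· + ·) h1 h2)

/-- With n = l + m this is n + k(n - k) + 1 = (k + 1)(n + 1 - k): the coordinates of the frame plus
one scaling parameter match k + 1 vectors in the quotient by the plane. The bound on k keeps the
subtractions honest. -/
theorem finrank_twistorModel_prod (hk : k ≤ l + m) :
    Module.finrank ℝ (TwistorModel l m k × ℂ) =
      Module.finrank ℝ (Fin (k + 1) → PlaneQuot l m k) := by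
  have h1 := finrank_real_of_complex (TwistorModel l m k × ℂ)
  have h2 := finrank_real_of_complex (Fin (k + 1) → PlaneQuot l m k)
  have h3 : Module.finrank ℂ (TwistorModel l m k × ℂ) =
      Module.finrank ℂ (Fin (k + 1) → PlaneQuot l m k) := by
    rw [Module.finrank_prod, finrank_twistorModel,
      Module.finrank_self, Module.finrank_pi_fintype, Finset.sum_const, Finset.card_univ,
      Fintype.card_fin, Module.finrank_fin_fun, smul_eq_mul]
    obtain ⟨d, hd⟩ : ∃ d, l + m = k + d := ⟨l + m - k, by omega⟩
    have e1 : l + m - k = d := by omega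
    have e2 : l + m + 1 - k = d + 1 := by omega
    rw [e1, e2, hd]
    ring
  exact h1.trans ((congrArg (2 * ·) h3).trans h2.symm)

end Recovery

/-! ### A continuous family of equations with prescribed kernels. -/

section PlaneEquation

theorem ProjFrame.symm_smul_affinePart {E : Type*} [AddCommGroup E] [Module ℂ E] (S : ProjFrame E)
    {v : E} (hv : (S v).1 ≠ 0) (s : ℂ) :
    S.symm (s • ((1 : ℂ), affinePart (S v))) = (s * (S v).1⁻¹) • v := by
  refine S.injective ?_
  rw [S.apply_symm_apply, map_smul, affinePart]
  refine Prod.ext ?_ ?_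
  · simp [hv]
  · simp [smul_smul]

/-- `S⁻¹` on affine coordinates and `wedgeMap`, followed by the linear map `ρ`. -/
def wedgeEquation {E₁ E₂ X Y : Type*} {G : Type*} [AddCommGroup E₁] [Module ℂ E₁] [AddCommGroup E₂]
    [Module ℂ E₂] [NormedAddCommGroup X] [NormedSpace ℂ X] [FiniteDimensional ℂ X]
    [NormedAddCommGroup Y] [NormedSpace ℂ Y] [AddCommGroup G] [Module ℂ G]
    (μ : (E₁ × E₂) →ₗ[ℂ] X →ₗ[ℂ] G) (ρ : G →ₗ[ℂ] Y)
    (S₁ : ProjFrame E₁) (S₂ : ProjFrame E₂) :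
    ((ℂ × ProjModel E₁) × (ℂ × ProjModel E₂)) →ₗ[ℂ] X →L[ℂ] Y :=
  LinearMap.toContinuousLinearMap.toLinearMap ∘ₗ
    (μ.compr₂ ρ) ∘ₗ (S₁.symm.toLinearMap.prodMap S₂.symm.toLinearMap)

theorem continuous_wedgeEquation {E₁ E₂ X Y : Type*} {G : Type*} [AddCommGroup E₁] [Module ℂ E₁]
    [AddCommGroup E₂] [Module ℂ E₂] [NormedAddCommGroup X] [NormedSpace ℂ X]
    [FiniteDimensional ℂ X] [NormedAddCommGroup Y] [NormedSpace ℂ Y]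
    [AddCommGroup G] [Module ℂ G] (μ : (E₁ × E₂) →ₗ[ℂ] X →ₗ[ℂ] G) (ρ : G →ₗ[ℂ] Y)
    (S₁ : ProjFrame E₁) (S₂ : ProjFrame E₂) (s₁ s₂ : ℂ) :
    Continuous fun y : ProjModel E₁ × ProjModel E₂ =>
      wedgeEquation μ ρ S₁ S₂ (s₁ • (1, y.1), s₂ • (1, y.2)) :=
  (LinearMap.continuous_of_finiteDimensional _).comp (by fun_prop)

theorem wedgeEquation_apply {E₁ E₂ X Y : Type*} {G : Type*} [AddCommGroup E₁] [Module ℂ E₁]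
    [AddCommGroup E₂] [Module ℂ E₂] [NormedAddCommGroup X] [NormedSpace ℂ X]
    [FiniteDimensional ℂ X] [NormedAddCommGroup Y] [NormedSpace ℂ Y]
    [AddCommGroup G] [Module ℂ G] (μ : (E₁ × E₂) →ₗ[ℂ] X →ₗ[ℂ] G) (ρ : G →ₗ[ℂ] Y)
    (S₁ : ProjFrame E₁) (S₂ : ProjFrame E₂) {v₁ : E₁} {v₂ : E₂} (h₁ : (S₁ v₁).1 ≠ 0)
    (h₂ : (S₂ v₂).1 ≠ 0) (s₁ s₂ : ℂ) (x : X) :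
    wedgeEquation μ ρ S₁ S₂ (s₁ • (1, affinePart (S₁ v₁)), s₂ • (1, affinePart (S₂ v₂))) x =
      ρ (μ ((s₁ * (S₁ v₁).1⁻¹) • v₁, (s₂ * (S₂ v₂).1⁻¹) • v₂) x) :=
  congrArg₂ (fun w₁ w₂ => ρ (μ (w₁, w₂) x)) (S₁.symm_smul_affinePart h₁ s₁)
    (S₂.symm_smul_affinePart h₂ s₂)

theorem finrank_ker_of_surjective {X : Type*} [AddCommGroup X] [Module ℂ X] [FiniteDimensional ℂ X]
    {r q : ℕ} (hq : Module.finrank ℂ X = r + q) {A : X →ₗ[ℂ] Fin q → ℂ}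
    (hA : Function.Surjective A) : Module.finrank ℂ (LinearMap.ker A) = r := by
  have h1 := A.finrank_range_add_finrank_ker
  rw [LinearMap.range_eq_top.2 hA, finrank_top, Module.finrank_fin_fun] at h1
  omega

/-- A family of linear maps, continuous in affine coordinates, which has the same kernels as the maps
`μ (v₁, v₂)` up to rescaling `v₁` and `v₂`, as long as these have the generic dimension. -/
theorem exists_kernel_family {E₁ E₂ X : Type*} {G : Type*} [AddCommGroup E₁] [Module ℂ E₁]
    [AddCommGroup E₂] [Module ℂ E₂] [NormedAddCommGroup X] [NormedSpace ℂ X]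
    [FiniteDimensional ℂ X] [AddCommGroup G] [Module ℂ G]
    (S₁ : ProjFrame E₁) (S₂ : ProjFrame E₂) (μ : (E₁ × E₂) →ₗ[ℂ] X →ₗ[ℂ] G) {α : E₁} {β : E₂}
    (hα : (S₁ α).1 ≠ 0) (hβ : (S₂ β).1 ≠ 0) {P : Submodule ℂ X}
    (hP : LinearMap.ker (μ (α, β)) = P) {r q : ℕ} (hr : Module.finrank ℂ P = r)
    (hq : Module.finrank ℂ X = r + q) :
    ∃ Θ : ProjModel E₁ × ProjModel E₂ → X →L[ℂ] (Fin q → ℂ), Continuous Θ ∧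
      (∀ v, Θ (affinePart (S₁ α), affinePart (S₂ β)) v = 0 ↔ v ∈ P) ∧
      Function.Surjective (Θ (affinePart (S₁ α), affinePart (S₂ β))) ∧
      ∀ {v₁ : E₁} {v₂ : E₂}, (S₁ v₁).1 ≠ 0 → (S₂ v₂).1 ≠ 0 →
        Function.Surjective (Θ (affinePart (S₁ v₁), affinePart (S₂ v₂))) →
        ∃ c d : ℂ, c ≠ 0 ∧ d ≠ 0 ∧ ∀ {Q : Submodule ℂ X}, LinearMap.ker (μ (c • v₁, d • v₂)) = Q →
          Module.finrank ℂ Q = r →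
          ∀ v, Θ (affinePart (S₁ v₁), affinePart (S₂ v₂)) v = 0 → v ∈ Q := by
  -- ρ is chosen at the base point only; at other points the composite may have a larger kernel,
  -- which surjectivity rules out.
  obtain ⟨ρ, hρ1, hρ2⟩ := exists_comp_ker_eq (μ (α, β)) (q := q) (hP ▸ hr) hq
  have hval := fun v => wedgeEquation_apply μ ρ S₁ S₂ hα hβ (S₁ α).1 (S₂ β).1 v
  simp only [mul_inv_cancel₀ hα, mul_inv_cancel₀ hβ, one_smul] at hval
  refine ⟨fun y => wedgeEquation μ ρ S₁ S₂ ((S₁ α).1 • (1, y.1), (S₂ β).1 • (1, y.2)),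
    continuous_wedgeEquation μ ρ S₁ S₂ (S₁ α).1 (S₂ β).1, ?_, ?_, ?_⟩
  · intro v
    rw [← hP, ← hρ1]
    exact Eq.congr_left (hval v)
  · intro w
    obtain ⟨v, hv⟩ := hρ2 w
    exact ⟨v, (hval v).trans hv⟩
  · intro v₁ v₂ h1 h2 hsurj
    have hval' := fun v => wedgeEquation_apply μ ρ S₁ S₂ h1 h2 (S₁ α).1 (S₂ β).1 v
    refine ⟨_, _, mul_ne_zero hα (inv_ne_zero h1), mul_ne_zero hβ (inv_ne_zero h2), ?_⟩
    intro Q hQ hQr v hv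
    set ν := μ (((S₁ α).1 * (S₁ v₁).1⁻¹) • v₁, ((S₂ β).1 * (S₂ v₂).1⁻¹) • v₂) with hν
    have hle : LinearMap.ker ν ≤ LinearMap.ker (ρ ∘ₗ ν) := LinearMap.ker_le_ker_comp _ _
    have hsurj' : Function.Surjective (ρ ∘ₗ ν) := fun w => by
      obtain ⟨v, hv⟩ := hsurj w
      exact ⟨v, (hval' v).symm.trans hv⟩
    -- Both kernels have dimension r: one by assumption, the other by surjectivity of the composite.
    have heq := Submodule.eq_of_le_of_finrank_eq hle (by
      rw [hQ, hQr]
      exact (finrank_ker_of_surjective hq hsurj').symm)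
    rw [← hQ, heq]
    exact (hval' v).symm.trans hv

end PlaneEquation

/-! ### Nearby values of ψ come from nearby points. -/

section Recovery

variable {l m k a b : ℕ}

theorem ker_wedgeMap_smul (hab : a + b = k) {κ : BKTwistorSpace l m k}
    (hκ : κ ∈ twistorU l m k a b) {c d : ℂ} (hc : c ≠ 0) (hd : d ≠ 0) :
    LinearMap.ker (wedgeMap l m a b
      (c • BKTwistorSpace.phi (a + 1) b κ, d • BKTwistorSpace.phi a (b + 1) κ)) =
      (BKTwistorSpace.plane κ).map (diagMap l m d⁻¹ c⁻¹) := by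
  ext v
  rw [LinearMap.mem_ker, wedgeMap_apply, lambdaWedge_smul_smul, BKTwistorSpace.mem_plane_iff hab hκ]
  constructor
  · intro h
    exact ⟨_, h, by ext <;> simp [hc, hd]⟩
  · rintro ⟨w, hw, rfl⟩
    have : diagMap l m d c (diagMap l m d⁻¹ c⁻¹ w) = w := by
      ext <;> simp [hc, hd]
    rwa [this]

theorem finrank_map_diagMap {c d : ℂ} (hc : c ≠ 0) (hd : d ≠ 0)
    (P : Submodule ℂ (VSpace l × WSpace m)) :
    Module.finrank ℂ (P.map (diagMap l m c d)) = Module.finrank ℂ P :=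
  ((Submodule.equivMapOfInjective _ (diagMap_injective hc hd) P).finrank_eq).symm

theorem finrank_plane (κ : BKTwistorSpace l m k) :
    Module.finrank ℂ (BKTwistorSpace.plane κ) = k + 1 := by
  rw [BKTwistorSpace.plane, finrank_span_eq_card (BKTwistorSpace.linearIndependent_frame κ),
    Fintype.card_fin]

/-- Two points whose planes are spanned by frames that differ by `GL(1) × GL(1)` agree. -/
theorem eq_of_map_le_map_plane {p : BKSpace l m} {T : GrFrame (BKModel l m) k}
    {κ κ' : BKTwistorSpace l m k} (hκ' : κ'.base ∈ (extChartAt (bkI l m) p).source)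
    {Z : GrSub k →L[ℂ] GrQuot (BKModel l m) k} (hZ : κ'.coordFiber p = T.graph Z)
    {e c d : ℂ} (he : e ≠ 0) (hc : c ≠ 0) (hd : d ≠ 0)
    (h : ∀ j, diagMap l m e 1 (localFrame p T (extChartAt (bkI l m) p κ'.base, Z) j) ∈
      (BKTwistorSpace.plane κ).map (diagMap l m c d)) : κ = κ' := by
  obtain ⟨c', d', hc', hd', h1⟩ := span_localFrame κ' p T hκ' hZ
  have h2 : (BKTwistorSpace.plane κ').map (diagMap l m (e * c') (1 * d')) ≤
      (BKTwistorSpace.plane κ).map (diagMap l m c d) := by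
    rw [← map_diagMap_map, ← h1, Submodule.map_span, Submodule.span_le]
    rintro _ ⟨_, ⟨j, rfl⟩, rfl⟩
    exact h j
  have he' : e * c' ≠ 0 := mul_ne_zero he hc'
  have hd'' : 1 * d' ≠ 0 := by rwa [one_mul]
  have h3 := Submodule.eq_of_le_of_finrank_eq h2 (by
    rw [finrank_map_diagMap he' hd'', finrank_map_diagMap hc hd, finrank_plane, finrank_plane])
  have h4 := eq_map_diagMap_of_map_eq he' hd'' h3
  rw [map_diagMap_map] at h4
  exact BKTwistorSpace.eq_of_plane_eq_map κ κ' (mul_ne_zero (inv_ne_zero he') hc)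
    (mul_ne_zero (inv_ne_zero hd'') hd) h4

variable {S₁ : ProjFrame (LambdaVW l m (a + 1) b)} {S₂ : ProjFrame (LambdaVW l m a (b + 1))}

/-- A continuous family of linear maps which, at the affine coordinates of `ψ κ`, has the plane of `κ`
as its kernel up to `GL(1) × GL(1)`. -/
theorem exists_plane_family (hk : k ≤ l + m) (hab : a + b = k) {κ₀ : BKTwistorSpace l m k}
    (h₀ : BKTwistorSpace.center κ₀ ∈ localDomain S₁ S₂ κ₀.base κ₀.frameAt) :
    ∃ Θ : TargetModel l m a b → ((VSpace l × WSpace m) →L[ℂ] PlaneQuot l m k), Continuous Θ ∧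
      (∀ v, Θ (localPsi S₁ S₂ κ₀.base κ₀.frameAt (BKTwistorSpace.center κ₀)) v = 0 ↔
        v ∈ Submodule.span ℂ (range (BKTwistorSpace.coordFrame κ₀))) ∧
      Function.Surjective (Θ (localPsi S₁ S₂ κ₀.base κ₀.frameAt (BKTwistorSpace.center κ₀))) ∧
      ∀ κ ∈ twistorU l m k a b, (S₁ (BKTwistorSpace.phi (a + 1) b κ)).1 ≠ 0 →
        (S₂ (BKTwistorSpace.phi a (b + 1) κ)).1 ≠ 0 →
        Function.Surjective (Θ (affinePart (S₁ (BKTwistorSpace.phi (a + 1) b κ)),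
          affinePart (S₂ (BKTwistorSpace.phi a (b + 1) κ)))) →
        ∃ c d : ℂ, c ≠ 0 ∧ d ≠ 0 ∧ ∀ v,
          Θ (affinePart (S₁ (BKTwistorSpace.phi (a + 1) b κ)),
            affinePart (S₂ (BKTwistorSpace.phi a (b + 1) κ))) v = 0 →
          v ∈ (BKTwistorSpace.plane κ).map (diagMap l m c d) := by
  have hker : LinearMap.ker (wedgeMap l m a b
      (localPhi (a + 1) b κ₀.base κ₀.frameAt (BKTwistorSpace.center κ₀),
        localPhi a (b + 1) κ₀.base κ₀.frameAt (BKTwistorSpace.center κ₀))) =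
      Submodule.span ℂ (range (BKTwistorSpace.coordFrame κ₀)) := by
    ext v
    rw [LinearMap.mem_ker, wedgeMap_apply]
    exact lambdaWedge_eq_zero_iff (by omega) (BKTwistorSpace.linearIndependent_coordFrame κ₀)
      (S₁.ne_zero_of_fst_ne_zero h₀.2.1) (S₂.ne_zero_of_fst_ne_zero h₀.2.2) v
  have hr : Module.finrank ℂ (Submodule.span ℂ (range (BKTwistorSpace.coordFrame κ₀))) = k + 1 := by
    rw [finrank_span_eq_card (BKTwistorSpace.linearIndependent_coordFrame κ₀), Fintype.card_fin]
  have hq : Module.finrank ℂ (VSpace l × WSpace m) = (k + 1) + (l + m + 1 - k) := by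
    rw [Module.finrank_prod, Module.finrank_fin_fun, Module.finrank_fin_fun]
    omega
  have h := exists_kernel_family (X := VSpace l × WSpace m) (G := LambdaVW l m (a + 1) (b + 1))
    S₁ S₂ (wedgeMap l m a b) h₀.2.1 h₀.2.2 hker hr hq
  obtain ⟨Θ, hΘ, h1, h2, h3⟩ := h
  refine ⟨Θ, hΘ, h1, h2, fun κ hκ hs₁ hs₂ hsurj => ?_⟩
  obtain ⟨c, d, hc, hd, h4⟩ := h3 hs₁ hs₂ hsurj
  refine ⟨d⁻¹, c⁻¹, inv_ne_zero hd, inv_ne_zero hc, h4 (ker_wedgeMap_smul hab hκ hc hd) ?_⟩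
  rw [finrank_map_diagMap (inv_ne_zero hd) (inv_ne_zero hc), finrank_plane]

/-- Points whose image under `ψ` is close to that of `κ₀` are close to `κ₀`. -/
theorem eventually_mem_of_localPsi (hk : k ≤ l + m) (hab : a + b = k) {κ₀ : BKTwistorSpace l m k}
    (h₀ : BKTwistorSpace.center κ₀ ∈ localDomain S₁ S₂ κ₀.base κ₀.frameAt)
    {N : Set (TwistorModel l m k)} (hN : N ∈ nhds (BKTwistorSpace.center κ₀))
    (hN' : N ⊆ (GrassmannBundle.chart κ₀ κ₀.frameAt).target) :
    ∀ᶠ y in nhds (localPsi S₁ S₂ κ₀.base κ₀.frameAt (BKTwistorSpace.center κ₀)),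
      ∀ κ ∈ twistorU l m k a b, (S₁ (BKTwistorSpace.phi (a + 1) b κ)).1 ≠ 0 →
        (S₂ (BKTwistorSpace.phi a (b + 1) κ)).1 ≠ 0 →
        (affinePart (S₁ (BKTwistorSpace.phi (a + 1) b κ)),
          affinePart (S₂ (BKTwistorSpace.phi a (b + 1) κ))) = y →
        ∃ t ∈ N, κ = (GrassmannBundle.chart κ₀ κ₀.frameAt).symm t := by
  obtain ⟨Θ, hΘ, h1, h2, h3⟩ := exists_plane_family hk hab h₀
  have hF : HasStrictFDerivAt (localFrame κ₀.base κ₀.frameAt) (BKTwistorSpace.frameDeriv κ₀)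
      (BKTwistorSpace.center κ₀) :=
    (contDiffAt_localFrame κ₀.base κ₀.frameAt (t := BKTwistorSpace.center κ₀)
      (BKTwistorSpace.coord_pos κ₀) 1).hasStrictFDerivAt one_ne_zero
  -- One parameter suffices for GL(1) × GL(1): overall scalars preserve a plane, so only diag(1 + c,
  -- 1) is needed. In the nondegeneracy condition the second diagonal coefficient is 0, hence c = 0
  -- as well.
  have h4 := eventually_exists_solution hF (LinearMap.toContinuousLinearMap (diagMap l m 1 0))
    (Θ (localPsi S₁ S₂ κ₀.base κ₀.frameAt (BKTwistorSpace.center κ₀)))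
    (fun j => (h1 _).2 (Submodule.subset_span ⟨j, rfl⟩))
    (fun τ c h => BKTwistorSpace.eq_zero_of_frameDeriv_mem κ₀ (c := c) (d := 0) fun j => by
      have h5 := (h1 _).1 (h j)
      have h6 : diagMap l m c 0 (BKTwistorSpace.coordFrame κ₀ j) =
          c • diagMap l m 1 0 (BKTwistorSpace.coordFrame κ₀ j) := by
        ext <;> simp
      rw [h6]
      exact h5)
    (finrank_twistorModel_prod hk) hN
  filter_upwards [hΘ.continuousAt.eventually h4, hΘ.continuousAt.eventually
    (eventually_surjective _ h2)] with y hy1 hy2 κ hκ hs₁ hs₂ hyκ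
  subst hyκ
  obtain ⟨t, ht, e, he, h5⟩ := hy1
  obtain ⟨c, d, hc, hd, h6⟩ := h3 κ hκ hs₁ hs₂ hy2
  refine ⟨t, ht, ?_⟩
  have h7 := (GrassmannBundle.chart κ₀ κ₀.frameAt).map_target (hN' ht)
  have h8 := (GrassmannBundle.chart κ₀ κ₀.frameAt).right_inv (hN' ht)
  set κ' := (GrassmannBundle.chart κ₀ κ₀.frameAt).symm t
  obtain ⟨h9, Z, hZ⟩ := h7
  have h10 : (extChartAt (bkI l m) κ₀.base κ'.base, Z) = t := by
    rw [← h8, ← GrassmannBundle.slope_eq hZ]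
    rfl
  refine eq_of_map_le_map_plane h9 hZ he hc hd fun j => ?_
  rw [h10]
  refine h6 _ ?_
  -- The solution says that the frame at t, moved by diag(1 + e, 1), lies in the kernel, that is, in
  -- the plane of κ up to a diagonal map.
  have h11 : diagMap l m (1 + e) 1 (localFrame κ₀.base κ₀.frameAt t j) =
      localFrame κ₀.base κ₀.frameAt t j + e • diagMap l m 1 0 (localFrame κ₀.base κ₀.frameAt t j) := by
    ext <;> simp [add_mul]
  rw [h11]
  exact h5 j

end Recovery

/-! ### Inverse function theorem and charts built from it. -/

section InverseFunction

/-- A complex linear map which is bijective on the image of an injective real linear map, if this image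
is a complex subspace. -/
theorem exists_bijective_comp {T Y : Type*} [NormedAddCommGroup T] [NormedSpace ℂ T]
    [FiniteDimensional ℂ T] [NormedAddCommGroup Y] [NormedSpace ℂ Y] [FiniteDimensional ℂ Y]
    (L : T →L[ℝ] Y) (hL : Function.Injective L) (J : T → T) (hJ : ∀ τ, L (J τ) = Complex.I • L τ) :
    ∃ Λ : Y →L[ℂ] T, Function.Bijective fun τ => Λ (L τ) := by
  have : FiniteDimensional ℝ T := FiniteDimensional.complexToReal T
  have : FiniteDimensional ℝ Y := FiniteDimensional.complexToReal Y
  -- The range is closed under √-1 because √-1 Lτ = L(Jτ); it then has the same complex dimension as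
  -- T.
  let R : Submodule ℂ Y :=
    { carrier := range L
      add_mem' := by
        rintro _ _ ⟨s, rfl⟩ ⟨t, rfl⟩
        exact ⟨s + t, map_add _ _ _⟩
      zero_mem' := ⟨0, map_zero _⟩
      smul_mem' := by
        rintro c _ ⟨t, rfl⟩
        refine ⟨c.re • t + c.im • J t, ?_⟩
        rw [map_add, map_smul, map_smul, hJ]
        conv_rhs => rw [← Complex.re_add_im c, add_smul, mul_smul]
        simp }
  let e₀ : T ≃ₗ[ℝ] R := LinearEquiv.ofBijective
    ({ toFun := fun t => ⟨L t, t, rfl⟩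
       map_add' := fun s t => Subtype.ext (map_add L s t)
       map_smul' := fun c t => Subtype.ext (map_smul L c t) } : T →ₗ[ℝ] R)
    ⟨fun s t h => hL (Subtype.ext_iff.1 h), by
      rintro ⟨_, t, rfl⟩
      exact ⟨t, rfl⟩⟩
  have hdim : Module.finrank ℂ R = Module.finrank ℂ T := by
    have h1 := e₀.finrank_eq
    have h2 := finrank_real_of_complex T
    have h3 := finrank_real_of_complex R
    omega
  let e : R ≃ₗ[ℂ] T := LinearEquiv.ofFinrankEq _ _ hdim
  obtain ⟨Λ, hΛ⟩ := LinearMap.exists_extend e.toLinearMap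
  refine ⟨LinearMap.toContinuousLinearMap Λ, ?_⟩
  have h : (fun τ => (LinearMap.toContinuousLinearMap Λ) (L τ)) = e ∘ e₀ :=
    funext fun τ => LinearMap.congr_fun hΛ (e₀ τ)
  rw [h]
  exact e.bijective.comp e₀.bijective

/-- The inverse function theorem, with a local inverse which is smooth on its domain. -/
theorem exists_smooth_localInverse {T : Type*} [NormedAddCommGroup T] [NormedSpace ℝ T]
    [FiniteDimensional ℝ T] {F : T → T} {D : Set T} (hD : IsOpen D) {t₀ : T} (ht₀ : t₀ ∈ D)
    (hF : ∀ t ∈ D, ContDiffAt ℝ ∞ F t) (hF' : Function.Bijective (fderiv ℝ F t₀)) :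
    ∃ e : OpenPartialHomeomorph T T, t₀ ∈ e.source ∧ e.source ⊆ D ∧ (∀ t, e t = F t) ∧
      ContDiffOn ℝ ∞ e e.source ∧ ContDiffOn ℝ ∞ e.symm e.target := by
  have : CompleteSpace T := FiniteDimensional.complete ℝ T
  let A : T ≃L[ℝ] T := (LinearEquiv.ofBijective (fderiv ℝ F t₀).toLinearMap hF').toContinuousLinearEquiv
  have hA : HasFDerivAt F (A : T →L[ℝ] T) t₀ :=
    ((hF t₀ ht₀).differentiableAt (by simp)).hasFDerivAt
  let e₁ := (hF t₀ ht₀).toOpenPartialHomeomorph F hA (by simp)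
  have hcont : ∀ t ∈ D, ContinuousAt (fderiv ℝ F) t := fun t ht =>
    ((hF t ht).fderiv_right (m := 0) (by simp)).continuousAt
  -- Restricting to invertible derivatives makes the inverse smooth on its whole domain, not just
  -- near one point.
  have hU : IsOpen {t | t ∈ D ∧ IsUnit (fderiv ℝ F t)} := by
    rw [isOpen_iff_mem_nhds]
    intro t ht
    exact Filter.inter_mem (hD.mem_nhds ht.1)
      ((hcont t ht.1).preimage_mem_nhds (Units.isOpen.mem_nhds ht.2))
  have he : ∀ t, e₁ t = F t := fun t => rfl
  let e := e₁.restrOpen _ hU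
  have hs : ∀ {t}, t ∈ e.source → t ∈ D ∧ IsUnit (fderiv ℝ F t) := fun {t} ht => ht.2
  refine ⟨e, ⟨(hF t₀ ht₀).mem_toOpenPartialHomeomorph_source hA (by simp), ht₀, ?_⟩,
    fun t ht => (hs ht).1, he, fun t ht => (hF t (hs ht).1).contDiffWithinAt, fun u hu => ?_⟩
  · rw [ContinuousLinearMap.isUnit_iff_bijective]
    exact hF'
  · have h1 := hs (e.map_target hu)
    have h2 := (ContinuousLinearMap.isUnit_iff_bijective).1 h1.2
    let B : T ≃L[ℝ] T :=
      (LinearEquiv.ofBijective (fderiv ℝ F (e.symm u)).toLinearMap h2).toContinuousLinearEquiv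
    have hB : HasFDerivAt e (B : T →L[ℝ] T) (e.symm u) :=
      ((hF _ h1.1).differentiableAt (by simp)).hasFDerivAt
    exact (e.contDiffAt_symm hu hB (hF _ h1.1)).contDiffWithinAt

theorem trans_mem_maximalAtlas {T Z : Type*} [NormedAddCommGroup T] [NormedSpace ℝ T]
    [TopologicalSpace Z] [ChartedSpace T Z] [IsManifold 𝓘(ℝ, T) ∞ Z] (z : Z)
    {e : OpenPartialHomeomorph T T} (h : ContDiffOn ℝ ∞ e e.source)
    (h' : ContDiffOn ℝ ∞ e.symm e.target) :
    (chartAt T z).trans e ∈ IsManifold.maximalAtlas 𝓘(ℝ, T) ∞ Z := by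
  apply OpenPartialHomeomorph.mem_maximalAtlas_of_contMDiffOn
  · exact h.contMDiffOn.comp ((contMDiffOn_chart (x := z)).mono fun x hx => hx.1)
      fun x hx => hx.2
  · exact (contMDiffOn_chart_symm (x := z)).comp (h'.contMDiffOn.mono fun x hx => hx.1)
      fun x hx => hx.2

end InverseFunction

/-! ### Openness of U_{a,b} and the topological embedding. -/

section TwistorCharts

variable {l m k a b : ℕ}

theorem chart_self (κ : BKTwistorSpace l m k) :
    GrassmannBundle.chart κ κ.frameAt κ = BKTwistorSpace.center κ :=
  Prod.ext rfl (BKTwistorSpace.slope_frameAt κ)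

theorem mem_source_self (κ : BKTwistorSpace l m k) :
    κ ∈ (GrassmannBundle.chart κ κ.frameAt).source :=
  mem_chart_source (TwistorModel l m k) κ

theorem ProjFrame.projFrameAt_mk {E : Type*} [AddCommGroup E] [Module ℂ E] [FiniteDimensional ℂ E]
    {v : E} (hv : v ≠ 0) : (projFrameAt (Projectivization.mk ℂ v hv) v).1 ≠ 0 :=
  (ProjFrame.mk_mem_source _ hv).1 (projFrameAt_spec _)

variable {S₁ : ProjFrame (LambdaVW l m (a + 1) b)} {S₂ : ProjFrame (LambdaVW l m a (b + 1))}

theorem mem_twistorU_of_mem_localDomain {κ κ' : BKTwistorSpace l m k}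
    (h : κ' ∈ (GrassmannBundle.chart κ κ.frameAt).source)
    (h' : GrassmannBundle.chart κ κ.frameAt κ' ∈ localDomain S₁ S₂ κ.base κ.frameAt) :
    κ' ∈ twistorU l m k a b ∧ (S₁ (BKTwistorSpace.phi (a + 1) b κ')).1 ≠ 0 ∧
      (S₂ (BKTwistorSpace.phi a (b + 1) κ')).1 ≠ 0 := by
  obtain ⟨C₁, hC₁, h1⟩ := exists_localPhi_eq_smul κ' κ.base κ.frameAt h (a + 1) b
  obtain ⟨C₂, hC₂, h2⟩ := exists_localPhi_eq_smul κ' κ.base κ.frameAt h a (b + 1)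
  have h3 := (S₁.fst_ne_zero hC₁ h1).1 h'.2.1
  have h4 := (S₂.fst_ne_zero hC₂ h2).1 h'.2.2
  exact ⟨⟨S₁.ne_zero_of_fst_ne_zero h3, S₂.ne_zero_of_fst_ne_zero h4⟩, h3, h4⟩

theorem chart_mem_localDomain {κ : BKTwistorSpace l m k}
    (h₁ : (S₁ (BKTwistorSpace.phi (a + 1) b κ)).1 ≠ 0)
    (h₂ : (S₂ (BKTwistorSpace.phi a (b + 1) κ)).1 ≠ 0) :
    GrassmannBundle.chart κ κ.frameAt κ ∈ localDomain S₁ S₂ κ.base κ.frameAt := by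
  rw [chart_self]
  exact center_mem_localDomain h₁ h₂

theorem isOpen_chart_preimage (κ : BKTwistorSpace l m k) {D : Set (TwistorModel l m k)}
    (hD : IsOpen D) : IsOpen {κ' | κ' ∈ (GrassmannBundle.chart κ κ.frameAt).source ∧
      GrassmannBundle.chart κ κ.frameAt κ' ∈ D} :=
  (chartAt (TwistorModel l m k) κ).isOpen_inter_preimage hD

theorem isOpen_twistorU (l m k a b : ℕ) : IsOpen (twistorU l m k a b) := by
  rw [isOpen_iff_mem_nhds]
  intro κ hκ
  refine Filter.mem_of_superset ((isOpen_chart_preimage κ (isOpen_localDomain (S₁ := projFrameAt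
    (Projectivization.mk ℂ _ hκ.1)) (S₂ := projFrameAt (Projectivization.mk ℂ _ hκ.2)) κ.base
      κ.frameAt)).mem_nhds ⟨mem_source_self κ, ?_⟩)
    fun κ' h => (mem_twistorU_of_mem_localDomain h.1 h.2).1
  exact chart_mem_localDomain (ProjFrame.projFrameAt_mk hκ.1) (ProjFrame.projFrameAt_mk hκ.2)

/-- `U_{a,b}` as an open submanifold. -/
abbrev twistorOpens (l m k a b : ℕ) : TopologicalSpace.Opens (BKTwistorSpace l m k) :=
  ⟨twistorU l m k a b, isOpen_twistorU l m k a b⟩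

/-- `ψ_{a,b}` on the open submanifold `U_{a,b}`. -/
abbrev psi (l m k a b : ℕ) : twistorOpens l m k a b →
    ℙ ℂ (LambdaVW l m (a + 1) b) × ℙ ℂ (LambdaVW l m a (b + 1)) :=
  twistorPsi l m k a b

/-- The preferred affine coordinates at the first component of `ψ κ`. -/
def frame₁ (κ : twistorOpens l m k a b) : ProjFrame (LambdaVW l m (a + 1) b) :=
  projFrameAt (psi l m k a b κ).1

/-- The preferred affine coordinates at the second component of `ψ κ`. -/
def frame₂ (κ : twistorOpens l m k a b) : ProjFrame (LambdaVW l m a (b + 1)) :=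
  projFrameAt (psi l m k a b κ).2

/-- `ψ` in the preferred charts at `κ` and `ψ κ`. -/
def chartPsi (κ : twistorOpens l m k a b) : TwistorModel l m k → TargetModel l m a b :=
  localPsi (frame₁ κ) (frame₂ κ) κ.1.base κ.1.frameAt

/-- The domain of `chartPsi`. -/
def chartDomain (κ : twistorOpens l m k a b) : Set (TwistorModel l m k) :=
  localDomain (frame₁ κ) (frame₂ κ) κ.1.base κ.1.frameAt

theorem center_mem_chartDomain (κ : twistorOpens l m k a b) :
    BKTwistorSpace.center κ.1 ∈ chartDomain κ :=
  center_mem_localDomain (ProjFrame.projFrameAt_mk κ.2.1) (ProjFrame.projFrameAt_mk κ.2.2)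

theorem chartPsi_chart (κ κ' : twistorOpens l m k a b)
    (h : κ'.1 ∈ (GrassmannBundle.chart κ.1 κ.1.frameAt).source) :
    chartPsi κ (GrassmannBundle.chart κ.1 κ.1.frameAt κ'.1) =
      chartAt (ModelProd (ProjModel (LambdaVW l m (a + 1) b)) (ProjModel (LambdaVW l m a (b + 1))))
        (psi l m k a b κ) (psi l m k a b κ') :=
  localPsi_eq (frame₁ κ) (frame₂ κ) κ.1.base κ.1.frameAt κ' h

theorem psi_mem_source (κ κ' : twistorOpens l m k a b)
    (h : κ'.1 ∈ (GrassmannBundle.chart κ.1 κ.1.frameAt).source)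
    (h' : GrassmannBundle.chart κ.1 κ.1.frameAt κ'.1 ∈ chartDomain κ) :
    psi l m k a b κ' ∈ (chartAt (ModelProd (ProjModel (LambdaVW l m (a + 1) b))
      (ProjModel (LambdaVW l m a (b + 1)))) (psi l m k a b κ)).source := by
  obtain ⟨-, h1, h2⟩ := mem_twistorU_of_mem_localDomain h h'
  exact ⟨(ProjFrame.mk_mem_source _ κ'.2.1).2 h1, (ProjFrame.mk_mem_source _ κ'.2.2).2 h2⟩

theorem eventually_chart (κ : twistorOpens l m k a b) :
    ∀ᶠ κ' in nhds κ, κ'.1 ∈ (GrassmannBundle.chart κ.1 κ.1.frameAt).source ∧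
      GrassmannBundle.chart κ.1 κ.1.frameAt κ'.1 ∈ chartDomain κ :=
  continuous_subtype_val.continuousAt.eventually ((isOpen_chart_preimage κ.1
    (isOpen_localDomain κ.1.base κ.1.frameAt)).mem_nhds ⟨mem_source_self κ.1, by
      rw [chart_self]
      exact center_mem_chartDomain κ⟩)

theorem contDiffAt_chartPsi (κ : twistorOpens l m k a b) {t : TwistorModel l m k}
    (ht : t ∈ chartDomain κ) (n : ℕ∞ω) : ContDiffAt ℝ n (chartPsi κ) t :=
  contDiffAt_localPsi ht n

theorem continuousAt_psi (κ : twistorOpens l m k a b) : ContinuousAt (psi l m k a b) κ := by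
  set e := chartAt (ModelProd (ProjModel (LambdaVW l m (a + 1) b))
    (ProjModel (LambdaVW l m a (b + 1)))) (psi l m k a b κ) with he
  have h1 : ContinuousAt (fun κ' : twistorOpens l m k a b =>
      GrassmannBundle.chart κ.1 κ.1.frameAt κ'.1) κ :=
    ContinuousAt.comp (g := chartAt (TwistorModel l m k) κ.1)
      ((chartAt (TwistorModel l m k) κ.1).continuousAt (mem_chart_source _ κ.1))
      continuous_subtype_val.continuousAt
  have h2 : ContinuousAt (chartPsi κ) (GrassmannBundle.chart κ.1 κ.1.frameAt κ.1) := by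
    rw [chart_self]
    exact (contDiffAt_chartPsi κ (center_mem_chartDomain κ) 0).continuousAt
  have h3 : chartPsi κ (GrassmannBundle.chart κ.1 κ.1.frameAt κ.1) = e (psi l m k a b κ) :=
    chartPsi_chart κ κ (mem_source_self κ.1)
  have h4 : ContinuousAt e.symm (chartPsi κ (GrassmannBundle.chart κ.1 κ.1.frameAt κ.1)) := by
    rw [h3]
    exact e.continuousAt_symm (e.map_source (mem_chart_source _ _))
  have h5 : ContinuousAt (fun κ' : twistorOpens l m k a b =>
      e.symm (chartPsi κ (GrassmannBundle.chart κ.1 κ.1.frameAt κ'.1))) κ :=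
    ContinuousAt.comp (g := e.symm) h4 (ContinuousAt.comp (g := chartPsi κ) h2 h1)
  refine h5.congr ?_
  filter_upwards [eventually_chart κ] with κ' h
  rw [chartPsi_chart κ κ' h.1]
  exact e.left_inv (psi_mem_source κ κ' h.1 h.2)

/-- Continuity gives one inclusion of neighbourhood filters. For the other,
`eventually_mem_of_localPsi` places every point with image near ψ(κ) in a prescribed neighbourhood
of κ, without first restricting to a chart of the source. -/
theorem isEmbedding_psi (hk : k ≤ l + m) (hab : a + b = k) :
    Topology.IsEmbedding (psi l m k a b) := by
  refine ⟨Topology.isInducing_iff_nhds.2 fun κ => le_antisymm (continuousAt_psi κ).le_comap ?_,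
    injective_twistorPsi a b hab⟩
  intro N hN
  set e := chartAt (ModelProd (ProjModel (LambdaVW l m (a + 1) b))
    (ProjModel (LambdaVW l m a (b + 1)))) (psi l m k a b κ) with he
  obtain ⟨N', hN', hN'N⟩ := mem_nhds_subtype _ _ _ |>.1 hN
  let e₀ := chartAt (TwistorModel l m k) κ.1
  have h0 : e₀ κ.1 = BKTwistorSpace.center κ.1 := chart_self κ.1
  have h1 : e₀.target ∩ e₀.symm ⁻¹' N' ∈ nhds (BKTwistorSpace.center κ.1) := by
    rw [← h0]
    refine Filter.inter_mem (e₀.open_target.mem_nhds (e₀.map_source (mem_chart_source _ _)))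
      ((e₀.continuousAt_symm (e₀.map_source (mem_chart_source _ _))).preimage_mem_nhds ?_)
    rw [e₀.left_inv (mem_chart_source _ _)]
    exact hN'
  have h2 := eventually_mem_of_localPsi hk hab (center_mem_chartDomain κ) h1 inter_subset_left
  have h3 : chartPsi κ (BKTwistorSpace.center κ.1) = e (psi l m k a b κ) := by
    rw [← chart_self]
    exact chartPsi_chart κ κ (mem_source_self κ.1)
  have h4 : Filter.Tendsto e (nhds (psi l m k a b κ))
      (nhds (chartPsi κ (BKTwistorSpace.center κ.1))) := by
    rw [h3]
    exact e.continuousAt (mem_chart_source _ _)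
  refine Filter.mem_comap.2 ⟨_, Filter.inter_mem (e.open_source.mem_nhds (mem_chart_source _ _))
    (h4.eventually h2), ?_⟩
  rintro κ' ⟨h5, h6⟩
  have h7 := (ProjFrame.mk_mem_source (frame₁ κ) κ'.2.1).1 h5.1
  have h8 := (ProjFrame.mk_mem_source (frame₂ κ) κ'.2.2).1 h5.2
  obtain ⟨t, ht, h9⟩ := h6 κ'.1 κ'.2 h7 h8 (Prod.ext
    (ProjFrame.chart_mk (frame₁ κ) κ'.2.1).symm (ProjFrame.chart_mk (frame₂ κ) κ'.2.2).symm)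
  apply hN'N
  change κ'.1 ∈ N'
  rw [h9]
  exact ht.2

end TwistorCharts

theorem mfderiv_eq_fderiv {E E' M M' H' : Type*} [NormedAddCommGroup E] [NormedSpace ℝ E]
    [NormedAddCommGroup E'] [NormedSpace ℝ E'] [TopologicalSpace M] [ChartedSpace E M]
    [TopologicalSpace H'] [TopologicalSpace M'] [ChartedSpace H' M']
    {I' : ModelWithCorners ℝ E' H'} {f : M → M'} {x : M} {t : E} {F : E → E'}
    (hf : MDifferentiableAt 𝓘(ℝ, E) I' f x) (ht : extChartAt 𝓘(ℝ, E) x x = t)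
    (hF : writtenInExtChartAt 𝓘(ℝ, E) I' x f =ᶠ[nhds t] F) :
    (mfderiv 𝓘(ℝ, E) I' f x : E →L[ℝ] E') = fderiv ℝ F t := by
  have h : fderivWithin ℝ (writtenInExtChartAt 𝓘(ℝ, E) I' x f) (range 𝓘(ℝ, E))
      (extChartAt 𝓘(ℝ, E) x x) = fderiv ℝ F t := by
    rw [modelWithCornersSelf_coe, range_id, fderivWithin_univ, ht, hF.fderiv_eq]
  exact hf.mfderiv.trans h

/-! ### The manifold derivative of ψ. -/

section Derivative

variable {l m k a b : ℕ}

variable (l m k) in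
/-- The real model of the twistor space. -/
abbrev twistorI := 𝓘(ℝ, TwistorModel l m k)

variable (l m a b) in
/-- The real model of `P(Λ^{a+1} V ⊗ Λ^b W) × P(Λ^a V ⊗ Λ^{b+1} W)`. -/
abbrev targetI := (𝓘(ℝ, ProjModel (LambdaVW l m (a + 1) b))).prod
  𝓘(ℝ, ProjModel (LambdaVW l m a (b + 1)))

theorem extChartAt_twistorOpens (κ κ' : twistorOpens l m k a b) :
    extChartAt (twistorI l m k) κ κ' = GrassmannBundle.chart κ.1 κ.1.frameAt κ'.1 := rfl

theorem mem_extChartAt_twistorOpens (κ κ' : twistorOpens l m k a b)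
    (h : κ' ∈ (extChartAt (twistorI l m k) κ).source) :
    κ'.1 ∈ (GrassmannBundle.chart κ.1 κ.1.frameAt).source := by
  rw [extChartAt_source, TopologicalSpace.Opens.chartAt_eq,
    OpenPartialHomeomorph.subtypeRestr_source] at h
  exact h

theorem extChartAt_twistorOpens_self (κ : twistorOpens l m k a b) :
    extChartAt (twistorI l m k) κ κ = BKTwistorSpace.center κ.1 := chart_self κ.1

theorem writtenInExtChartAt_psi (κ : twistorOpens l m k a b) :
    writtenInExtChartAt (twistorI l m k) (targetI l m a b) κ (psi l m k a b) =ᶠ[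
      nhds (BKTwistorSpace.center κ.1)] chartPsi κ := by
  have h := extChartAt_target_mem_nhds (I := twistorI l m k) κ
  rw [extChartAt_twistorOpens_self] at h
  filter_upwards [h] with t ht
  have h1 := (extChartAt (twistorI l m k) κ).right_inv ht
  have h2 := mem_extChartAt_twistorOpens κ _ ((extChartAt (twistorI l m k) κ).map_target ht)
  rw [extChartAt_twistorOpens] at h1
  exact (chartPsi_chart κ _ h2).symm.trans (congrArg (chartPsi κ) h1)

theorem contMDiff_psi : ContMDiff (twistorI l m k) (targetI l m a b) ∞ (psi l m k a b) := by
  intro κ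
  rw [contMDiffAt_iff]
  refine ⟨continuousAt_psi κ, ContDiffAt.contDiffWithinAt ?_⟩
  rw [extChartAt_twistorOpens_self]
  exact (contDiffAt_chartPsi κ (center_mem_chartDomain κ) ∞).congr_of_eventuallyEq
    (writtenInExtChartAt_psi κ)

theorem mfderiv_psi (κ : twistorOpens l m k a b) :
    (mfderiv (twistorI l m k) (targetI l m a b) (psi l m k a b) κ :
      TwistorModel l m k →L[ℝ] TargetModel l m a b) =
      fderiv ℝ (chartPsi κ) (BKTwistorSpace.center κ.1) :=
  mfderiv_eq_fderiv ((contMDiff_psi κ).mdifferentiableAt (by simp))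
    (extChartAt_twistorOpens_self κ) (writtenInExtChartAt_psi κ)

theorem injective_fderiv_chartPsi (hab : a + b = k) (κ : twistorOpens l m k a b) :
    Function.Injective (fderiv ℝ (chartPsi κ) (BKTwistorSpace.center κ.1)) :=
  (fderiv_localPsi hab (center_mem_chartDomain κ)).1

theorem fderiv_chartPsi_twistorJ (hab : a + b = k) (κ : twistorOpens l m k a b)
    (τ : TwistorModel l m k) :
    fderiv ℝ (chartPsi κ) (BKTwistorSpace.center κ.1) (κ.1.twistorJ bkPotential τ) =
      Complex.I • fderiv ℝ (chartPsi κ) (BKTwistorSpace.center κ.1) τ :=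
  (fderiv_localPsi hab (center_mem_chartDomain κ)).2 τ

theorem injective_mfderiv_psi (hab : a + b = k) (κ : twistorOpens l m k a b) :
    let dψ : TwistorModel l m k →L[ℝ] TargetModel l m a b :=
      mfderiv (twistorI l m k) (targetI l m a b) (psi l m k a b) κ
    Function.Injective dψ := by
  intro dψ
  have h : dψ = fderiv ℝ (chartPsi κ) (BKTwistorSpace.center κ.1) := mfderiv_psi κ
  rw [h]
  exact injective_fderiv_chartPsi hab κ

theorem mfderiv_psi_twistorJ (hab : a + b = k) (κ : twistorOpens l m k a b)
    (τ : TwistorModel l m k) :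
    let dψ : TwistorModel l m k →L[ℝ] TargetModel l m a b :=
      mfderiv (twistorI l m k) (targetI l m a b) (psi l m k a b) κ
    dψ (κ.1.twistorJ bkPotential τ) = Complex.I • dψ τ := by
  intro dψ
  have h : dψ = fderiv ℝ (chartPsi κ) (BKTwistorSpace.center κ.1) := mfderiv_psi κ
  rw [h]
  exact fderiv_chartPsi_twistorJ hab κ τ

end Derivative

/-! ### Local holomorphic coordinates. -/

section HolomorphicChart

variable {l m k a b : ℕ}

/-- A linear combination of the affine coordinates of `ψ` at `ψ κ₀`. -/
def holCoord (Λ : TargetModel l m a b →L[ℂ] TwistorModel l m k) (κ₀ : twistorOpens l m k a b)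
    (w : ℙ ℂ (LambdaVW l m (a + 1) b) × ℙ ℂ (LambdaVW l m a (b + 1))) : TwistorModel l m k :=
  Λ ((frame₁ κ₀).chart w.1, (frame₂ κ₀).chart w.2)

theorem mdifferentiableOn_holCoord (Λ : TargetModel l m a b →L[ℂ] TwistorModel l m k)
    (κ₀ : twistorOpens l m k a b) :
    MDifferentiableOn ((𝓘(ℂ, ProjModel (LambdaVW l m (a + 1) b))).prod
      𝓘(ℂ, ProjModel (LambdaVW l m a (b + 1)))) 𝓘(ℂ, TwistorModel l m k) (holCoord Λ κ₀)
      (chartAt (ModelProd (ProjModel (LambdaVW l m (a + 1) b))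
        (ProjModel (LambdaVW l m a (b + 1)))) (psi l m k a b κ₀)).source := by
  have h1 : ContMDiffOn ((𝓘(ℂ, ProjModel (LambdaVW l m (a + 1) b))).prod
      𝓘(ℂ, ProjModel (LambdaVW l m a (b + 1)))) 𝓘(ℂ, TargetModel l m a b) ω
      (extChartAt ((𝓘(ℂ, ProjModel (LambdaVW l m (a + 1) b))).prod
        𝓘(ℂ, ProjModel (LambdaVW l m a (b + 1)))) (psi l m k a b κ₀))
      (chartAt (ModelProd (ProjModel (LambdaVW l m (a + 1) b))
        (ProjModel (LambdaVW l m a (b + 1)))) (psi l m k a b κ₀)).source :=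
    contMDiffOn_extChartAt
  exact ((Λ.contMDiff (n := 1)).comp_contMDiffOn (h1.of_le le_top)).mdifferentiableOn one_ne_zero

theorem holCoord_psi (Λ : TargetModel l m a b →L[ℂ] TwistorModel l m k)
    (κ₀ κ : twistorOpens l m k a b) {p : BKSpace l m} {T : GrFrame (BKModel l m) k}
    (h : κ.1.base ∈ (extChartAt (bkI l m) p).source ∧ ∃ Z, κ.1.coordFiber p = T.graph Z) :
    holCoord Λ κ₀ (psi l m k a b κ) = Λ (localPsi (frame₁ κ₀) (frame₂ κ₀) p T
      (extChartAt (bkI l m) p κ.1.base, κ.1.slope p T)) :=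
  (congrArg Λ (localPsi_eq (frame₁ κ₀) (frame₂ κ₀) p T κ h)).symm

/-- A chart of the twistor space which is `holCoord ∘ ψ` is holomorphic. -/
theorem mfderiv_holCoord (hab : a + b = k) (Λ : TargetModel l m a b →L[ℂ] TwistorModel l m k)
    (κ₀ κ : twistorOpens l m k a b)
    {e : OpenPartialHomeomorph (BKTwistorSpace l m k) (TwistorModel l m k)}
    (he : e ∈ IsManifold.maximalAtlas (twistorI l m k) ∞ (BKTwistorSpace l m k))
    (hκ : κ.1 ∈ e.source)
    (h₁ : (frame₁ κ₀ (BKTwistorSpace.phi (a + 1) b κ.1)).1 ≠ 0)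
    (h₂ : (frame₂ κ₀ (BKTwistorSpace.phi a (b + 1) κ.1)).1 ≠ 0)
    (heq : ∀ κ' : twistorOpens l m k a b, κ'.1 ∈ e.source → e κ'.1 = holCoord Λ κ₀ (psi l m k a b κ'))
    (τ : TwistorModel l m k) :
    let de : TwistorModel l m k →L[ℝ] TwistorModel l m k :=
      mfderiv (twistorI l m k) (twistorI l m k) e κ.1
    de (κ.1.twistorJ bkPotential τ) = Complex.I • de τ := by
  intro de
  -- The source chart is centred at κ, where J is expressed, while the affine frames of the target
  -- stay those at κ₀.
  let f := localPsi (frame₁ κ₀) (frame₂ κ₀) κ.1.base κ.1.frameAt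
  have hc : BKTwistorSpace.center κ.1 ∈ localDomain (frame₁ κ₀) (frame₂ κ₀) κ.1.base κ.1.frameAt :=
    center_mem_localDomain h₁ h₂
  let c := chartAt (TwistorModel l m k) κ.1
  have hself : c κ.1 = BKTwistorSpace.center κ.1 := chart_self κ.1
  have h1 : writtenInExtChartAt (twistorI l m k) (twistorI l m k) κ.1 e =ᶠ[
      nhds (BKTwistorSpace.center κ.1)] fun t => Λ (f t) := by
    have h2 : c.target ∩ c.symm ⁻¹' (e.source ∩ twistorU l m k a b) ∈
        nhds (BKTwistorSpace.center κ.1) := by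
      rw [← hself]
      refine Filter.inter_mem (c.open_target.mem_nhds (c.map_source (mem_chart_source _ _)))
        ((c.continuousAt_symm (c.map_source (mem_chart_source _ _))).preimage_mem_nhds ?_)
      rw [c.left_inv (mem_chart_source _ _)]
      exact Filter.inter_mem (e.open_source.mem_nhds hκ)
        ((isOpen_twistorU l m k a b).mem_nhds κ.2)
    filter_upwards [h2] with t ht
    have h3 := heq ⟨c.symm t, ht.2.2⟩ ht.2.1
    have h4 := holCoord_psi Λ κ₀ ⟨c.symm t, ht.2.2⟩ (c.map_target ht.1)
    exact (h3.trans h4).trans (congrArg (fun s => Λ (f s)) (c.right_inv ht.1))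
  have h2 : MDifferentiableAt (twistorI l m k) (twistorI l m k) e κ.1 :=
    (contMDiffAt_of_mem_maximalAtlas he hκ).mdifferentiableAt (by simp)
  have h3 : HasFDerivAt (fun t => Λ (f t)) ((Λ.restrictScalars ℝ) ∘L
      fderiv ℝ f (BKTwistorSpace.center κ.1)) (BKTwistorSpace.center κ.1) :=
    (Λ.restrictScalars ℝ).hasFDerivAt.comp _
      ((contDiffAt_localPsi hc 1).differentiableAt one_ne_zero).hasFDerivAt
  have h4 := (mfderiv_eq_fderiv h2 (chart_self κ.1) h1).trans h3.fderiv
  have h5 := (fderiv_localPsi hab hc).2 τ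
  have h6 := fun τ => congrArg (fun A : TwistorModel l m k →L[ℝ] TwistorModel l m k => A τ) h4
  exact (h6 _).trans ((congrArg Λ h5).trans ((map_smul Λ _ _).trans
    (congrArg (Complex.I • ·) (h6 τ).symm)))

/-- `ψ` gives local holomorphic coordinates. -/
theorem exists_holomorphic_chart (hab : a + b = k) (κ₀ : twistorOpens l m k a b) :
    ∃ e ∈ IsManifold.maximalAtlas (twistorI l m k) ∞ (BKTwistorSpace l m k), κ₀.1 ∈ e.source ∧
      ∃ Λ : TargetModel l m a b →L[ℂ] TwistorModel l m k, ∀ κ ∈ e.source, κ ∈ twistorU l m k a b ∧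
        (frame₁ κ₀ (BKTwistorSpace.phi (a + 1) b κ)).1 ≠ 0 ∧
        (frame₂ κ₀ (BKTwistorSpace.phi a (b + 1) κ)).1 ≠ 0 ∧
        ∀ hκ : κ ∈ twistorU l m k a b, e κ = holCoord Λ κ₀ (psi l m k a b ⟨κ, hκ⟩) := by
  -- Complex linearity of dψ makes its image a complex subspace, so Λ can be chosen complex linear;
  -- hence Λ applied to affine coordinates is holomorphic on the target.
  obtain ⟨Λ, hΛ⟩ := exists_bijective_comp _ (injective_fderiv_chartPsi hab κ₀)
    (κ₀.1.twistorJ bkPotential) (fderiv_chartPsi_twistorJ hab κ₀)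
  have hD : IsOpen (chartDomain κ₀) := isOpen_localDomain κ₀.1.base κ₀.1.frameAt
  have hF : ∀ t ∈ chartDomain κ₀, ContDiffAt ℝ ∞ (fun t => Λ (chartPsi κ₀ t)) t := fun t ht =>
    (Λ.restrictScalars ℝ).contDiff.contDiffAt.comp t (contDiffAt_chartPsi κ₀ ht ∞)
  have hF' : HasFDerivAt (fun t => Λ (chartPsi κ₀ t)) ((Λ.restrictScalars ℝ) ∘L
      fderiv ℝ (chartPsi κ₀) (BKTwistorSpace.center κ₀.1)) (BKTwistorSpace.center κ₀.1) :=
    (Λ.restrictScalars ℝ).hasFDerivAt.comp _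
      ((contDiffAt_chartPsi κ₀ (center_mem_chartDomain κ₀) 1).differentiableAt
        one_ne_zero).hasFDerivAt
  obtain ⟨e, h1, h2, h3, h4, h5⟩ := exists_smooth_localInverse hD (center_mem_chartDomain κ₀) hF (by
    rw [hF'.fderiv]
    exact hΛ)
  refine ⟨(chartAt (TwistorModel l m k) κ₀.1).trans e, trans_mem_maximalAtlas κ₀.1 h4 h5,
    ⟨mem_chart_source _ _, ?_⟩, Λ, ?_⟩
  · change GrassmannBundle.chart κ₀.1 κ₀.1.frameAt κ₀.1 ∈ e.source
    rw [chart_self]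
    exact h1
  · rintro κ ⟨h6, h7⟩
    obtain ⟨h8, h9, h10⟩ := mem_twistorU_of_mem_localDomain (κ := κ₀.1) h6 (h2 h7)
    refine ⟨h8, h9, h10, fun hκ => ?_⟩
    exact (h3 _).trans (holCoord_psi Λ κ₀ ⟨κ, hκ⟩ h6).symm

/-- The affine neighbourhood of `ψ κ`. -/
def chartSource (κ : twistorOpens l m k a b) :
    Set (ℙ ℂ (LambdaVW l m (a + 1) b) × ℙ ℂ (LambdaVW l m a (b + 1))) :=
  (chartAt (ModelProd (ProjModel (LambdaVW l m (a + 1) b))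
    (ProjModel (LambdaVW l m a (b + 1)))) (psi l m k a b κ)).source

theorem isOpen_chartSource (κ : twistorOpens l m k a b) : IsOpen (chartSource κ) :=
  (chartAt (ModelProd (ProjModel (LambdaVW l m (a + 1) b))
    (ProjModel (LambdaVW l m a (b + 1)))) (psi l m k a b κ)).open_source

theorem psi_mem_chartSource (κ₀ κ : twistorOpens l m k a b)
    (h₁ : (frame₁ κ₀ (BKTwistorSpace.phi (a + 1) b κ.1)).1 ≠ 0)
    (h₂ : (frame₂ κ₀ (BKTwistorSpace.phi a (b + 1) κ.1)).1 ≠ 0) :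
    psi l m k a b κ ∈ chartSource κ₀ :=
  ⟨(ProjFrame.mk_mem_source _ κ.2.1).2 h₁, (ProjFrame.mk_mem_source _ κ.2.2).2 h₂⟩

end HolomorphicChart

end BKTwistor

end

theorem mainTheorem2 (l m k : ℕ) (hk : k ≤ l + m) :
    (∀ κ : BKTwistorSpace l m k, ∃ a b : ℕ, a + b = k ∧ κ ∈ twistorU l m k a b) ∧
    ∀ a b : ℕ, a + b = k →
      ∃ hU : IsOpen (twistorU l m k a b),
        let U : TopologicalSpace.Opens (BKTwistorSpace l m k) := ⟨twistorU l m k a b, hU⟩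
        let ψ : U → ℙ ℂ (LambdaVW l m (a + 1) b) × ℙ ℂ (LambdaVW l m a (b + 1)) :=
          twistorPsi l m k a b
        let IZ := 𝓘(ℝ, TwistorModel l m k)
        let IP := (𝓘(ℝ, ProjModel (LambdaVW l m (a + 1) b))).prod
          𝓘(ℝ, ProjModel (LambdaVW l m a (b + 1)))
        let dψ : ∀ κ : U, TwistorModel l m k →L[ℝ] TargetModel l m a b :=
          fun κ => mfderiv IZ IP ψ κ
        Topology.IsEmbedding ψ ∧
        ContMDiff IZ IP ∞ ψ ∧
        (∀ κ : U, Function.Injective (dψ κ)) ∧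
        (∀ (κ : U) (t : TwistorModel l m k),
          dψ κ (κ.1.twistorJ bkPotential t) = Complex.I • dψ κ t) ∧
        ∀ κ₀ ∈ U, ∃ e ∈ IsManifold.maximalAtlas IZ ∞ (BKTwistorSpace l m k),
          κ₀ ∈ e.source ∧ e.source ⊆ U ∧
          (∃ O : Set (ℙ ℂ (LambdaVW l m (a + 1) b) × ℙ ℂ (LambdaVW l m a (b + 1))), IsOpen O ∧
            ∃ g : ℙ ℂ (LambdaVW l m (a + 1) b) × ℙ ℂ (LambdaVW l m a (b + 1)) →
                TwistorModel l m k,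
              MDifferentiableOn ((𝓘(ℂ, ProjModel (LambdaVW l m (a + 1) b))).prod
                𝓘(ℂ, ProjModel (LambdaVW l m a (b + 1)))) 𝓘(ℂ, TwistorModel l m k) g O ∧
              ∀ κ : U, κ.1 ∈ e.source → ψ κ ∈ O ∧ e κ.1 = g (ψ κ)) ∧
          ∀ κ ∈ e.source, ∀ t : TwistorModel l m k,
            let de : TwistorModel l m k →L[ℝ] TwistorModel l m k := mfderiv IZ IZ e κ
            de (κ.twistorJ bkPotential t) = Complex.I • de t := by
  refine ⟨BKTwistorSpace.exists_mem_twistorU, fun a b hab => ⟨isOpen_twistorU l m k a b, ?_⟩⟩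
  refine ⟨isEmbedding_psi hk hab, contMDiff_psi, fun κ => ?_, fun κ t => ?_, fun κ₀ hκ₀ => ?_⟩
  · exact injective_mfderiv_psi hab κ
  · exact mfderiv_psi_twistorJ hab κ t
  · obtain ⟨e, he, h1, Λ, h2⟩ := exists_holomorphic_chart hab ⟨κ₀, hκ₀⟩
    refine ⟨e, he, h1, fun κ hκ => (h2 κ hκ).1, ⟨chartSource ⟨κ₀, hκ₀⟩,
      isOpen_chartSource ⟨κ₀, hκ₀⟩, holCoord Λ ⟨κ₀, hκ₀⟩,
      mdifferentiableOn_holCoord Λ ⟨κ₀, hκ₀⟩, fun κ hκ => ?_⟩, fun κ hκ t => ?_⟩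
    · obtain ⟨h3, h4, h5, h6⟩ := h2 κ.1 hκ
      exact ⟨psi_mem_chartSource ⟨κ₀, hκ₀⟩ κ h4 h5, h6 h3⟩
    · obtain ⟨h3, h4, h5, -⟩ := h2 κ hκ
      exact mfderiv_holCoord hab Λ ⟨κ₀, hκ₀⟩ ⟨κ, h3⟩ he hκ h4 h5
        (fun κ' hκ' => (h2 κ'.1 hκ').2.2.2 κ'.2) t
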